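/- **Monotonicity formula.** Let $m,n\ge 2$, let $Q$ be a positive integer, and let $\mathbb B_r(x)\subset\mathbb R^m$ be the ball of radius $r$ about $x$. Let $\underline Q(\mathbb R^n)$ be the set of unordered $Q$-tuples $\sum_{i=1}^Q[[p_i]]$ of points of $\mathbb R^n$ with the metric $\mathcal G(\sum[[p_i]],\sum[[q_i]])=\min_\tau(\sum_i|p_i-q_{\tau(i)}|^2)^{1/2}$ ($\tau$ ranging over permutations), and $\underline Q(\mathbb S^{n-1})$ the subset with all $p_i\in\mathbb S^{n-1}$. Let $\xi:\underline Q(\mathbb R^n)\to\mathbb R^N$ be Almgren's bi-Lipschitz embedding (in White's form: for suitable orthonormal bases of $\mathbb R^n$, $K$ in number, it lists in nondecreasing order, for each basis vector $e$, the numbers $\langle p_i,e\rangle$, multiplied by $K^{-1/2}$), and let $\mathcal Y_2(\mathbb B_1(0),\underline Q(\mathbb S^{n-1}))$ be the class of maps $u:\mathbb B_1(0)\to\underline Q(\mathbb S^{n-1})$ with $\xi\circ u\in W^{1,2}(\mathbb B_1(0);\mathbb R^N)$; it does not depend on the choice of bases. Such a $u$ is approximately differentiable at $y$ if $u(y)=\sum[[a_i]]$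 and there are linear maps $L_i:\mathbb R^m\to\mathbb R^n$, with $L_i=L_j$ whenever $a_i=a_j$, such that $\operatorname{ap\,lim}_{z\to y}\mathcal G(u(z),\sum[[a_i+L_i(z-y)]])/|z-y|=0$; then $|D_vu(y)|^2=\sum_i|L_iv|^2$ and $|Du(y)|^2=\sum_{j=1}^m|D_{e_j}u(y)|^2$, where $e_1,\dots,e_m$ is the standard basis of $\mathbb R^m$. The map $u$ is Dir-minimizing if $\int_{\mathbb B_1(0)}|Du|^2\le\int_{\mathbb B_1(0)}|Dv|^2$ for every $v\in\mathcal Y_2(\mathbb B_1(0),\underline Q(\mathbb S^{n-1}))$ that agrees with $u$ a.e. near $\partial\mathbb B_1(0)$ (in particular, every map that minimizes the energy among maps with its own boundary trace is Dir-minimizing). Let $u\in\mathcal Y_2(\mathbb B_1(0),\underline Q(\mathbb S^{n-1}))$ be Dir-minimizing, let $\mathbb B_{\rho_0}(x)\subset\mathbb B_1(0)$ and $0<\sigma<\rho<\rho_0$. Then $u$ is approximately differentiable a.e. in $\mathbb B_1(0)$, the functions integrated below are integrable, and $$\rho^{2-m}\int_{\mathbb B_\rho(x)}|Du|^2-\sigma^{2-m}\int_{\mathbb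 B_\sigma(x)}|Du|^2=2\int_{\mathbb B_\rho(x)\setminus\mathbb B_\sigma(x)}R^{2-m}\left|\frac{\partial u}{\partial R}\right|^2,$$ where $R=|y-x|$ and $|\partial u/\partial R|^2(y)=|D_vu(y)|^2$ with $v=(y-x)/|y-x|$. -/

import Mathlib

open MeasureTheory Filter Topology
open scoped ContDiff ENNReal

noncomputable section

namespace MultiValued

/-- The Euclidean space `ℝ^k`. -/
abbrev E (k : ℕ) : Type := EuclideanSpace ℝ (Fin k)

/-- Unordered `Q`-tuples `∑ [[pᵢ]]` of points of `ℝ^n`, with multiplicity. -/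
abbrev QPoint (Q n : ℕ) : Type := Sym (E n) Q

/-- The `Q`-point `∑ [[aᵢ]]`. -/
def QPoint.ofFn {Q n : ℕ} (a : Fin Q → E n) : QPoint Q n :=
  ⟨Multiset.map a Finset.univ.val, by simp⟩

/-- The metric `𝒢(p, q) = min (∑ |aᵢ - bᵢ|²)^{1/2}`, the minimum being over all enumerations
`a` of `p` and `b` of `q`. -/
def QPoint.gdist {Q n : ℕ} (p q : QPoint Q n) : ℝ :=
  sInf {d : ℝ | ∃ a b : Fin Q → E n,
    p = QPoint.ofFn a ∧ q = QPoint.ofFn b ∧ d = Real.sqrt (∑ i, ‖a i - b i‖ ^ 2)}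

/-- The projections `⟨pᵢ, e⟩` of the points of `p` to the line spanned by `e`, listed in
nondecreasing order. -/
def QPoint.sortedProj {Q n : ℕ} (e : E n) (p : QPoint Q n) (i : Fin Q) : ℝ :=
  (Multiset.sort (Multiset.map (fun z : E n => inner ℝ e z) p.1)).get
    (Fin.cast (by rw [Multiset.length_sort, Multiset.card_map, p.2]) i)

/-- The Almgren–White map `ξ` attached to `K` orthonormal bases of `ℝ^n`: all the ordered
projections of a `Q`-point to the lines spanned by the basis vectors, times `K^{-1/2}`. -/
def xi {K Q n : ℕ} (b : Fin K → OrthonormalBasis (Fin n) ℝ (E n)) (p : QPoint Q n) :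
    EuclideanSpace ℝ (Fin K × Fin n × Fin Q) :=
  WithLp.toLp 2 fun t => (Real.sqrt K)⁻¹ * QPoint.sortedProj (b t.1 t.2.1) p t.2.2

/-- `ξ` is bi-Lipschitz onto its image. -/
def IsBiLipschitz {Q n : ℕ} {F : Type*} [NormedAddCommGroup F] (ξ : QPoint Q n → F) : Prop :=
  ∃ c C : ℝ, 0 < c ∧ 0 < C ∧ ∀ p q : QPoint Q n,
    c * QPoint.gdist p q ≤ ‖ξ p - ξ q‖ ∧ ‖ξ p - ξ q‖ ≤ C * QPoint.gdist p q

/-- `f ∈ W^{1,2}(Ω; F)`: `f` and its weak gradient `g` are square integrable on `Ω`. -/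
def MemW12 {m : ℕ} {F : Type*} [NormedAddCommGroup F] [NormedSpace ℝ F]
    (Ω : Set (E m)) (f : E m → F) : Prop :=
  MemLp f 2 (volume.restrict Ω) ∧
  ∃ g : E m → (E m →L[ℝ] F), MemLp g 2 (volume.restrict Ω) ∧
    ∀ φ : E m → ℝ, ContDiff ℝ ∞ φ → HasCompactSupport φ → tsupport φ ⊆ Ω → ∀ v : E m,
      ∫ y in Ω, (fderiv ℝ φ y v) • f y = - ∫ y in Ω, φ y • g y v

/-- `u ∈ 𝒴₂(Ω, Q(𝕊^{n-1}))`: almost every value of `u` consists of unit vectors, and `ξ ∘ u` is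
in `W^{1,2}(Ω)` for a bi-Lipschitz embedding `ξ` as above (the class does not depend on which). -/
def MemY2Sphere {m Q n : ℕ} (Ω : Set (E m)) (u : E m → QPoint Q n) : Prop :=
  (∀ᵐ y ∂(volume.restrict Ω), ∀ p ∈ u y, ‖p‖ = 1) ∧
  ∃ (K : ℕ) (b : Fin K → OrthonormalBasis (Fin n) ℝ (E n)),
    IsBiLipschitz (xi (Q := Q) b) ∧ MemW12 Ω (fun y => xi b (u y))

/-- `L₁, …, L_Q` is an approximate derivative of `u` at `x`: one can write `u(x) = ∑ [[aᵢ]]` with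
`Lᵢ = Lⱼ` whenever `aᵢ = aⱼ`, and
`ap lim_{y → x} 𝒢(u(y), ∑ [[aᵢ + Lᵢ (y - x)]]) / |y - x| = 0`. -/
def HasApproxDerivAt {m Q n : ℕ} (u : E m → QPoint Q n) (L : Fin Q → (E m →L[ℝ] E n))
    (x : E m) : Prop :=
  ∃ a : Fin Q → E n, u x = QPoint.ofFn a ∧ (∀ i j, a i = a j → L i = L j) ∧
    ∀ ε : ℝ, 0 < ε →
      Tendsto (fun r : ℝ =>
          volume {y ∈ Metric.ball x r |
            ε * ‖y - x‖ < QPoint.gdist (u y) (QPoint.ofFn fun i => a i + L i (y - x))} /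
          volume (Metric.ball x r))
        (𝓝[>] 0) (𝓝 0)

/-- `u` is approximately differentiable at `x`. -/
def ApproxDifferentiableAt {m Q n : ℕ} (u : E m → QPoint Q n) (x : E m) : Prop :=
  ∃ L : Fin Q → (E m →L[ℝ] E n), HasApproxDerivAt u L x

open Classical in
/-- The approximate derivative of `u` at `x` (unique up to the order of the `Lᵢ`); zero where
`u` is not approximately differentiable. -/
def approxDeriv {m Q n : ℕ} (u : E m → QPoint Q n) (x : E m) : Fin Q → (E m →L[ℝ] E n) :=
  if h : ApproxDifferentiableAt u x then h.choose else 0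

/-- `|D_v u(x)|² = ∑ᵢ |Lᵢ v|²`. -/
def dirDerivSq {m Q n : ℕ} (u : E m → QPoint Q n) (x v : E m) : ℝ :=
  ∑ i, ‖approxDeriv u x i v‖ ^ 2

/-- `|Du(x)|²`, the sum of `|D_v u(x)|²` over the standard basis. -/
def derivSq {m Q n : ℕ} (u : E m → QPoint Q n) (x : E m) : ℝ :=
  ∑ j : Fin m, dirDerivSq u x (EuclideanSpace.single j 1)

/-- `|∂u/∂R|²` at `y`, for the radial direction `(y - x) / |y - x|`. -/
def radialDerivSq {m Q n : ℕ} (u : E m → QPoint Q n) (x y : E m) : ℝ :=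
  dirDerivSq u y (‖y - x‖⁻¹ • (y - x))

/-- The Dirichlet energy `Dir(u; A) = ∫_A |Du|²`. -/
def dirEnergy {m Q n : ℕ} (u : E m → QPoint Q n) (A : Set (E m)) : ℝ≥0∞ :=
  ∫⁻ y in A, ENNReal.ofReal (derivSq u y)

/-- `u : 𝔹₁ → Q(𝕊^{n-1})` is Dirichlet minimizing: it has least energy among all maps of the same
class that agree with it near `∂𝔹₁`. (A minimizer among all maps with the same trace on `∂𝔹₁` is
one in this sense.) -/
def IsDirMinimizing {m Q n : ℕ} (u : E m → QPoint Q n) : Prop :=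
  MemY2Sphere (Metric.ball 0 1) u ∧
  ∀ v : E m → QPoint Q n, MemY2Sphere (Metric.ball 0 1) v →
    (∃ r : ℝ, r < 1 ∧
      ∀ᵐ y ∂(volume.restrict (Metric.ball (0 : E m) 1 \ Metric.ball 0 r)), v y = u y) →
    dirEnergy u (Metric.ball 0 1) ≤ dirEnergy v (Metric.ball 0 1)

end MultiValued

end

noncomputable section

namespace MultiValued

/-! ### Enumerations of `Q`-points -/

/-! The formula expresses stationarity under variations of the domain. For a compactly supported
field `X`, the map `id + tX` is a diffeomorphism of the unit ball for small `t`, and composing `u`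
with its inverse gives an admissible competitor: values of `u` are only moved around, so neither the
sphere constraint nor the lack of linear structure on `Q`-tuples interferes. Differentiating the
energy at `t = 0` yields `∫ (div X |Du|² - 2 ∑ⱼ ⟨Dⱼu, D_{∂ⱼX} u⟩) = 0`, where the products are read
off from the weak gradient of `ξ ∘ u` (`IsDirMinimizing.integral_varDensity_eq_zero`). The
ingredients are the chain rule `IsWeakGrad.comp_inv`, the diffeomorphisms of
`exists_smoothTransform`, and the expansion `exists_energy_expansion`, whose error is uniform in the
gradient.

Now take `X = η(R²)(y - x)` with `η' = -½ χ(τ) τ^{-m/2}` and `η = 0` beyond `ρ²`. When `χ` tends to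
the indicator of `(σ², ρ²)`, `(m - 2) η(R²)` tends to `max(R, σ)^{2-m} - ρ^{2-m}` inside the ball of
radius `ρ`. Hence the coefficient of `|Du|²` is `σ^{2-m} - ρ^{2-m}` in the inner ball and `-ρ^{2-m}`
in the annulus, where the term in `η'` cancels `R^{2-m}` and leaves `2 R^{2-m} |∂u/∂R|²`. This is
the formula itself, with no differentiation in the radius (`IsDirMinimizing.integral_sharp_eq_zero`,
`sharp_integrand_eq`).

The calculation is carried out for the weak gradient `g` of `ξ ∘ u`; the bridge to `u` is `|D_v u|²
= |g v|²` almost everywhere (`ae_dirDerivSq_eq`). A Sobolev function has its weak gradient as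
approximate derivative almost everywhere (`ae_isLittleO_of_isWeakGrad`): at a Lebesgue point of the
gradient, integrate along segments, mollify, and conclude with Fatou and Chebyshev. Coordinates of
`ξ` are sorted projections, and sorted projections that tie at a point have equal derivatives there,
so the expansions can be unsorted into expansions of the individual points. Parseval in each of the
`K` bases, averaged over the bases, gives the equality of norms. -/

theorem exists_perm_of_map_univ_eq {Q : ℕ} {α : Type*} {a b : Fin Q → α}
    (h : Multiset.map a Finset.univ.val = Multiset.map b Finset.univ.val) :
    ∃ τ : Equiv.Perm (Fin Q), ∀ i, b (τ i) = a i := by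
  classical
  -- The multiplicity of `c` counts the indices in the fibre over `c`, so corresponding fibres are
  -- equinumerous, and bijections between them glue to a permutation.
  have hcard : ∀ c, Nonempty ({i // a i = c} ≃ {i // b i = c}) := by
    intro c
    rw [← Fintype.card_eq, Fintype.card_subtype, Fintype.card_subtype]
    have := congrArg (Multiset.count c) h
    rw [Multiset.count_map, Multiset.count_map] at this
    simpa [Finset.card, Finset.filter, eq_comm] using this
  have e := fun c => (hcard c).some
  exact ⟨Equiv.ofFiberEquiv e, fun i => Equiv.ofFiberEquiv_map e i⟩

theorem QPoint.exists_ofFn {Q n : ℕ} (p : QPoint Q n) : ∃ a : Fin Q → E n, p = QPoint.ofFn a := by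
  obtain ⟨s, hs⟩ := p
  induction s using Quotient.inductionOn with
  | h l =>
    have hl : l.length = Q := by simpa using hs
    subst hl
    refine ⟨l.get, Subtype.ext ?_⟩
    simp only [QPoint.ofFn, Fin.univ_val_map, List.ofFn_get]
    rfl

theorem QPoint.exists_perm_of_ofFn_eq {Q n : ℕ} {a b : Fin Q → E n}
    (h : QPoint.ofFn a = QPoint.ofFn b) : ∃ τ : Equiv.Perm (Fin Q), ∀ i, b (τ i) = a i :=
  exists_perm_of_map_univ_eq (congrArg Subtype.val h)

theorem QPoint.ofFn_comp_perm {Q n : ℕ} (a : Fin Q → E n) (τ : Equiv.Perm (Fin Q)) :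
    QPoint.ofFn (fun i => a (τ i)) = QPoint.ofFn a := by
  refine Subtype.ext ?_
  have := Multiset.map_univ_val_equiv τ
  simp only [QPoint.ofFn]
  conv_rhs => rw [← this]
  rw [Multiset.map_map]
  rfl

theorem QPoint.gdist_le {Q n : ℕ} (a b : Fin Q → E n) :
    QPoint.gdist (QPoint.ofFn a) (QPoint.ofFn b) ≤ Real.sqrt (∑ i, ‖a i - b i‖ ^ 2) :=
  csInf_le ⟨0, by rintro _ ⟨a, b, -, -, rfl⟩; exact Real.sqrt_nonneg _⟩ ⟨a, b, rfl, rfl, rfl⟩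

theorem QPoint.gdist_nonneg {Q n : ℕ} (p q : QPoint Q n) : 0 ≤ QPoint.gdist p q := by
  refine Real.sInf_nonneg ?_
  rintro _ ⟨a, b, -, -, rfl⟩
  exact Real.sqrt_nonneg _

/-- The minimum in the definition of `𝒢` is attained, with a given enumeration of one point. -/
theorem QPoint.exists_gdist_eq {Q n : ℕ} (p : QPoint Q n) (a : Fin Q → E n) :
    ∃ b : Fin Q → E n, p = QPoint.ofFn b ∧
      QPoint.gdist p (QPoint.ofFn a) = Real.sqrt (∑ i, ‖b i - a i‖ ^ 2) := by
  obtain ⟨b₀, hb₀⟩ := p.exists_ofFn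
  set S : Set ℝ := {d : ℝ | ∃ a' b' : Fin Q → E n,
    p = QPoint.ofFn a' ∧ QPoint.ofFn a = QPoint.ofFn b' ∧
      d = Real.sqrt (∑ i, ‖a' i - b' i‖ ^ 2)} with hS
  -- Reindexing both enumerations so that the second becomes `a` leaves only a permutation of `b₀`
  -- free. There are thus finitely many candidate distances, and the infimum is attained.
  have hsub : S ⊆ Set.range fun τ : Equiv.Perm (Fin Q) =>
      Real.sqrt (∑ i, ‖b₀ (τ i) - a i‖ ^ 2) := by
    rintro _ ⟨a', b', ha', hb', rfl⟩
    obtain ⟨τ, hτ⟩ := QPoint.exists_perm_of_ofFn_eq (ha'.symm.trans hb₀)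
    obtain ⟨τ', hτ'⟩ := QPoint.exists_perm_of_ofFn_eq hb'
    refine ⟨τ'.trans τ, ?_⟩
    rw [← Equiv.sum_comp τ' fun i => ‖a' i - b' i‖ ^ 2]
    simp [hτ, hτ']
  have hmem : sInf S ∈ S :=
    Set.Nonempty.csInf_mem ⟨_, b₀, a, hb₀, rfl, rfl⟩ ((Set.finite_range _).subset hsub)
  obtain ⟨τ, hτ⟩ := hsub hmem
  refine ⟨fun i => b₀ (τ i), ?_, hτ.symm⟩
  rw [QPoint.ofFn_comp_perm, hb₀]

theorem QPoint.sortedProj_mono {Q n : ℕ} (e : E n) (p : QPoint Q n) :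
    Monotone (QPoint.sortedProj e p) := by
  intro i j hij
  have := Multiset.pairwise_sort (Multiset.map (fun z : E n => inner ℝ e z) p.1) (· ≤ ·)
  exact (List.sortedLE_iff_pairwise.2 this).monotone_get hij

/-- Sorting only rearranges the projections. The permutation depends on `e` and on the enumeration,
so it may jump as the point varies; later arguments use only its existence at each point. -/
theorem QPoint.exists_perm_sortedProj {Q n : ℕ} (e : E n) (a : Fin Q → E n) :
    ∃ τ : Equiv.Perm (Fin Q), ∀ i,
      QPoint.sortedProj e (QPoint.ofFn a) (τ i) = inner ℝ e (a i) := by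
  refine exists_perm_of_map_univ_eq ?_
  have h := Multiset.sort_eq (Multiset.map (fun z : E n => inner ℝ e z) (QPoint.ofFn a).1) (· ≤ ·)
  have hl : (Multiset.sort (Multiset.map (fun z : E n => inner ℝ e z)
      (QPoint.ofFn a).1)).length = Q := by simp [QPoint.ofFn]
  have h2 : Multiset.map (QPoint.sortedProj e (QPoint.ofFn a)) Finset.univ.val
      = Multiset.map (fun z : E n => inner ℝ e z) (QPoint.ofFn a).1 := by
    rw [← h, Fin.univ_val_map]
    congr 1
    refine List.ext_get (by simp [QPoint.ofFn]) fun k h1 h2 => ?_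
    simp only [List.get_eq_getElem, List.getElem_ofFn, QPoint.sortedProj, Fin.val_cast]
  rw [h2]
  simp [QPoint.ofFn, Function.comp_def]

/-! ### The approximate neighbourhood filter -/

/-- The filter of sets whose complement has density zero at `y`. -/
def apNhds {m : ℕ} (y : E m) : Filter (E m) where
  sets := {S | Tendsto (fun r : ℝ => volume (Sᶜ ∩ Metric.ball y r) / volume (Metric.ball y r))
    (𝓝[>] 0) (𝓝 0)}
  univ_sets := by simp
  sets_of_superset := by
    intro S T hS hST
    refine tendsto_of_tendsto_of_tendsto_of_le_of_le tendsto_const_nhds hS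
      (fun _ => bot_le) fun r => ?_
    dsimp only
    gcongr
  inter_sets := by
    intro S T hS hT
    have h := Tendsto.add hS hT
    rw [add_zero] at h
    refine tendsto_of_tendsto_of_tendsto_of_le_of_le tendsto_const_nhds h
      (fun _ => bot_le) fun r => ?_
    dsimp only
    rw [← ENNReal.add_div, Set.compl_inter, Set.union_inter_distrib_right]
    gcongr
    exact measure_union_le _ _

theorem eventually_apNhds_iff {m : ℕ} {y : E m} {P : E m → Prop} :
    (∀ᶠ z in apNhds y, P z) ↔
      Tendsto (fun r : ℝ => volume {z ∈ Metric.ball y r | ¬ P z} / volume (Metric.ball y r))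
        (𝓝[>] 0) (𝓝 0) := by
  have : ∀ r, {z | P z}ᶜ ∩ Metric.ball y r = {z ∈ Metric.ball y r | ¬ P z} := by
    intro r; ext z; simp [and_comm]
  simp only [← this]
  rfl

theorem apNhds_le_nhds {m : ℕ} (y : E m) : apNhds y ≤ 𝓝 y := by
  intro S hS
  obtain ⟨ε, hε, hS⟩ := Metric.mem_nhds_iff.1 hS
  refine Tendsto.congr' (f₁ := fun _ => 0) ?_ tendsto_const_nhds
  filter_upwards [Ioo_mem_nhdsGT hε] with r hr
  have : Sᶜ ∩ Metric.ball y r = ∅ := by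
    ext z
    simp only [Set.mem_inter_iff, Set.mem_compl_iff, Set.mem_empty_iff_false, iff_false, not_and]
    exact fun h hz => h (hS (Metric.ball_subset_ball hr.2.le hz))
  simp [this]

/-- A linear functional that is nonnegative to first order on a set of density one vanishes. -/
theorem eq_zero_of_eventually_apNhds {m : ℕ} {y : E m} {l : E m →L[ℝ] ℝ}
    (h : ∀ ε : ℝ, 0 < ε → ∀ᶠ z in apNhds y, -(ε * ‖z - y‖) ≤ l (z - y)) : l = 0 := by
  by_contra hl
  obtain ⟨w₀, hw₀⟩ : ∃ w, l w ≠ 0 := by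
    by_contra! H
    exact hl (ContinuousLinearMap.ext H)
  obtain ⟨w, hw⟩ : ∃ w, l w < 0 := by
    rcases lt_or_gt_of_ne hw₀ with h | h
    · exact ⟨w₀, h⟩
    · exact ⟨-w₀, by simpa using h⟩
  have hwn : 0 < ‖w‖ := norm_pos_iff.2 fun h0 => by simp [h0] at hw
  obtain ⟨ε, hε, hεw⟩ : ∃ ε : ℝ, 0 < ε ∧ l w < -(ε * ‖w‖) := by
    refine ⟨-l w / (2 * ‖w‖), by have := neg_pos.2 hw; positivity, ?_⟩
    have : -l w / (2 * ‖w‖) * ‖w‖ = -l w / 2 := by field_simp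
    rw [this]; linarith
  -- This set is invariant under positive dilations, so a ball inside it, shrunk towards `y`, fills
  -- a fixed proportion of every `ball y r`.
  have hopen : IsOpen {v : E m | l v < -(ε * ‖v‖)} :=
    isOpen_lt l.continuous (by fun_prop)
  obtain ⟨δ, hδ, hball⟩ := Metric.isOpen_iff.1 hopen w hεw
  -- Points of `ball w δ` have norm below `c`, so scaling by `r / c` brings them into the ball of
  -- radius `r`.
  set c : ℝ := ‖w‖ + δ with hc
  have hcpos : 0 < c := by positivity
  have h1 := eventually_apNhds_iff.1 (h ε hε)
  have hvol1 : volume (Metric.ball (0 : E m) 1) ≠ 0 :=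
    (Metric.measure_ball_pos volume _ one_pos).ne'
  have hvol1' : volume (Metric.ball (0 : E m) 1) ≠ ⊤ := measure_ball_lt_top.ne
  have hlow : ∀ r : ℝ, 0 < r → ENNReal.ofReal ((δ / c) ^ Module.finrank ℝ (E m)) ≤
      volume {z ∈ Metric.ball y r | ¬ -(ε * ‖z - y‖) ≤ l (z - y)} / volume (Metric.ball y r) := by
    intro r hr
    have hsub : Metric.ball (y + (r / c) • w) (r * (δ / c)) ⊆
        {z ∈ Metric.ball y r | ¬ -(ε * ‖z - y‖) ≤ l (z - y)} := by
      intro z hz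
      rw [mem_ball_iff_norm] at hz
      set v := (c / r) • (z - y) with hv
      have hzv : z - y = (r / c) • v := by
        rw [hv, smul_smul]; field_simp; simp
      have hvw : ‖v - w‖ < δ := by
        have : z - (y + (r / c) • w) = (r / c) • (v - w) := by
          rw [smul_sub, ← hzv]; abel
        rw [this, norm_smul, Real.norm_of_nonneg (by positivity)] at hz
        have h3 : r * (δ / c) = r / c * δ := by ring
        rw [h3] at hz
        exact lt_of_mul_lt_mul_left hz (by positivity)
      have hvC : l v < -(ε * ‖v‖) := hball (mem_ball_iff_norm.2 hvw)
      have hvn : ‖v‖ < c := by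
        have := norm_le_norm_add_norm_sub' v w
        linarith
      refine ⟨?_, ?_⟩
      · rw [mem_ball_iff_norm, hzv, norm_smul, Real.norm_of_nonneg (by positivity)]
        calc r / c * ‖v‖ < r / c * c := by gcongr
          _ = r := by field_simp
      · rw [hzv, norm_smul, Real.norm_of_nonneg (by positivity), map_smul, smul_eq_mul, not_le]
        have : 0 < r / c := by positivity
        nlinarith
    rw [ENNReal.le_div_iff_mul_le (Or.inl (Metric.measure_ball_pos volume _ hr).ne')
      (Or.inl measure_ball_lt_top.ne)]
    refine le_trans (le_of_eq ?_) (measure_mono hsub)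
    rw [Measure.addHaar_ball_of_pos volume y hr,
      Measure.addHaar_ball_of_pos volume _ (show 0 < r * (δ / c) by positivity), mul_pow, ENNReal.ofReal_mul (by positivity)]
    ring
  have h2 := ge_of_tendsto h1 (by
    filter_upwards [self_mem_nhdsWithin] with r hr using hlow r hr)
  have : 0 < (δ / c) ^ Module.finrank ℝ (E m) := by positivity
  simp only [nonpos_iff_eq_zero, ENNReal.ofReal_eq_zero] at h2
  linarith

/-- Applied to the difference of two first order expansions, this gives uniqueness of approximate
derivatives. -/
theorem eq_zero_of_isLittleO_apNhds {m : ℕ} {y : E m} {l : E m →L[ℝ] ℝ}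
    (h : (fun z => l (z - y)) =o[apNhds y] fun z => z - y) : l = 0 := by
  refine eq_zero_of_eventually_apNhds (y := y) fun ε hε => ?_
  filter_upwards [h.def hε] with z hz
  have := (abs_le.1 (Real.norm_eq_abs _ ▸ hz)).1
  linarith

/-! ### Approximate differentiability through sorted projections -/

/-- Turns the density condition into a little-o along `apNhds y`, so that the calculus of
asymptotics applies. -/
theorem hasApproxDerivAt_iff {m Q n : ℕ} {u : E m → QPoint Q n} {L : Fin Q → (E m →L[ℝ] E n)}
    {y : E m} : HasApproxDerivAt u L y ↔
      ∃ a : Fin Q → E n, u y = QPoint.ofFn a ∧ (∀ i j, a i = a j → L i = L j) ∧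
        (fun z => QPoint.gdist (u z) (QPoint.ofFn fun i => a i + L i (z - y)))
          =o[apNhds y] fun z => z - y := by
  refine exists_congr fun a => and_congr_right fun _ => and_congr_right fun _ => ?_
  rw [Asymptotics.isLittleO_iff]
  refine forall_congr' fun ε => forall_congr' fun hε => ?_
  rw [eventually_apNhds_iff]
  simp [abs_of_nonneg (QPoint.gdist_nonneg _ _)]

theorem tendsto_sub_apNhds {m : ℕ} (y : E m) : Tendsto (fun z => z - y) (apNhds y) (𝓝 0) := by
  have : Tendsto (fun z => z - y) (𝓝 y) (𝓝 (y - y)) :=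
    (continuous_id.sub continuous_const).tendsto y
  rw [sub_self] at this
  exact this.mono_left (apNhds_le_nhds y)

theorem tendsto_clm_sub_apNhds {m : ℕ} {F : Type*} [NormedAddCommGroup F] [NormedSpace ℝ F]
    (y : E m) (l : E m →L[ℝ] F) : Tendsto (fun z => l (z - y)) (apNhds y) (𝓝 0) := by
  have := (l.continuous.tendsto 0).comp (tendsto_sub_apNhds y)
  rwa [map_zero] at this

section SortedProj

variable {m Q n : ℕ} {e : E n} {y : E m} {G : Fin Q → (E m →L[ℝ] ℝ)}

/-- The derivatives of sorted projections that coincide at `y` coincide. -/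
theorem sortedProj_deriv_eq {u : E m → QPoint Q n}
    (h : ∀ s, (fun z => QPoint.sortedProj e (u z) s - QPoint.sortedProj e (u y) s - G s (z - y))
      =o[apNhds y] fun z => z - y) {s s' : Fin Q}
    (hs : QPoint.sortedProj e (u y) s = QPoint.sortedProj e (u y) s') : G s = G s' := by
  wlog hle : s ≤ s' generalizing s s'
  · exact (this hs.symm (le_of_not_ge hle)).symm
  -- For `s ≤ s'` the difference of the two sorted projections is nonnegative and vanishes at `y`,
  -- so `G s' - G s` is nonnegative to first order, which forces it to be zero.
  refine (sub_eq_zero.1 (eq_zero_of_eventually_apNhds (y := y) fun ε hε => ?_)).symm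
  filter_upwards [(h s).def (half_pos hε), (h s').def (half_pos hε)] with z hz hz'
  have hmono := QPoint.sortedProj_mono e (u z) hle
  rw [Real.norm_eq_abs, abs_le] at hz hz'
  simp only [_root_.sub_apply]
  linarith [hz'.1, hz'.2, hz.1, hz.2]

/-- First order expansions of the sorted projections of `∑ [[pᵢ(z)]]` are first order expansions
of the projections of the `pᵢ`. -/
theorem inner_sub_isLittleO {a : Fin Q → E n} {p : E m → Fin Q → E n}
    (hp : ∀ i, Tendsto (fun z => p z i) (apNhds y) (𝓝 (a i)))
    (h : ∀ s, (fun z => QPoint.sortedProj e (QPoint.ofFn (p z)) s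
      - QPoint.sortedProj e (QPoint.ofFn a) s - G s (z - y)) =o[apNhds y] fun z => z - y)
    (htie : ∀ s s', QPoint.sortedProj e (QPoint.ofFn a) s = QPoint.sortedProj e (QPoint.ofFn a) s' →
      G s = G s')
    {i : Fin Q} {s : Fin Q} (his : QPoint.sortedProj e (QPoint.ofFn a) s = inner ℝ e (a i)) :
    (fun z => inner ℝ e (p z i - a i) - G s (z - y)) =o[apNhds y] fun z => z - y := by
  have hy := tendsto_sub_apNhds y
  have hsp : ∀ s, Tendsto (fun z => QPoint.sortedProj e (QPoint.ofFn (p z)) s) (apNhds y)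
      (𝓝 (QPoint.sortedProj e (QPoint.ofFn a) s)) := by
    intro s
    have h1 := (h s).trans_tendsto hy
    have h3 := (h1.add (tendsto_clm_sub_apNhds y (G s))).add_const (QPoint.sortedProj e (QPoint.ofFn a) s)
    simpa only [sub_add_cancel, add_zero, zero_add] using h3
  have hin : Tendsto (fun z => (inner ℝ e (p z i) : ℝ)) (apNhds y) (𝓝 (inner ℝ e (a i))) :=
    tendsto_const_nhds.inner (hp i)
  -- Sorted projections whose value at `y` differs from that of point `i` stay apart from it nearby.
  -- The rank of point `i` may therefore vary with `z`, but only among ranks tied at `y`, whose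
  -- derivatives agree.
  have hsep : ∀ᶠ z in apNhds y, ∀ s', QPoint.sortedProj e (QPoint.ofFn (p z)) s'
      = inner ℝ e (p z i) → QPoint.sortedProj e (QPoint.ofFn a) s' = inner ℝ e (a i) := by
    rw [eventually_all]
    intro s'
    by_cases hs' : QPoint.sortedProj e (QPoint.ofFn a) s' = inner ℝ e (a i)
    · exact Eventually.of_forall fun _ _ => hs'
    · have h1 := (hsp s').sub hin
      filter_upwards [h1.eventually_ne (sub_ne_zero.2 hs')] with z hz hz'
      exact absurd (sub_eq_zero.2 hz') hz
  refine Asymptotics.isLittleO_iff.2 fun ε hε => ?_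
  have hall : ∀ᶠ z in apNhds y, ∀ s', ‖QPoint.sortedProj e (QPoint.ofFn (p z)) s'
      - QPoint.sortedProj e (QPoint.ofFn a) s' - G s' (z - y)‖ ≤ ε * ‖z - y‖ :=
    eventually_all.2 fun s' => (h s').def hε
  filter_upwards [hall, hsep] with z hz hzs
  obtain ⟨τ, hτ⟩ := QPoint.exists_perm_sortedProj e (p z)
  have h1 := hz (τ i)
  have h2 := hzs (τ i) (hτ i)
  rwa [hτ i, h2, htie (τ i) s (h2.trans his.symm), ← inner_sub_right] at h1

end SortedProj

section Xi

variable {m K Q n : ℕ} {b : Fin K → OrthonormalBasis (Fin n) ℝ (E n)} {u : E m → QPoint Q n}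
  {y : E m} {G : E m →L[ℝ] EuclideanSpace ℝ (Fin K × Fin n × Fin Q)}

/-- The derivative of the sorted projection number `s` to the `j`-th vector of the `k`-th basis. -/
def sortedDeriv (G : E m →L[ℝ] EuclideanSpace ℝ (Fin K × Fin n × Fin Q)) (k : Fin K) (j : Fin n)
    (s : Fin Q) : E m →L[ℝ] ℝ :=
  Real.sqrt K • (EuclideanSpace.proj (k, j, s)).comp G

theorem sqrt_natCast_pos_of_fin (k : Fin K) : 0 < Real.sqrt K :=
  Real.sqrt_pos.2 (Nat.cast_pos.2 (Fin.pos k))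

theorem sortedProj_isLittleO {q : E m → QPoint Q n} {q₀ : QPoint Q n}
    (h : (fun z => xi b (q z) - xi b q₀ - G (z - y)) =o[apNhds y] fun z => z - y)
    (k : Fin K) (j : Fin n) (s : Fin Q) :
    (fun z => QPoint.sortedProj (b k j) (q z) s - QPoint.sortedProj (b k j) q₀ s
      - sortedDeriv G k j s (z - y)) =o[apNhds y] fun z => z - y := by
  have hK := sqrt_natCast_pos_of_fin k
  have h1 : (fun z => (xi b (q z) - xi b q₀ - G (z - y)) (k, j, s)) =o[apNhds y]
      fun z => z - y := by
    refine Asymptotics.IsBigO.trans_isLittleO ?_ h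
    exact Asymptotics.IsBigO.of_bound 1 (Eventually.of_forall fun z => by
      rw [one_mul]; exact PiLp.norm_apply_le _ _)
  refine (h1.const_mul_left (Real.sqrt K)).congr_left fun z => ?_
  simp only [xi, sortedDeriv, PiLp.sub_apply, _root_.smul_apply,
    ContinuousLinearMap.comp_apply, PiLp.proj_apply, smul_eq_mul]
  field_simp

theorem isLittleO_xi_of_gdist {q q' : E m → QPoint Q n} (hb : IsBiLipschitz (xi (Q := Q) b))
    (h : (fun z => QPoint.gdist (q z) (q' z)) =o[apNhds y] fun z => z - y) :
    (fun z => xi b (q z) - xi b (q' z)) =o[apNhds y] fun z => z - y := by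
  obtain ⟨c, C, -, hC, hcC⟩ := hb
  refine Asymptotics.IsBigO.trans_isLittleO (Asymptotics.IsBigO.of_bound C ?_) h
  refine Eventually.of_forall fun z => (hcC _ _).2.trans ?_
  rw [Real.norm_of_nonneg (QPoint.gdist_nonneg _ _)]

/-- Every approximate derivative of `u` has the same Hilbert–Schmidt norms as the approximate
derivative of `ξ ∘ u`. -/
theorem HasApproxDerivAt.sum_norm_sq_eq (hK : K ≠ 0) (hb : IsBiLipschitz (xi (Q := Q) b))
    (hG : (fun z => xi b (u z) - xi b (u y) - G (z - y)) =o[apNhds y] fun z => z - y)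
    {L : Fin Q → (E m →L[ℝ] E n)} (hL : HasApproxDerivAt u L y) (v : E m) :
    ∑ i, ‖L i v‖ ^ 2 = ‖G v‖ ^ 2 := by
  obtain ⟨a, ha, -, hLa⟩ := hasApproxDerivAt_iff.1 hL
  set p : E m → Fin Q → E n := fun z i => a i + L i (z - y) with hp
  have hpt : ∀ i, Tendsto (fun z => p z i) (apNhds y) (𝓝 (a i)) := by
    intro i
    have hc : Continuous fun z => p z i := by simp only [hp]; fun_prop
    have := (hc.tendsto y).mono_left (apNhds_le_nhds y)
    simpa [hp] using this
  have hξ : (fun z => xi b (QPoint.ofFn (p z)) - xi b (QPoint.ofFn a) - G (z - y))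
      =o[apNhds y] fun z => z - y := by
    have h2 := hG.sub (isLittleO_xi_of_gdist hb hLa)
    refine h2.congr_left fun z => ?_
    rw [← ha]; abel
  -- The affine family `p` shares the first order expansion of `ξ ∘ u`; unsorting it and using
  -- uniqueness of derivatives identifies each projection of `L i`.
  have hkey : ∀ k j i s, QPoint.sortedProj (b k j) (QPoint.ofFn a) s = inner ℝ (b k j) (a i) →
      (inner ℝ (b k j) (L i v) : ℝ) = Real.sqrt K * G v (k, j, s) := by
    intro k j i s his
    have htie : ∀ s s', QPoint.sortedProj (b k j) (QPoint.ofFn a) s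
        = QPoint.sortedProj (b k j) (QPoint.ofFn a) s' →
        sortedDeriv G k j s = sortedDeriv G k j s' := by
      intro s s' hs
      rw [← ha] at hs
      exact sortedProj_deriv_eq (sortedProj_isLittleO hG k j) hs
    have h1 := inner_sub_isLittleO hpt (sortedProj_isLittleO hξ k j) htie his
    have h2 := eq_zero_of_isLittleO_apNhds (y := y)
      (l := (innerSL ℝ (b k j)).comp (L i) - sortedDeriv G k j s) (by
        refine h1.congr_left fun z => ?_
        simp [hp])
    have h3 := DFunLike.congr_fun (sub_eq_zero.1 h2) v
    simpa [sortedDeriv] using h3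
  have hsum : ∀ k j, ∑ i, (inner ℝ (b k j) (L i v) : ℝ) ^ 2 = K * ∑ s, (G v (k, j, s)) ^ 2 := by
    intro k j
    obtain ⟨τ, hτ⟩ := QPoint.exists_perm_sortedProj (b k j) a
    rw [← Equiv.sum_comp τ fun s => (G v (k, j, s)) ^ 2, Finset.mul_sum]
    refine Finset.sum_congr rfl fun i _ => ?_
    rw [hkey k j i _ (hτ i), mul_pow, Real.sq_sqrt (Nat.cast_nonneg K)]
  have hK' : (K : ℝ) ≠ 0 := Nat.cast_ne_zero.2 hK
  -- Parseval in the `k`-th basis. Each basis alone recovers the full norm; the factor `K^{-1/2}` in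
  -- `ξ` makes the sum over all bases an average.
  have hnorm : ∀ k : Fin K, ∑ i, ‖L i v‖ ^ 2 = K * ∑ j, ∑ s, (G v (k, j, s)) ^ 2 := by
    intro k
    rw [Finset.mul_sum]
    simp only [← hsum]
    rw [Finset.sum_comm]
    refine Finset.sum_congr rfl fun i _ => ?_
    rw [← (b k).sum_sq_norm_inner_right (L i v)]
    simp [sq_abs]
  have htot : ∑ _k : Fin K, ∑ i, ‖L i v‖ ^ 2 = K * ‖G v‖ ^ 2 := by
    rw [Finset.sum_congr rfl fun k _ => hnorm k, ← Finset.mul_sum, EuclideanSpace.norm_sq_eq,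
      Fintype.sum_prod_type]
    simp [Fintype.sum_prod_type, sq_abs]
  rw [Finset.sum_const, Finset.card_univ, Fintype.card_fin, nsmul_eq_mul] at htot
  refine mul_left_cancel₀ hK' ?_
  exact htot

/-- If `ξ ∘ u` is approximately differentiable at `y`, so is `u`. -/
theorem approxDifferentiableAt_of_xi (hK : K ≠ 0) (hb : IsBiLipschitz (xi (Q := Q) b))
    (hG : (fun z => xi b (u z) - xi b (u y) - G (z - y)) =o[apNhds y] fun z => z - y) :
    ApproxDifferentiableAt u y := by
  classical
  -- A single basis already determines the derivatives.
  obtain ⟨k⟩ : Nonempty (Fin K) := Fin.pos_iff_nonempty.1 (Nat.pos_of_ne_zero hK)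
  obtain ⟨a, ha⟩ := (u y).exists_ofFn
  -- Each `u z` is enumerated by an optimal matching with `a`. No regularity of this choice is
  -- needed beyond `p z i → a i`.
  choose p hpu hpd using fun z => QPoint.exists_gdist_eq (u z) a
  have hy := tendsto_sub_apNhds y
  have hξ0 : Tendsto (fun z => xi b (u z) - xi b (u y)) (apNhds y) (𝓝 0) := by
    simpa only [sub_add_cancel, add_zero] using
      (hG.trans_tendsto hy).add (tendsto_clm_sub_apNhds y G)
  have hg0 : Tendsto (fun z => QPoint.gdist (u z) (u y)) (apNhds y) (𝓝 0) := by
    obtain ⟨c, C, hc, -, hcC⟩ := hb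
    refine squeeze_zero (fun z => QPoint.gdist_nonneg _ _) (fun z => ?_)
      (by simpa using hξ0.norm.const_mul c⁻¹)
    rw [inv_mul_eq_div, le_div_iff₀' hc]
    exact (hcC _ _).1
  have hpt : ∀ i, Tendsto (fun z => p z i) (apNhds y) (𝓝 (a i)) := by
    intro i
    rw [tendsto_iff_norm_sub_tendsto_zero]
    refine squeeze_zero (fun z => norm_nonneg _) (fun z => ?_) hg0
    rw [ha, hpd z]
    refine Real.le_sqrt_of_sq_le ?_
    exact Finset.single_le_sum (f := fun i => ‖p z i - a i‖ ^ 2) (fun _ _ => by positivity)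
      (Finset.mem_univ i)
  have hex : ∀ j i, ∃ s, QPoint.sortedProj (b k j) (QPoint.ofFn a) s = inner ℝ (b k j) (a i) := by
    intro j i
    obtain ⟨τ, hτ⟩ := QPoint.exists_perm_sortedProj (b k j) a
    exact ⟨τ i, hτ i⟩
  choose S hS using hex
  have htie : ∀ j s s', QPoint.sortedProj (b k j) (QPoint.ofFn a) s
      = QPoint.sortedProj (b k j) (QPoint.ofFn a) s' →
      sortedDeriv G k j s = sortedDeriv G k j s' := by
    intro j s s' hs
    rw [← ha] at hs
    exact sortedProj_deriv_eq (sortedProj_isLittleO hG k j) hs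
  have hG' : (fun z => xi b (QPoint.ofFn (p z)) - xi b (QPoint.ofFn a) - G (z - y))
      =o[apNhds y] fun z => z - y := by
    refine hG.congr_left fun z => ?_
    rw [← hpu z, ha]
  set L : Fin Q → (E m →L[ℝ] E n) := fun i =>
    ∑ j, (sortedDeriv G k j (S j i)).smulRight (b k j) with hL
  have hLo : ∀ i, (fun z => p z i - (a i + L i (z - y))) =o[apNhds y] fun z => z - y := by
    intro i
    have h1 : ∀ j, (fun z => (inner ℝ (b k j) (p z i - a i)
        - sortedDeriv G k j (S j i) (z - y)) • b k j) =o[apNhds y] fun z => z - y := by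
      intro j
      refine Asymptotics.IsBigO.trans_isLittleO (Asymptotics.IsBigO.of_bound 1 ?_)
        (inner_sub_isLittleO hpt (sortedProj_isLittleO hG' k j) (htie j) (hS j i))
      refine Eventually.of_forall fun z => ?_
      rw [norm_smul, (b k).norm_eq_one, mul_one, one_mul]
    refine (Asymptotics.IsLittleO.sum (s := Finset.univ) fun j _ => h1 j).congr_left fun z => ?_
    simp only [Finset.sum_apply, sub_smul, Finset.sum_sub_distrib, (b k).sum_repr', hL,
      _root_.sum_apply, ContinuousLinearMap.smulRight_apply]
    abel
  refine ⟨L, hasApproxDerivAt_iff.2 ⟨a, ha, ?_, ?_⟩⟩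
  · intro i i' hii
    refine Finset.sum_congr rfl fun j _ => ?_
    rw [htie j (S j i) (S j i') (by rw [hS, hS, hii])]
  · refine Asymptotics.IsBigO.trans_isLittleO (Asymptotics.IsBigO.of_bound 1 ?_)
      (Asymptotics.IsLittleO.sum (s := Finset.univ) fun i _ => (hLo i).norm_left)
    refine Eventually.of_forall fun z => ?_
    rw [Finset.sum_apply, Real.norm_of_nonneg (QPoint.gdist_nonneg _ _),
      Real.norm_of_nonneg (Finset.sum_nonneg fun _ _ => norm_nonneg _), one_mul]
    conv_lhs => rw [hpu z]
    refine (QPoint.gdist_le _ _).trans ?_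
    rw [Real.sqrt_le_left (Finset.sum_nonneg fun _ _ => norm_nonneg _)]
    exact Finset.sum_sq_le_sq_sum_of_nonneg fun i _ => norm_nonneg _

/-- The arbitrary choice in `approxDeriv` is harmless, since `HasApproxDerivAt.sum_norm_sq_eq`
applies to every approximate derivative. -/
theorem dirDerivSq_eq_of_xi (hK : K ≠ 0) (hb : IsBiLipschitz (xi (Q := Q) b))
    (hG : (fun z => xi b (u z) - xi b (u y) - G (z - y)) =o[apNhds y] fun z => z - y) (v : E m) :
    dirDerivSq u y v = ‖G v‖ ^ 2 := by
  have h := approxDifferentiableAt_of_xi hK hb hG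
  rw [dirDerivSq, approxDeriv, dif_pos h]
  exact HasApproxDerivAt.sum_norm_sq_eq hK hb hG h.choose_spec v

/-- With no bases the target of `ξ` is a single point, yet `Q` copies of a unit vector and `Q`
copies of the origin are at distance `√Q`. -/
theorem IsBiLipschitz.ne_zero_of_xi (hQ : Q ≠ 0) (hn : n ≠ 0)
    (hb : IsBiLipschitz (xi (Q := Q) b)) : K ≠ 0 := by
  rintro rfl
  obtain ⟨c, C, hc, -, hcC⟩ := hb
  obtain ⟨i₀⟩ : Nonempty (Fin Q) := Fin.pos_iff_nonempty.1 (Nat.pos_of_ne_zero hQ)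
  obtain ⟨j₀⟩ : Nonempty (Fin n) := Fin.pos_iff_nonempty.1 (Nat.pos_of_ne_zero hn)
  set e : E n := EuclideanSpace.single j₀ 1
  obtain ⟨d, hd, hgd⟩ := QPoint.exists_gdist_eq (QPoint.ofFn fun _ : Fin Q => e) fun _ => 0
  obtain ⟨τ, hτ⟩ := QPoint.exists_perm_of_ofFn_eq hd.symm
  have h1 := (hcC (QPoint.ofFn fun _ : Fin Q => e) (QPoint.ofFn fun _ => 0)).1
  have h2 : xi b (QPoint.ofFn fun _ : Fin Q => e) - xi b (QPoint.ofFn fun _ => 0) = 0 :=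
    Subsingleton.elim _ _
  have h3 : ∀ i, ‖d i - 0‖ ^ 2 = 1 := by
    intro i
    rw [← hτ i]
    simp [e]
  rw [h2, norm_zero, hgd] at h1
  simp only [h3, Finset.sum_const, Finset.card_univ, Fintype.card_fin, nsmul_eq_mul, mul_one] at h1
  have : 0 < c * Real.sqrt Q :=
    mul_pos hc (Real.sqrt_pos.2 (Nat.cast_pos.2 (Nat.pos_of_ne_zero hQ)))
  linarith

end Xi

/-! ### Approximate differentiability of Sobolev functions -/

/-- `g` is a weak gradient of `f` on `Ω`. -/
def IsWeakGrad {m : ℕ} {F : Type*} [NormedAddCommGroup F] [NormedSpace ℝ F]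
    (Ω : Set (E m)) (f : E m → F) (g : E m → (E m →L[ℝ] F)) : Prop :=
  ∀ φ : E m → ℝ, ContDiff ℝ ∞ φ → HasCompactSupport φ → tsupport φ ⊆ Ω → ∀ v : E m,
    ∫ y in Ω, (fderiv ℝ φ y v) • f y = - ∫ y in Ω, φ y • g y v

theorem volume_ball_mul {m : ℕ} (y : E m) {s : ℝ} (hs : 0 < s) (r : ℝ) :
    volume (Metric.ball y (s * r)) = ENNReal.ofReal (s ^ m) * volume (Metric.ball y r) := by
  have := Measure.addHaar_ball_mul_of_pos volume y hs r
  rw [finrank_euclideanSpace_fin] at this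
  rw [this, Measure.addHaar_ball_center volume y]

theorem setLIntegral_ball_comp_homothety {m : ℕ} (y : E m) (H : E m → ℝ≥0∞) {s r : ℝ}
    (hs : 0 < s) :
    ENNReal.ofReal (s ^ m) * ∫⁻ z in Metric.ball y r, H (y + s • (z - y)) =
      ∫⁻ z in Metric.ball y (s * r), H z := by
  have himg : (fun z => y + s • (z - y)) '' Metric.ball y r = Metric.ball y (s * r) := by
    ext w
    constructor
    · rintro ⟨z, hz, rfl⟩
      rw [mem_ball_iff_norm] at hz ⊢
      rw [add_sub_cancel_left, norm_smul, Real.norm_of_nonneg hs.le]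
      gcongr
    · intro hw
      refine ⟨y + s⁻¹ • (w - y), ?_, ?_⟩
      · rw [mem_ball_iff_norm] at hw ⊢
        rw [add_sub_cancel_left, norm_smul, norm_inv, Real.norm_of_nonneg hs.le,
          inv_mul_lt_iff₀ hs]
        exact hw
      · simp [smul_smul, hs.ne']
  have hder : ∀ z ∈ Metric.ball y r, HasFDerivWithinAt (fun z => y + s • (z - y))
      (s • ContinuousLinearMap.id ℝ (E m)) (Metric.ball y r) z := by
    intro z _
    exact ((((hasFDerivAt_id z).sub_const y).const_smul s).const_add y).hasFDerivWithinAt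
  have hinj : Set.InjOn (fun z => y + s • (z - y)) (Metric.ball y r) := by
    intro z _ w _ h
    simpa [hs.ne'] using h
  rw [← himg, lintegral_image_eq_lintegral_abs_det_fderiv_mul volume measurableSet_ball hder hinj]
  have hdet : (s • ContinuousLinearMap.id ℝ (E m)).det = s ^ m := by
    simp [ContinuousLinearMap.det, LinearMap.det_smul]
  rw [hdet, abs_of_nonneg (by positivity), lintegral_const_mul' _ _ ENNReal.ofReal_ne_top]

/-- Averages over segments emanating from `y` are controlled by averages over balls at `y`. -/
theorem lintegral_segment_le {m : ℕ} {y : E m} {H : E m → ℝ≥0∞} (hH : Measurable H) {C : ℝ≥0∞}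
    {r : ℝ} (hr : 0 < r)
    (h : ∀ t, 0 < t → t ≤ r → ∫⁻ w in Metric.ball y t, H w ≤ C * volume (Metric.ball y t)) :
    ∫⁻ z in Metric.ball y r, ∫⁻ s in Set.Ioc (0 : ℝ) 1, H (y + s • (z - y)) ≤
      C * volume (Metric.ball y r) := by
  -- For fixed `s`, the homothety maps `ball y r` onto `ball y (s * r)`, and its Jacobian `s ^ m`
  -- cancels the ratio of the volumes.
  rw [lintegral_lintegral_swap]
  · have : ∀ s ∈ Set.Ioc (0 : ℝ) 1, ∫⁻ z in Metric.ball y r, H (y + s • (z - y)) ≤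
        C * volume (Metric.ball y r) := by
      intro s hs
      have h1 := h (s * r) (mul_pos hs.1 hr) (by nlinarith [hs.2])
      rw [← setLIntegral_ball_comp_homothety y H hs.1, volume_ball_mul y hs.1 r,
        mul_left_comm] at h1
      have hpos : 0 < s ^ m := pow_pos hs.1 m
      exact (ENNReal.mul_le_mul_iff_right (by simpa using hpos) ENNReal.ofReal_ne_top).1 h1
    calc ∫⁻ s in Set.Ioc (0 : ℝ) 1, ∫⁻ z in Metric.ball y r, H (y + s • (z - y))
        ≤ ∫⁻ _ in Set.Ioc (0 : ℝ) 1, C * volume (Metric.ball y r) :=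
          setLIntegral_mono' measurableSet_Ioc this
      _ = C * volume (Metric.ball y r) := by simp
  · refine Measurable.aemeasurable ?_
    exact hH.comp (by fun_prop)

/-- Bounds for averages over balls at `y` survive mollification with a loss `4 ^ m` that does not
depend on the scale. If the mollifier is at least as wide as the ball, its kernel is at most `2 ^ m`
over the volume of its support ball; if it is narrower, Tonelli and unit mass reduce to a ball of
twice the radius. -/
theorem lintegral_mollify_le {m : ℕ} {y : E m} {k : E m → ℝ≥0∞} (hk : AEMeasurable k volume)
    (φ : ContDiffBump (0 : E m)) (hφ : φ.rOut ≤ 2 * φ.rIn) {δ : ℝ≥0∞} {r : ℝ} (hφr : φ.rOut ≤ r)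
    (h : ∀ s, 0 < s → s ≤ 2 * r →
      ∫⁻ w in Metric.ball y s, k w ≤ δ * volume (Metric.ball y s))
    {t : ℝ} (ht : 0 < t) (htr : t ≤ r) :
    ∫⁻ w in Metric.ball y t, ∫⁻ x, ENNReal.ofReal (φ.normed volume (w - x)) * k x ≤
      4 ^ m * δ * volume (Metric.ball y t) := by
  have hε := φ.rOut_pos
  have hsupp : ∀ w x, w ∈ Metric.ball y t → x ∉ Metric.ball y (t + φ.rOut) →
      φ.normed volume (w - x) = 0 := by
    intro w x hw hx
    by_contra hne
    have : w - x ∈ Function.support (φ.normed volume) := hne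
    rw [φ.support_normed_eq, mem_ball_zero_iff] at this
    rw [mem_ball_iff_norm] at hw
    refine hx (mem_ball_iff_norm.2 ?_)
    have h1 : x - y = (w - y) - (w - x) := by abel
    rw [h1]
    exact (norm_sub_le _ _).trans_lt (add_lt_add hw this)
  have hloc : ∀ w ∈ Metric.ball y t, ∫⁻ x, ENNReal.ofReal (φ.normed volume (w - x)) * k x =
      ∫⁻ x in Metric.ball y (t + φ.rOut), ENNReal.ofReal (φ.normed volume (w - x)) * k x := by
    intro w hw
    rw [← lintegral_indicator measurableSet_ball]
    refine lintegral_congr fun x => ?_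
    by_cases hx : x ∈ Metric.ball y (t + φ.rOut)
    · rw [Set.indicator_of_mem hx]
    · rw [Set.indicator_of_notMem hx, hsupp w x hw hx]; simp
  have h4 : (4 : ℝ≥0∞) ^ m = 2 ^ m * 2 ^ m := by rw [← mul_pow]; norm_num
  have h2 : ENNReal.ofReal ((2 : ℝ) ^ m) = 2 ^ m := by
    rw [ENNReal.ofReal_pow (by norm_num)]; norm_num
  rw [setLIntegral_congr_fun measurableSet_ball hloc]
  rcases le_or_gt t φ.rOut with hle | hgt
  · have hpt : ∀ w ∈ Metric.ball y t,
        ∫⁻ x in Metric.ball y (t + φ.rOut), ENNReal.ofReal (φ.normed volume (w - x)) * k x ≤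
          4 ^ m * δ := by
      intro w _
      have hb : ∀ x, ENNReal.ofReal (φ.normed volume x) ≤
          2 ^ m / volume (Metric.ball y φ.rOut) := by
        intro x
        have h1 := φ.normed_le_div_measure_closedBall_rOut volume 2 hφ x
        rw [finrank_euclideanSpace_fin] at h1
        refine (ENNReal.ofReal_le_ofReal h1).trans ?_
        have hpos : 0 < volume.real (Metric.closedBall (0 : E m) φ.rOut) :=
          ENNReal.toReal_pos (Metric.measure_closedBall_pos _ _ hε).ne' measure_closedBall_lt_top.ne
        rw [ENNReal.ofReal_div_of_pos hpos, h2, Measure.real,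
          ENNReal.ofReal_toReal measure_closedBall_lt_top.ne,
          Measure.addHaar_ball_center volume y]
        gcongr
        exact Metric.ball_subset_closedBall
      calc ∫⁻ x in Metric.ball y (t + φ.rOut), ENNReal.ofReal (φ.normed volume (w - x)) * k x
          ≤ ∫⁻ x in Metric.ball y (t + φ.rOut), 2 ^ m / volume (Metric.ball y φ.rOut) * k x := by
            gcongr with x; exact hb _
        _ ≤ ∫⁻ x in Metric.ball y (2 * φ.rOut), 2 ^ m / volume (Metric.ball y φ.rOut) * k x :=
            lintegral_mono_set (Metric.ball_subset_ball (by linarith))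
        _ = 2 ^ m / volume (Metric.ball y φ.rOut) * ∫⁻ x in Metric.ball y (2 * φ.rOut), k x :=
            lintegral_const_mul'' _ hk.restrict
        _ ≤ 2 ^ m / volume (Metric.ball y φ.rOut) *
              (δ * (2 ^ m * volume (Metric.ball y φ.rOut))) := by
            gcongr
            refine (h _ (by positivity) (by linarith)).trans ?_
            rw [volume_ball_mul y two_pos _, h2]
        _ = 2 ^ m * 2 ^ m * δ * (volume (Metric.ball y φ.rOut) /
              volume (Metric.ball y φ.rOut)) := by
            simp only [div_eq_mul_inv]; ring
        _ = 4 ^ m * δ := by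
            rw [ENNReal.div_self (Metric.measure_ball_pos _ _ hε).ne' measure_ball_lt_top.ne, h4,
              mul_one]
    calc _ ≤ ∫⁻ _ in Metric.ball y t, 4 ^ m * δ := setLIntegral_mono' measurableSet_ball hpt
      _ = 4 ^ m * δ * volume (Metric.ball y t) := by simp
  · have hinteg : ∀ x : E m, ∫⁻ w, ENNReal.ofReal (φ.normed volume (w - x)) = 1 := by
      intro x
      rw [lintegral_sub_right_eq_self (fun w => ENNReal.ofReal (φ.normed volume w)) x,
        ← ofReal_integral_eq_lintegral_ofReal φ.integrable_normed
        (Eventually.of_forall fun _ => φ.nonneg_normed _), φ.integral_normed, ENNReal.ofReal_one]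
    have hφm := (φ.continuous_normed (μ := volume)).measurable
    have hmeas : Measurable fun p : E m × E m =>
        ENNReal.ofReal (φ.normed volume (p.1 - p.2)) := by fun_prop
    have hm : ∀ x : E m, Measurable fun w => ENNReal.ofReal (φ.normed volume (w - x)) := by
      intro x; fun_prop
    rw [lintegral_lintegral_swap (hmeas.aemeasurable.mul hk.restrict.comp_snd)]
    calc ∫⁻ x in Metric.ball y (t + φ.rOut), ∫⁻ w in Metric.ball y t,
          ENNReal.ofReal (φ.normed volume (w - x)) * k x
        ≤ ∫⁻ x in Metric.ball y (t + φ.rOut), k x := by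
          gcongr with x
          calc ∫⁻ w in Metric.ball y t, ENNReal.ofReal (φ.normed volume (w - x)) * k x
              ≤ ∫⁻ w, ENNReal.ofReal (φ.normed volume (w - x)) * k x :=
                setLIntegral_le_lintegral _ _
            _ = k x := by
                rw [lintegral_mul_const _ (hm x), hinteg, one_mul]
      _ ≤ ∫⁻ x in Metric.ball y (2 * t), k x :=
          lintegral_mono_set (Metric.ball_subset_ball (by linarith))
      _ ≤ δ * (2 ^ m * volume (Metric.ball y t)) := by
          refine (h _ (by positivity) (by linarith)).trans ?_
          rw [volume_ball_mul y two_pos _, h2]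
      _ = 2 ^ m * δ * volume (Metric.ball y t) := by ring
      _ ≤ 4 ^ m * δ * volume (Metric.ball y t) := by
          gcongr; norm_num

theorem locallyIntegrable_indicator {m : ℕ} {G : Type*} [NormedAddCommGroup G] {Ω : Set (E m)}
    (hΩ : MeasurableSet Ω) {g : E m → G} (hg : IntegrableOn g Ω) :
    LocallyIntegrable (Ω.indicator g) volume :=
  (hg.integrable_indicator hΩ).locallyIntegrable

/-! ### Mollified Sobolev functions. -/

section Mollify

variable {m : ℕ} {F : Type*} [NormedAddCommGroup F] [NormedSpace ℝ F]

open ContinuousLinearMap Convolution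

/-- The fundamental theorem of calculus for `f - A` on the segment from `y` to `z`. -/
theorem enorm_sub_le_lintegral_segment [CompleteSpace F] {f : E m → F} {f' : E m → (E m →L[ℝ] F)}
    (hf' : Continuous f') {y z : E m} {r : ℝ} (hz : z ∈ Metric.ball y r)
    (hf : ∀ w ∈ Metric.ball y r, HasFDerivAt f (f' w) w) (A : E m →L[ℝ] F) :
    ‖f z - f y - A (z - y)‖ₑ ≤
      ‖z - y‖ₑ * ∫⁻ s in Set.Ioc (0 : ℝ) 1, ‖f' (y + s • (z - y)) - A‖ₑ := by
  have hmem : ∀ s ∈ Set.uIcc (0 : ℝ) 1, y + s • (z - y) ∈ Metric.ball y r := by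
    intro s hs
    rw [Set.uIcc_of_le zero_le_one] at hs
    rw [mem_ball_iff_norm] at hz ⊢
    rw [add_sub_cancel_left, norm_smul, Real.norm_of_nonneg hs.1]
    exact (mul_le_of_le_one_left (norm_nonneg _) hs.2).trans_lt hz
  have hder : ∀ s ∈ Set.uIcc (0 : ℝ) 1, HasDerivAt
      (fun s : ℝ => f (y + s • (z - y)) - A (s • (z - y)))
      ((f' (y + s • (z - y)) - A) (z - y)) s := by
    intro s hs
    have h1 : HasDerivAt (fun s : ℝ => s • (z - y)) (z - y) s := by
      simpa using (hasDerivAt_id s).smul_const (z - y)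
    exact ((hf _ (hmem s hs)).comp_hasDerivAt s (h1.const_add y)).sub
      (A.hasFDerivAt.comp_hasDerivAt s h1)
  have hcont : Continuous fun s : ℝ => (f' (y + s • (z - y)) - A) (z - y) := by fun_prop
  have hFTC := intervalIntegral.integral_eq_sub_of_hasDerivAt hder
    (hcont.intervalIntegrable 0 1)
  simp only [one_smul, zero_smul, add_zero, map_zero, sub_zero, add_sub_cancel] at hFTC
  have h3 : f z - f y - A (z - y) = f z - A (z - y) - f y := by abel
  rw [h3, ← hFTC, intervalIntegral.integral_of_le zero_le_one]
  refine (enorm_integral_le_lintegral_enorm _).trans ?_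
  rw [← lintegral_const_mul' _ _ enorm_ne_top]
  refine lintegral_mono fun s => ?_
  rw [mul_comm]
  exact ContinuousLinearMap.le_opENorm _ _

/-- Where the bump fits inside `Ω`, the reflection `t ↦ φ (x - t)` is an admissible test function,
and the weak gradient identity moves the derivative from the bump to `g`. -/
theorem hasFDerivAt_mollify {Ω : Set (E m)} (hΩ : MeasurableSet Ω) {f : E m → F}
    {g : E m → (E m →L[ℝ] F)} (hf : IntegrableOn f Ω) (hg : IntegrableOn g Ω)
    (hfg : IsWeakGrad Ω f g) (φ : ContDiffBump (0 : E m)) {x : E m}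
    (hx : Metric.closedBall x φ.rOut ⊆ Ω) :
    HasFDerivAt (φ.normed volume ⋆[lsmul ℝ ℝ, volume] Ω.indicator f)
      ((φ.normed volume ⋆[lsmul ℝ ℝ, volume] Ω.indicator g) x) x := by
  have hfi : LocallyIntegrable (Ω.indicator f) volume :=
    locallyIntegrable_indicator hΩ hf
  have hgi : LocallyIntegrable (Ω.indicator g) volume :=
    locallyIntegrable_indicator hΩ hg
  have h1 := φ.hasCompactSupport_normed (μ := volume).hasFDerivAt_convolution_left (lsmul ℝ ℝ)
    (φ.contDiff_normed (n := 1)) hfi x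
  suffices key : (φ.normed volume ⋆[lsmul ℝ ℝ, volume] Ω.indicator g) x
      = (fderiv ℝ (φ.normed volume) ⋆[(lsmul ℝ ℝ).precompL (E m), volume] Ω.indicator f) x by
    rw [key]; exact h1
  refine ContinuousLinearMap.ext fun v => ?_
  have hex1 := (φ.hasCompactSupport_normed (μ := volume)).convolutionExists_left (lsmul ℝ ℝ)
    φ.continuous_normed hgi x
  have hex2 := ((φ.hasCompactSupport_normed (μ := volume)).fderiv ℝ).convolutionExists_left
    ((lsmul ℝ ℝ).precompL (E m))
    ((φ.contDiff_normed (n := 1)).continuous_fderiv one_ne_zero) hfi x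
  have hsm : ContDiff ℝ ∞ fun t => φ.normed volume (x - t) :=
    (φ.contDiff_normed (n := ⊤)).comp (contDiff_const.sub contDiff_id)
  have hts : tsupport (fun t => φ.normed volume (x - t)) ⊆ Metric.closedBall x φ.rOut := by
    refine closure_minimal ?_ Metric.isClosed_closedBall
    intro t ht
    have : x - t ∈ Function.support (φ.normed volume) := ht
    rw [φ.support_normed_eq, mem_ball_zero_iff] at this
    rw [mem_closedBall_iff_norm']
    exact this.le
  have hw := hfg (fun t => φ.normed volume (x - t)) hsm
    ((isCompact_closedBall x φ.rOut).of_isClosed_subset (isClosed_tsupport _) hts)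
    (hts.trans hx) v
  have hfd : ∀ t, fderiv ℝ (fun t => φ.normed volume (x - t)) t v
      = - fderiv ℝ (φ.normed volume) (x - t) v := by
    intro t
    have h2 : HasFDerivAt (fun t => φ.normed volume (x - t))
        ((fderiv ℝ (φ.normed volume) (x - t)).comp (-ContinuousLinearMap.id ℝ (E m))) t := by
      have h3 := ((φ.contDiff_normed (μ := volume) (n := 1)).differentiable one_ne_zero
        (x - t)).hasFDerivAt
      exact h3.comp t ((hasFDerivAt_id t).const_sub x)
    rw [h2.fderiv]
    simp
  rw [convolution_eq_swap, convolution_eq_swap]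
  rw [ContinuousLinearMap.integral_apply (by simpa using hex1.integrable_swap),
    ContinuousLinearMap.integral_apply (by simpa using hex2.integrable_swap)]
  simp only [hfd, neg_smul, integral_neg, neg_inj] at hw
  rw [← integral_indicator hΩ, ← integral_indicator hΩ] at hw
  have e1 : ∀ t, (((lsmul ℝ ℝ) (φ.normed volume (x - t))) (Ω.indicator g t)) v
      = Ω.indicator (fun t => φ.normed volume (x - t) • g t v) t := by
    intro t
    by_cases ht : t ∈ Ω <;> simp [ht]
  have e2 : ∀ t, ((((lsmul ℝ ℝ).precompL (E m)) (fderiv ℝ (φ.normed volume) (x - t)))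
      (Ω.indicator f t)) v = Ω.indicator (fun t => fderiv ℝ (φ.normed volume) (x - t) v • f t) t := by
    intro t
    by_cases ht : t ∈ Ω <;> simp [ht, precompL_apply]
  simp only [e1, e2]
  exact hw.symm

end Mollify

section Sobolev

variable {m : ℕ} {F : Type*} [NormedAddCommGroup F] [NormedSpace ℝ F]

open ContinuousLinearMap Convolution

/-- The kernel has unit mass, so subtracting a constant commutes with mollification. -/
theorem enorm_mollify_sub_le [CompleteSpace F] {g : E m → F} (hg : LocallyIntegrable g volume)
    (φ : ContDiffBump (0 : E m)) (A : F) (w : E m) :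
    ‖(φ.normed volume ⋆[lsmul ℝ ℝ, volume] g) w - A‖ₑ ≤
      ∫⁻ x, ENNReal.ofReal (φ.normed volume (w - x)) * ‖g x - A‖ₑ := by
  have hex := ((φ.hasCompactSupport_normed (μ := volume)).convolutionExists_left (lsmul ℝ ℝ)
    φ.continuous_normed hg w).integrable_swap
  have hinteg : ∫ x, φ.normed volume (w - x) = 1 := by
    rw [integral_sub_left_eq_self (fun x => φ.normed volume x) volume w, φ.integral_normed]
  have hA : Integrable (fun x => φ.normed volume (w - x) • A) volume :=
    ((φ.integrable_normed (μ := volume)).comp_sub_left w).smul_const A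
  have heq : (φ.normed volume ⋆[lsmul ℝ ℝ, volume] g) w - A
      = ∫ x, φ.normed volume (w - x) • (g x - A) := by
    simp only [smul_sub]
    rw [integral_sub (by simpa using hex) hA, integral_smul_const, hinteg, one_smul,
      convolution_eq_swap]
    simp
  rw [heq]
  refine (enorm_integral_le_lintegral_enorm _).trans (lintegral_mono fun x => ?_)
  rw [enorm_smul, Real.enorm_of_nonneg (φ.nonneg_normed _)]

/-- A mollified Sobolev function is close to its first order expansion at `y`, on average over
balls, if its gradient is close to a constant on average over balls. -/
theorem lintegral_mollify_expansion_le [CompleteSpace F] {Ω : Set (E m)} (hΩ : IsOpen Ω)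
    {f : E m → F} {g : E m → (E m →L[ℝ] F)} (hf : IntegrableOn f Ω) (hg : IntegrableOn g Ω)
    (hfg : IsWeakGrad Ω f g) (φ : ContDiffBump (0 : E m)) (hφ : φ.rOut ≤ 2 * φ.rIn) {y : E m}
    {r : ℝ} (hφr : φ.rOut ≤ r) (hr : 0 < r) (hyr : Metric.ball y (2 * r) ⊆ Ω)
    {A : E m →L[ℝ] F} {δ : ℝ≥0∞}
    (h : ∀ s, 0 < s → s ≤ 2 * r →
      ∫⁻ w in Metric.ball y s, ‖Ω.indicator g w - A‖ₑ ≤ δ * volume (Metric.ball y s)) :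
    ∫⁻ z in Metric.ball y r,
      ‖(φ.normed volume ⋆[lsmul ℝ ℝ, volume] Ω.indicator f) z
        - (φ.normed volume ⋆[lsmul ℝ ℝ, volume] Ω.indicator f) y - A (z - y)‖ₑ / ‖z - y‖ₑ ≤
      4 ^ m * δ * volume (Metric.ball y r) := by
  have hgi : LocallyIntegrable (Ω.indicator g) volume :=
    locallyIntegrable_indicator hΩ.measurableSet hg
  set f' := φ.normed volume ⋆[lsmul ℝ ℝ, volume] Ω.indicator g with hf'
  have hf'c : Continuous f' := (φ.hasCompactSupport_normed (μ := volume)).continuous_convolution_left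
    (lsmul ℝ ℝ) φ.continuous_normed hgi
  have hder : ∀ w ∈ Metric.ball y r, HasFDerivAt
      (φ.normed volume ⋆[lsmul ℝ ℝ, volume] Ω.indicator f) (f' w) w := by
    intro w hw
    refine hasFDerivAt_mollify hΩ.measurableSet hf hg hfg φ (Set.Subset.trans ?_ hyr)
    intro x hx
    rw [Metric.mem_ball] at hw ⊢
    rw [Metric.mem_closedBall] at hx
    linarith [dist_triangle x w y]
  have hmeas : Measurable fun w => ‖f' w - A‖ₑ := by
    have : Continuous fun w => ‖f' w - A‖ₑ := by fun_prop
    exact this.measurable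
  refine le_trans ?_ (lintegral_segment_le (y := y) (r := r) hmeas hr fun t ht htr => ?_)
  · refine setLIntegral_mono' measurableSet_ball fun z hz => ?_
    refine ENNReal.div_le_of_le_mul' ?_
    exact enorm_sub_le_lintegral_segment hf'c hz hder A
  · refine (lintegral_mono fun w => enorm_mollify_sub_le hgi φ A w).trans ?_
    refine lintegral_mollify_le ?_ φ hφ hφr h ht htr
    exact (hgi.aestronglyMeasurable.sub aestronglyMeasurable_const).enorm

/-- Fatou's lemma: the bound for the mollified functions does not depend on the scale of the
mollifier. -/
theorem lintegral_expansion_le [CompleteSpace F] {Ω : Set (E m)} (hΩ : IsOpen Ω)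
    {f : E m → F} {g : E m → (E m →L[ℝ] F)} (hf : IntegrableOn f Ω) (hg : IntegrableOn g Ω)
    (hfg : IsWeakGrad Ω f g) {φ : ℕ → ContDiffBump (0 : E m)}
    (hφ : ∀ k, (φ k).rOut ≤ 2 * (φ k).rIn) (hφ0 : Tendsto (fun k => (φ k).rOut) atTop (𝓝 0))
    (hφf : ∀ᵐ z, Tendsto (fun k => ((φ k).normed volume ⋆[lsmul ℝ ℝ, volume] Ω.indicator f) z)
      atTop (𝓝 (Ω.indicator f z)))
    {y : E m}
    (hφy : Tendsto (fun k => ((φ k).normed volume ⋆[lsmul ℝ ℝ, volume] Ω.indicator f) y)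
      atTop (𝓝 (Ω.indicator f y)))
    {r : ℝ} (hr : 0 < r) (hyr : Metric.ball y (2 * r) ⊆ Ω)
    {A : E m →L[ℝ] F} {δ : ℝ≥0∞}
    (h : ∀ s, 0 < s → s ≤ 2 * r →
      ∫⁻ w in Metric.ball y s, ‖Ω.indicator g w - A‖ₑ ≤ δ * volume (Metric.ball y s)) :
    ∫⁻ z in Metric.ball y r,
      ‖Ω.indicator f z - Ω.indicator f y - A (z - y)‖ₑ / ‖z - y‖ₑ ≤
      4 ^ m * δ * volume (Metric.ball y r) := by
  have hfi : LocallyIntegrable (Ω.indicator f) volume :=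
    locallyIntegrable_indicator hΩ.measurableSet hf
  set T : ℕ → E m → ℝ≥0∞ := fun k z =>
    ‖((φ k).normed volume ⋆[lsmul ℝ ℝ, volume] Ω.indicator f) z
        - ((φ k).normed volume ⋆[lsmul ℝ ℝ, volume] Ω.indicator f) y - A (z - y)‖ₑ / ‖z - y‖ₑ
    with hT
  have hTm : ∀ k, Measurable (T k) := by
    intro k
    have hc : Continuous ((φ k).normed volume ⋆[lsmul ℝ ℝ, volume] Ω.indicator f) :=
      ((φ k).hasCompactSupport_normed (μ := volume)).continuous_convolution_left
        (lsmul ℝ ℝ) (φ k).continuous_normed hfi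
    have h1 : Continuous fun z => ‖((φ k).normed volume ⋆[lsmul ℝ ℝ, volume] Ω.indicator f) z
        - ((φ k).normed volume ⋆[lsmul ℝ ℝ, volume] Ω.indicator f) y - A (z - y)‖ₑ := by fun_prop
    have h2 : Continuous fun z : E m => ‖z - y‖ₑ := by fun_prop
    exact h1.measurable.div h2.measurable
  have hlim : ∀ᵐ z ∂(volume.restrict (Metric.ball y r)),
      ‖Ω.indicator f z - Ω.indicator f y - A (z - y)‖ₑ / ‖z - y‖ₑ
        = liminf (fun k => T k z) atTop := by
    filter_upwards [ae_restrict_of_ae hφf] with z hz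
    refine (Tendsto.liminf_eq ?_).symm
    -- At `z = y` all quotients are `0 / 0 = 0`.
    by_cases hzy : z = y
    · subst hzy
      simp [hT]
    · refine ENNReal.Tendsto.div_const ?_ (Or.inr (by simpa [sub_eq_zero] using hzy))
      exact ((hz.sub hφy).sub_const _).enorm
  rw [lintegral_congr_ae hlim]
  refine (lintegral_liminf_le hTm).trans ?_
  refine liminf_le_of_frequently_le' (Eventually.frequently ?_)
  filter_upwards [hφ0.eventually (gt_mem_nhds hr)] with k hk
  exact lintegral_mollify_expansion_le hΩ hf hg hfg (φ k) (hφ k) hk.le hr hyr h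

/-- Sobolev functions are approximately differentiable almost everywhere, the approximate
derivative being the weak gradient. -/
theorem ae_isLittleO_of_isWeakGrad [CompleteSpace F] {Ω : Set (E m)} (hΩ : IsOpen Ω)
    {f : E m → F} {g : E m → (E m →L[ℝ] F)} (hf : IntegrableOn f Ω) (hg : IntegrableOn g Ω)
    (hfg : IsWeakGrad Ω f g) :
    ∀ᵐ y ∂(volume.restrict Ω),
      (fun z => f z - f y - g y (z - y)) =o[apNhds y] fun z => z - y := by
  have hfi : LocallyIntegrable (Ω.indicator f) volume :=
    locallyIntegrable_indicator hΩ.measurableSet hf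
  have hgi : LocallyIntegrable (Ω.indicator g) volume :=
    locallyIntegrable_indicator hΩ.measurableSet hg
  -- The fixed ratio `rOut / rIn = 2` serves both the kernel bound and the almost everywhere
  -- convergence of the convolutions.
  set φ : ℕ → ContDiffBump (0 : E m) := fun k =>
    ⟨1 / ((k : ℝ) + 1), 2 * (1 / ((k : ℝ) + 1)), by positivity, by
      have : 0 < 1 / ((k : ℝ) + 1) := by positivity
      linarith⟩ with hφdef
  have hφ : ∀ k, (φ k).rOut ≤ 2 * (φ k).rIn := fun k => le_rfl
  have hφ0 : Tendsto (fun k => (φ k).rOut) atTop (𝓝 0) := by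
    simpa only [mul_zero] using (tendsto_one_div_add_atTop_nhds_zero_nat (𝕜 := ℝ)).const_mul 2
  have hφf := ContDiffBump.ae_convolution_tendsto_right_of_locallyIntegrable (μ := volume)
    hφ0 (Eventually.of_forall hφ) hfi
  rw [ae_restrict_iff' hΩ.measurableSet]
  filter_upwards [hφf, (Besicovitch.vitaliFamily volume).ae_tendsto_lintegral_enorm_sub_div hgi]
    with y hφy hleb hyΩ
  have hleb' := hleb.comp (Besicovitch.tendsto_filterAt volume y)
  rw [Set.indicator_of_mem hyΩ] at hleb'
  refine Asymptotics.isLittleO_iff.2 fun ε hε => ?_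
  rw [eventually_apNhds_iff, ENNReal.tendsto_nhds_zero]
  intro η hη
  -- The factor `4 ^ m` is the loss in `lintegral_expansion_le`; Chebyshev's inequality costs a
  -- division by `ε`.
  obtain ⟨δ, hδ, hδη⟩ : ∃ δ : ℝ≥0∞, 0 < δ ∧ 4 ^ m * δ ≤ ENNReal.ofReal ε * η := by
    refine ⟨ENNReal.ofReal ε * η / 4 ^ m, ?_, ?_⟩
    · exact ENNReal.div_pos (by simp [hε, hη.ne']) (by simp)
    · exact ENNReal.mul_div_le
  obtain ⟨r₀, hr₀, hr₀δ⟩ : ∃ r₀ : ℝ, 0 < r₀ ∧ ∀ s, 0 < s → s < r₀ →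
      ∫⁻ w in Metric.ball y s, ‖Ω.indicator g w - g y‖ₑ ≤ δ * volume (Metric.ball y s) := by
    have h1 := (ENNReal.tendsto_nhds_zero.1 hleb') δ hδ
    obtain ⟨r₀, hr₀, h2⟩ := mem_nhdsGT_iff_exists_Ioo_subset.1 h1
    refine ⟨r₀, hr₀, fun s hs hsr => ?_⟩
    have h3 : (∫⁻ w in Metric.closedBall y s, ‖Ω.indicator g w - g y‖ₑ) /
        volume (Metric.closedBall y s) ≤ δ := h2 ⟨hs, hsr⟩
    rw [ENNReal.div_le_iff (Metric.measure_closedBall_pos _ _ hs).ne'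
      measure_closedBall_lt_top.ne, Measure.addHaar_closedBall _ _ hs.le,
      ← Measure.addHaar_ball_of_pos _ y hs] at h3
    exact (lintegral_mono_set Metric.ball_subset_closedBall).trans h3
  obtain ⟨r₁, hr₁, hr₁Ω⟩ := Metric.isOpen_iff.1 hΩ y hyΩ
  filter_upwards [Ioo_mem_nhdsGT (show (0 : ℝ) < min r₀ r₁ / 2 by positivity)] with r hr
  have hr2 : 2 * r < min r₀ r₁ := by linarith [hr.2]
  have hball : Metric.ball y (2 * r) ⊆ Ω :=
    (Metric.ball_subset_ball (hr2.le.trans (min_le_right _ _))).trans hr₁Ω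
  have hmain := lintegral_expansion_le hΩ hf hg hfg hφ hφ0 hφf hφy hr.1 hball
    (A := g y) (δ := δ) fun s hs hsr => hr₀δ s hs (hsr.trans_lt (hr2.trans_le (min_le_left _ _)))
  rw [Set.indicator_of_mem hyΩ] at hmain
  refine ENNReal.div_le_of_le_mul ?_
  have hsub : {z ∈ Metric.ball y r | ¬ ‖f z - f y - g y (z - y)‖ ≤ ε * ‖z - y‖} ⊆
      {z | ENNReal.ofReal ε ≤ ‖Ω.indicator f z - f y - g y (z - y)‖ₑ / ‖z - y‖ₑ} ∩
        Metric.ball y r := by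
    rintro z ⟨hz, hzε⟩
    refine ⟨?_, hz⟩
    have hzΩ : z ∈ Ω := hball (Metric.ball_subset_ball (by linarith [hr.1]) hz)
    simp only [Set.mem_ofPred_eq, Set.indicator_of_mem hzΩ]
    have hzy : z ≠ y := by
      rintro rfl
      simp at hzε
    rw [ENNReal.le_div_iff_mul_le (Or.inl (by simpa [sub_eq_zero] using hzy))
      (Or.inl enorm_ne_top), ← ofReal_norm, ← ofReal_norm, ← ENNReal.ofReal_mul hε.le]
    exact ENNReal.ofReal_le_ofReal (not_le.1 hzε).le
  have hmeas : AEMeasurable (fun z => ‖Ω.indicator f z - f y - g y (z - y)‖ₑ / ‖z - y‖ₑ)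
      (volume.restrict (Metric.ball y r)) := by
    have h1 : AEStronglyMeasurable (fun z => Ω.indicator f z - f y - g y (z - y)) volume :=
      (hfi.aestronglyMeasurable.sub aestronglyMeasurable_const).sub
        (by fun_prop : Continuous fun z => g y (z - y)).aestronglyMeasurable
    have h2 : Continuous fun z : E m => ‖z - y‖ₑ := by fun_prop
    exact (h1.enorm.div h2.measurable.aemeasurable).restrict
  have hcheb := mul_meas_ge_le_lintegral₀ hmeas (ENNReal.ofReal ε)
  have hε0 : ENNReal.ofReal ε ≠ 0 := by simpa using hε
  refine (ENNReal.mul_le_mul_iff_right hε0 ENNReal.ofReal_ne_top).1 ?_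
  calc ENNReal.ofReal ε *
        volume {z ∈ Metric.ball y r | ¬ ‖f z - f y - g y (z - y)‖ ≤ ε * ‖z - y‖}
      ≤ ENNReal.ofReal ε * (volume.restrict (Metric.ball y r))
          {z | ENNReal.ofReal ε ≤ ‖Ω.indicator f z - f y - g y (z - y)‖ₑ / ‖z - y‖ₑ} := by
        refine mul_le_mul_right ?_ _
        exact (measure_mono hsub).trans (Measure.le_restrict_apply _ _)
    _ ≤ _ := hcheb
    _ ≤ 4 ^ m * δ * volume (Metric.ball y r) := hmain
    _ ≤ ENNReal.ofReal ε * η * volume (Metric.ball y r) := by gcongr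
    _ = ENNReal.ofReal ε * (η * volume (Metric.ball y r)) := by ring

end Sobolev

/-! ### Determinants and the first variation of the energy density -/

/-- The standard basis vectors of `ℝ^m`. -/
abbrev stdVec {m : ℕ} (j : Fin m) : E m := EuclideanSpace.single j 1

/-- The matrix of an endomorphism of `ℝ^m`. -/
def toMat {m : ℕ} (A : E m →L[ℝ] E m) : Matrix (Fin m) (Fin m) ℝ :=
  Matrix.of fun i j => A (stdVec j) i

theorem sum_smul_stdVec {m : ℕ} (x : E m) : ∑ i, x i • stdVec i = x := by
  ext k
  simp [Pi.single_apply]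

theorem norm_stdVec {m : ℕ} (j : Fin m) : ‖(stdVec j : E m)‖ = 1 := by
  simp [stdVec]

theorem det_toMat {m : ℕ} (A : E m →L[ℝ] E m) : (toMat A).det = A.det := by
  rw [ContinuousLinearMap.det, ← LinearMap.det_toMatrix (EuclideanSpace.basisFun (Fin m) ℝ).toBasis]
  rfl

/-- The trace of an endomorphism of `ℝ^m`. -/
def tr {m : ℕ} (A : E m →L[ℝ] E m) : ℝ := ∑ i, A (stdVec i) i

theorem contDiff_det {m : ℕ} : ContDiff ℝ ∞ fun A : E m →L[ℝ] E m => A.det := by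
  simp only [← det_toMat, Matrix.det_apply]
  refine ContDiff.sum fun σ _ => ContDiff.const_smul _ (contDiff_prod fun i _ => ?_)
  exact ((EuclideanSpace.proj (𝕜 := ℝ) (σ i)).comp
    (ContinuousLinearMap.apply ℝ (E m) (stdVec i))).contDiff

/-- Along a line through the identity the determinant is a polynomial whose linear coefficient is
the trace. -/
theorem hasDerivAt_det_one_add_smul {m : ℕ} (A : E m →L[ℝ] E m) :
    HasDerivAt (fun t : ℝ => (1 + t • A).det) (tr A) 0 := by
  have h1 : ∀ t : ℝ, (1 + t • A).det =
      Polynomial.eval t (Matrix.det (1 + (Polynomial.X : Polynomial ℝ) • (toMat A).map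
        Polynomial.C)) := by
    intro t
    have h2 : toMat (1 + t • A) = 1 + t • toMat A := by
      ext i j
      simp [toMat, Matrix.one_apply]
    rw [← det_toMat, h2, eval_det]
    simp [← Matrix.smul_eq_mul_diagonal]
  simp only [h1]
  have h3 := Polynomial.hasDerivAt (Matrix.det (1 + (Polynomial.X : Polynomial ℝ) •
    (toMat A).map Polynomial.C)) 0
  rw [Matrix.derivative_det_one_add_X_smul] at h3
  exact h3

/-- The trace as a continuous linear map. -/
def trCLM {m : ℕ} : (E m →L[ℝ] E m) →L[ℝ] ℝ :=
  ∑ i, (EuclideanSpace.proj (𝕜 := ℝ) i).comp (ContinuousLinearMap.apply ℝ (E m) (stdVec i))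

theorem trCLM_apply {m : ℕ} (A : E m →L[ℝ] E m) : trCLM A = tr A := by
  simp [trCLM, tr, _root_.sum_apply]

theorem fderiv_apply_eq_of_hasDerivAt_smul {V : Type*} [NormedAddCommGroup V] [NormedSpace ℝ V]
    {f : V → ℝ} (hf : DifferentiableAt ℝ f 0) {v : V} {c : ℝ}
    (h : HasDerivAt (fun t : ℝ => f (t • v)) c 0) : fderiv ℝ f 0 v = c := by
  have h1 : HasDerivAt (fun t : ℝ => t • v) v 0 := by
    simpa using (hasDerivAt_id (0 : ℝ)).smul_const v
  have h2 : HasFDerivAt f (fderiv ℝ f 0) ((0 : ℝ) • v) := by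
    rw [zero_smul]; exact hf.hasFDerivAt
  exact (h2.comp_hasDerivAt 0 h1).unique h

theorem hasFDerivAt_det_one_add {m : ℕ} :
    HasFDerivAt (fun A : E m →L[ℝ] E m => (1 + A).det) trCLM 0 := by
  have hd : DifferentiableAt ℝ (fun A : E m →L[ℝ] E m => (1 + A).det) 0 :=
    ((contDiff_det.comp (contDiff_const.add contDiff_id)).differentiable (by simp)) 0
  have h : fderiv ℝ (fun A : E m →L[ℝ] E m => (1 + A).det) 0 = trCLM :=
    ContinuousLinearMap.ext fun A => by
      rw [trCLM_apply]
      exact fderiv_apply_eq_of_hasDerivAt_smul hd (hasDerivAt_det_one_add_smul A)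
  rw [← h]
  exact hd.hasFDerivAt

theorem hasFDerivAt_inverse_one_add {V : Type*} [NormedAddCommGroup V] [NormedSpace ℝ V]
    [CompleteSpace V] : HasFDerivAt (fun A : V →L[ℝ] V => Ring.inverse (1 + A))
      (-ContinuousLinearMap.id ℝ _) 0 := by
  have h2 := hasFDerivAt_ringInverse (𝕜 := ℝ) (1 : (V →L[ℝ] V)ˣ)
  have h3 : HasFDerivAt (fun A : V →L[ℝ] V => 1 + A) (ContinuousLinearMap.id ℝ _) 0 :=
    (hasFDerivAt_id _).const_add 1
  have h4 : HasFDerivAt Ring.inverse (-ContinuousLinearMap.id ℝ (V →L[ℝ] V))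
      ((1 : V →L[ℝ] V) + 0) := by
    rw [add_zero]
    have e : (-ContinuousLinearMap.mulLeftRight ℝ (V →L[ℝ] V)
        ((1 : (V →L[ℝ] V)ˣ)⁻¹ : (V →L[ℝ] V)ˣ) ((1 : (V →L[ℝ] V)ˣ)⁻¹ : (V →L[ℝ] V)ˣ))
        = -ContinuousLinearMap.id ℝ (V →L[ℝ] V) := by
      refine ContinuousLinearMap.ext fun A => ?_
      simp
    rw [← e]
    exact h2
  exact h4.comp (0 : V →L[ℝ] V) h3

theorem hasFDerivAt_apply_inverse_one_add {V : Type*} [NormedAddCommGroup V] [NormedSpace ℝ V]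
    [CompleteSpace V] (v : V) (l : V →L[ℝ] ℝ) :
    HasFDerivAt (fun A : V →L[ℝ] V => l (Ring.inverse (1 + A) v))
      (-l.comp (ContinuousLinearMap.apply ℝ V v)) 0 := by
  set T : (V →L[ℝ] V) →L[ℝ] ℝ := l.comp (ContinuousLinearMap.apply ℝ V v)
  have h := T.hasFDerivAt.comp (0 : V →L[ℝ] V) hasFDerivAt_inverse_one_add
  have e : T.comp (-ContinuousLinearMap.id ℝ (V →L[ℝ] V)) = -T := by
    refine ContinuousLinearMap.ext fun A => ?_
    simp
  rw [e] at h
  exact h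

/-- The entries of `(1 + A)⁻¹`. -/
def invEntry {m : ℕ} (k j : Fin m) (A : E m →L[ℝ] E m) : ℝ :=
  Ring.inverse (1 + A) (stdVec j) k

theorem hasFDerivAt_invEntry {m : ℕ} (k j : Fin m) :
    HasFDerivAt (invEntry k j) (-(EuclideanSpace.proj (𝕜 := ℝ) k).comp
      (ContinuousLinearMap.apply ℝ (E m) (stdVec j))) (0 : E m →L[ℝ] E m) :=
  hasFDerivAt_apply_inverse_one_add (stdVec j) (EuclideanSpace.proj (𝕜 := ℝ) k)

/-- The coefficients of the pulled back energy density. -/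
def energyCoeff {m : ℕ} (k l : Fin m) (A : E m →L[ℝ] E m) : ℝ :=
  (1 + A).det * ∑ j, invEntry k j A * invEntry l j A

/-- To first order the determinant contributes `tr A`, and each of the two factors `(1 + A)⁻¹`
contributes `-A`. -/
theorem energyCoeff_isLittleO {m : ℕ} (k l : Fin m) :
    (fun A : E m →L[ℝ] E m => energyCoeff k l A - (if k = l then 1 else 0)
      - ((if k = l then 1 else 0) * tr A - A (stdVec k) l - A (stdVec l) k)) =o[𝓝 0] id := by
  have h1 := hasFDerivAt_det_one_add (m := m)
  have h2 : HasFDerivAt (fun A : E m →L[ℝ] E m => ∑ j, invEntry k j A * invEntry l j A) _ 0 :=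
    HasFDerivAt.fun_sum (u := Finset.univ) fun j _ =>
      (hasFDerivAt_invEntry k j).mul (hasFDerivAt_invEntry l j)
  have h3 := (h1.fun_mul h2).isLittleO
  have h0 : ∀ k j : Fin m, invEntry k j (0 : E m →L[ℝ] E m) = if k = j then 1 else 0 := by
    intro k j
    simp [invEntry]
  have hdet : ((1 : E m →L[ℝ] E m) + 0).det = 1 := by simp [ContinuousLinearMap.det]
  have hδ : ∑ j, invEntry k j (0 : E m →L[ℝ] E m) * invEntry l j 0 = if k = l then 1 else 0 := by
    simp [h0]
  have hs : ∀ A : E m →L[ℝ] E m, (∑ i, (invEntry k i (0 : E m →L[ℝ] E m) •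
        -(EuclideanSpace.proj (𝕜 := ℝ) l).comp (ContinuousLinearMap.apply ℝ (E m) (stdVec i)) +
      invEntry l i (0 : E m →L[ℝ] E m) •
        -(EuclideanSpace.proj (𝕜 := ℝ) k).comp (ContinuousLinearMap.apply ℝ (E m) (stdVec i)))) A
      = - A (stdVec k) l - A (stdVec l) k := by
    intro A
    rw [_root_.sum_apply]
    simp only [_root_.add_apply, _root_.smul_apply, _root_.neg_apply,
      ContinuousLinearMap.comp_apply, ContinuousLinearMap.apply_apply, PiLp.proj_apply, h0,
      smul_eq_mul, ite_mul, one_mul, zero_mul, Finset.sum_add_distrib, Finset.sum_ite_eq,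
      Finset.mem_univ, if_true]
    ring
  refine (h3.congr_left fun A => ?_).congr_right fun A => by simp
  rw [_root_.add_apply, _root_.smul_apply, _root_.smul_apply, sub_zero, hs, hδ, hdet, trCLM_apply]
  simp only [energyCoeff, smul_eq_mul]
  ring

variable {F : Type*} [NormedAddCommGroup F] [InnerProductSpace ℝ F]

/-- The square of the Hilbert–Schmidt norm. -/
def hsSq {m : ℕ} (G : E m →L[ℝ] F) : ℝ := ∑ j, ‖G (stdVec j)‖ ^ 2

theorem hsSq_nonneg {m : ℕ} (G : E m →L[ℝ] F) : 0 ≤ hsSq G :=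
  Finset.sum_nonneg fun _ _ => by positivity

theorem hsSq_le {m : ℕ} (G : E m →L[ℝ] F) : hsSq G ≤ m * ‖G‖ ^ 2 := by
  have : ∀ j ∈ (Finset.univ : Finset (Fin m)), ‖G (stdVec j)‖ ^ 2 ≤ ‖G‖ ^ 2 := by
    intro j _
    have := G.le_opNorm (stdVec j)
    rw [norm_stdVec, mul_one] at this
    gcongr
  simpa [hsSq] using Finset.sum_le_card_nsmul _ _ _ this

/-- The first variation of the energy density under a linear change of variables. -/
def varDensity {m : ℕ} (G : E m →L[ℝ] F) (A : E m →L[ℝ] E m) : ℝ :=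
  tr A * hsSq G - 2 * ∑ j, inner ℝ (G (stdVec j)) (G (A (stdVec j)))

/-- Separates the quadratic dependence on `G` from the dependence on `A`; expanding the coefficients
alone then gives an error uniform in `G`. -/
theorem det_mul_hsSq_eq {m : ℕ} (G : E m →L[ℝ] F) (A : E m →L[ℝ] E m) :
    (1 + A).det * hsSq (G.comp (Ring.inverse (1 + A))) =
      ∑ k, ∑ l, energyCoeff k l A * inner ℝ (G (stdVec k)) (G (stdVec l)) := by
  have h1 : ∀ j, ‖G (Ring.inverse (1 + A) (stdVec j))‖ ^ 2 =
      ∑ k, ∑ l, invEntry k j A * invEntry l j A * inner ℝ (G (stdVec k)) (G (stdVec l)) := by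
    intro j
    have h2 : G (Ring.inverse (1 + A) (stdVec j)) = ∑ k, invEntry k j A • G (stdVec k) := by
      conv_lhs => rw [← sum_smul_stdVec (Ring.inverse (1 + A) (stdVec j))]
      simp only [map_sum, map_smul, invEntry]
    rw [h2, ← real_inner_self_eq_norm_sq, sum_inner]
    refine Finset.sum_congr rfl fun k _ => ?_
    rw [inner_sum]
    refine Finset.sum_congr rfl fun l _ => ?_
    rw [real_inner_smul_left, real_inner_smul_right, mul_assoc]
  simp only [hsSq, ContinuousLinearMap.comp_apply, h1, energyCoeff]
  rw [Finset.sum_comm, Finset.mul_sum]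
  refine Finset.sum_congr rfl fun k _ => ?_
  rw [Finset.sum_comm, Finset.mul_sum]
  refine Finset.sum_congr rfl fun l _ => ?_
  rw [← Finset.sum_mul]
  ring

theorem hsSq_add_varDensity_eq {m : ℕ} (G : E m →L[ℝ] F) (A : E m →L[ℝ] E m) :
    hsSq G + varDensity G A = ∑ k, ∑ l, ((if k = l then 1 else 0)
      + ((if k = l then 1 else 0) * tr A - A (stdVec k) l - A (stdVec l) k)) *
        inner ℝ (G (stdVec k)) (G (stdVec l)) := by
  have h1 : ∀ j, (inner ℝ (G (stdVec j)) (G (A (stdVec j))) : ℝ) =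
      ∑ l, A (stdVec j) l * inner ℝ (G (stdVec j)) (G (stdVec l)) := by
    intro j
    conv_lhs => rw [← sum_smul_stdVec (A (stdVec j))]
    simp only [map_sum, map_smul, inner_sum, real_inner_smul_right]
  have h2 : ∑ k, ∑ l, A (stdVec l) k * (inner ℝ (G (stdVec k)) (G (stdVec l)) : ℝ) =
      ∑ k, ∑ l, A (stdVec k) l * inner ℝ (G (stdVec k)) (G (stdVec l)) := by
    rw [Finset.sum_comm]
    refine Finset.sum_congr rfl fun k _ => Finset.sum_congr rfl fun l _ => ?_
    rw [real_inner_comm]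
  have h3 : ∀ k l : Fin m, ((if k = l then 1 else 0)
      + ((if k = l then 1 else 0) * tr A - A (stdVec k) l - A (stdVec l) k)) *
        (inner ℝ (G (stdVec k)) (G (stdVec l)) : ℝ) =
      (if k = l then (1 + tr A) * ‖G (stdVec k)‖ ^ 2 else 0)
        - A (stdVec k) l * inner ℝ (G (stdVec k)) (G (stdVec l))
        - A (stdVec l) k * inner ℝ (G (stdVec k)) (G (stdVec l)) := by
    intro k l
    by_cases hkl : k = l
    · subst hkl
      simp only [if_true, real_inner_self_eq_norm_sq]
      ring
    · simp only [hkl, if_false]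
      ring
  simp only [h3, Finset.sum_sub_distrib, h2, Finset.sum_ite_eq, Finset.mem_univ, if_true,
    varDensity, hsSq, h1, ← Finset.mul_sum]
  ring

/-- First order expansion of the energy density, uniformly in the gradient. -/
theorem exists_energy_expansion (m : ℕ) (F : Type*) [NormedAddCommGroup F]
    [InnerProductSpace ℝ F] {ε : ℝ} (hε : 0 < ε) :
    ∃ δ : ℝ, 0 < δ ∧ ∀ A : E m →L[ℝ] E m, ‖A‖ < δ → ∀ G : E m →L[ℝ] F,
      |(1 + A).det * hsSq (G.comp (Ring.inverse (1 + A))) - hsSq G - varDensity G A| ≤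
        ε * ‖A‖ * ‖G‖ ^ 2 := by
  -- There are `m * m` coefficients; the extra `1` keeps the denominator positive for `m = 0`.
  have hm : 0 < ε / (m * m + 1) := by positivity
  have h1 : ∀ᶠ A in 𝓝 (0 : E m →L[ℝ] E m), ∀ k l, |energyCoeff k l A - (if k = l then 1 else 0)
      - ((if k = l then 1 else 0) * tr A - A (stdVec k) l - A (stdVec l) k)| ≤
        ε / (m * m + 1) * ‖A‖ :=
    eventually_all.2 fun k => eventually_all.2 fun l => (energyCoeff_isLittleO k l).def hm
  obtain ⟨δ, hδ, h2⟩ := Metric.eventually_nhds_iff.1 h1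
  refine ⟨δ, hδ, fun A hA G => ?_⟩
  have h3 := h2 (by simpa using hA : dist A 0 < δ)
  have hin : ∀ k l, |(inner ℝ (G (stdVec k)) (G (stdVec l)) : ℝ)| ≤ ‖G‖ ^ 2 := by
    intro k l
    have hG : ∀ j, ‖G (stdVec j)‖ ≤ ‖G‖ := by
      intro j
      have := G.le_opNorm (stdVec j)
      rwa [norm_stdVec, mul_one] at this
    refine (abs_real_inner_le_norm _ _).trans ?_
    rw [sq]
    exact mul_le_mul (hG k) (hG l) (norm_nonneg _) (norm_nonneg _)
  have h4 : (1 + A).det * hsSq (G.comp (Ring.inverse (1 + A))) - hsSq G - varDensity G A =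
      ∑ k, ∑ l, (energyCoeff k l A - (if k = l then 1 else 0)
      - ((if k = l then 1 else 0) * tr A - A (stdVec k) l - A (stdVec l) k)) *
        inner ℝ (G (stdVec k)) (G (stdVec l)) := by
    rw [sub_sub, hsSq_add_varDensity_eq, det_mul_hsSq_eq, ← Finset.sum_sub_distrib]
    refine Finset.sum_congr rfl fun k _ => ?_
    rw [← Finset.sum_sub_distrib]
    refine Finset.sum_congr rfl fun l _ => ?_
    ring
  rw [h4]
  calc _ ≤ ∑ k : Fin m, ∑ l : Fin m, ε / (m * m + 1) * ‖A‖ * ‖G‖ ^ 2 := by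
        refine (Finset.abs_sum_le_sum_abs _ _).trans (Finset.sum_le_sum fun k _ => ?_)
        refine (Finset.abs_sum_le_sum_abs _ _).trans (Finset.sum_le_sum fun l _ => ?_)
        rw [abs_mul]
        exact mul_le_mul (h3 k l) (hin k l) (abs_nonneg _) (by positivity)
    _ = (m * m / (m * m + 1)) * (ε * ‖A‖ * ‖G‖ ^ 2) := by
        simp only [Finset.sum_const, Finset.card_univ, Fintype.card_fin, nsmul_eq_mul]
        ring
    _ ≤ 1 * (ε * ‖A‖ * ‖G‖ ^ 2) := by
        gcongr
        rw [div_le_one (by positivity)]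
        linarith
    _ = _ := one_mul _

/-! ### Smooth changes of variables -/

theorem fderiv_inverse_eq {V : Type*} [NormedAddCommGroup V] [NormedSpace ℝ V] {Φ Ψ : V → V}
    (hΦ : Differentiable ℝ Φ) (hΨ : Differentiable ℝ Ψ) (hl : ∀ y, Ψ (Φ y) = y)
    (hr : ∀ z, Φ (Ψ z) = z) (y : V) : fderiv ℝ Ψ (Φ y) = Ring.inverse (fderiv ℝ Φ y) := by
  have h1 : fderiv ℝ Ψ (Φ y) * fderiv ℝ Φ y = 1 := by
    have h := (hΨ (Φ y)).hasFDerivAt.comp y (hΦ y).hasFDerivAt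
    have e : Ψ ∘ Φ = id := funext hl
    rw [e] at h
    exact h.unique (hasFDerivAt_id y)
  have h2 : fderiv ℝ Φ y * fderiv ℝ Ψ (Φ y) = 1 := by
    have h3 := (hΦ y).hasFDerivAt
    nth_rw 2 [← hl y] at h3
    have h := h3.comp (Φ y) (hΨ (Φ y)).hasFDerivAt
    have e : Φ ∘ Ψ = id := funext hr
    rw [e] at h
    exact h.unique (hasFDerivAt_id _)
  exact (Ring.inverse_unit (⟨_, _, h2, h1⟩ : (V →L[ℝ] V)ˣ)).symm

/-- An orientation preserving diffeomorphism of `ℝ^m` that maps `Ω` to itself, with bounded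
Jacobian and bounded inverse derivative. -/
structure SmoothTransform {m : ℕ} (Ω : Set (E m)) where
  /-- the diffeomorphism -/
  toFun : E m → E m
  /-- its inverse -/
  inv : E m → E m
  contDiff_toFun : ContDiff ℝ ∞ toFun
  contDiff_inv : ContDiff ℝ ∞ inv
  left_inv : ∀ y, inv (toFun y) = y
  right_inv : ∀ z, toFun (inv z) = z
  det_pos : ∀ y, 0 < (fderiv ℝ toFun y).det
  /-- a bound for the Jacobian and the inverse derivative -/
  bound : ℝ
  det_le : ∀ y, (fderiv ℝ toFun y).det ≤ bound
  norm_fderiv_inv_le : ∀ z, ‖fderiv ℝ inv z‖ ≤ bound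
  mem_iff : ∀ y, toFun y ∈ Ω ↔ y ∈ Ω

namespace SmoothTransform

variable {m : ℕ} {Ω : Set (E m)} (T : SmoothTransform Ω)
  {F : Type*} [NormedAddCommGroup F] [NormedSpace ℝ F]

/-- The Jacobian determinant. -/
def jac (y : E m) : ℝ := (fderiv ℝ T.toFun y).det

theorem contDiff_jac : ContDiff ℝ ∞ T.jac :=
  contDiff_det.comp (T.contDiff_toFun.fderiv_right (by simp))

theorem inv_mem_iff (z : E m) : T.inv z ∈ Ω ↔ z ∈ Ω := by
  rw [← T.mem_iff, T.right_inv]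

theorem image_eq : T.toFun '' Ω = Ω := by
  ext z
  exact ⟨by rintro ⟨y, hy, rfl⟩; exact (T.mem_iff y).2 hy,
    fun hz => ⟨T.inv z, (T.inv_mem_iff z).2 hz, T.right_inv z⟩⟩

theorem image_univ_eq : T.toFun '' Set.univ = Set.univ :=
  Set.image_univ_of_surjective fun z => ⟨T.inv z, T.right_inv z⟩

theorem hasFDerivAt (y : E m) : HasFDerivAt T.toFun (fderiv ℝ T.toFun y) y :=
  (T.contDiff_toFun.differentiable (by simp) y).hasFDerivAt

theorem hasFDerivAt_inv (z : E m) : HasFDerivAt T.inv (fderiv ℝ T.inv z) z :=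
  (T.contDiff_inv.differentiable (by simp) z).hasFDerivAt

theorem fderiv_inv_eq (y : E m) :
    fderiv ℝ T.inv (T.toFun y) = Ring.inverse (fderiv ℝ T.toFun y) :=
  fderiv_inverse_eq (T.contDiff_toFun.differentiable (by simp))
    (T.contDiff_inv.differentiable (by simp)) T.left_inv T.right_inv y

theorem setIntegral_comp {S : Set (E m)} (hS : MeasurableSet S) (hTS : T.toFun '' S = S)
    (k : E m → F) : ∫ z in S, k z = ∫ y in S, T.jac y • k (T.toFun y) := by
  conv_lhs => rw [← hTS]
  rw [integral_image_eq_integral_abs_det_fderiv_smul volume hS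
    (fun y _ => (T.hasFDerivAt y).hasFDerivWithinAt)
    (Function.LeftInverse.injective T.left_inv).injOn]
  refine integral_congr_ae (Eventually.of_forall fun y => ?_)
  simp only [abs_of_pos (T.det_pos y), jac]

theorem setLIntegral_comp (hΩ : MeasurableSet Ω) (k : E m → ℝ≥0∞) :
    ∫⁻ z in Ω, k z = ∫⁻ y in Ω, ENNReal.ofReal (T.jac y) * k (T.toFun y) := by
  conv_lhs => rw [← T.image_eq]
  rw [lintegral_image_eq_lintegral_abs_det_fderiv_mul volume hΩ
    (fun y _ => (T.hasFDerivAt y).hasFDerivWithinAt)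
    (Function.LeftInverse.injective T.left_inv).injOn]
  refine lintegral_congr fun y => ?_
  simp only [abs_of_pos (T.det_pos y), jac]

/-- The image measure has the Jacobian as density on `Ω`, and the Jacobian is bounded. This carries
null sets and `L^p` bounds through composition with `inv`. -/
theorem map_inv_le (hΩ : MeasurableSet Ω) :
    Measure.map T.inv (volume.restrict Ω) ≤ ENNReal.ofReal T.bound • volume.restrict Ω := by
  have hm : Measurable T.inv := T.contDiff_inv.continuous.measurable
  refine Measure.le_iff.2 fun S hS => ?_
  rw [Measure.map_apply hm hS, ← lintegral_indicator_one (hm hS), T.setLIntegral_comp hΩ,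
    Measure.smul_apply, smul_eq_mul, ← lintegral_indicator_one hS,
    ← lintegral_const_mul _ (measurable_one.indicator hS)]
  refine lintegral_mono fun y => ?_
  have h1 : (T.inv ⁻¹' S).indicator (1 : E m → ℝ≥0∞) (T.toFun y) = S.indicator 1 y := by
    have h2 : T.toFun y ∈ T.inv ⁻¹' S ↔ y ∈ S := by rw [Set.mem_preimage, T.left_inv]
    by_cases hy : y ∈ S
    · rw [Set.indicator_of_mem hy, Set.indicator_of_mem (h2.2 hy)]; rfl
    · rw [Set.indicator_of_notMem hy, Set.indicator_of_notMem (mt h2.1 hy)]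
  rw [h1]
  gcongr
  exact T.det_le y

theorem ae_comp_inv (hΩ : MeasurableSet Ω) {P : E m → Prop}
    (h : ∀ᵐ y ∂(volume.restrict Ω), P y) : ∀ᵐ z ∂(volume.restrict Ω), P (T.inv z) := by
  have hm : Measurable T.inv := T.contDiff_inv.continuous.measurable
  have hac := Measure.absolutelyContinuous_of_le_smul (T.map_inv_le hΩ)
  exact ae_of_ae_map hm.aemeasurable (hac.ae_le h)

theorem memLp_comp_inv {G : Type*} [NormedAddCommGroup G] (hΩ : MeasurableSet Ω) {p : ℝ≥0∞}
    {f : E m → G} (hf : MemLp f p (volume.restrict Ω)) : MemLp (fun z => f (T.inv z)) p (volume.restrict Ω) := by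
  have hm : Measurable T.inv := T.contDiff_inv.continuous.measurable
  exact MemLp.comp_of_map (hf.of_measure_le_smul ENNReal.ofReal_ne_top (T.map_inv_le hΩ))
    hm.aemeasurable

theorem memLp_grad_comp_inv (hΩ : MeasurableSet Ω) {g : E m → (E m →L[ℝ] F)}
    (hg : MemLp g 2 (volume.restrict Ω)) :
    MemLp (fun z => (g (T.inv z)).comp (fderiv ℝ T.inv z)) 2 (volume.restrict Ω) := by
  have h1 := T.memLp_comp_inv hΩ hg
  have h2 : Continuous fun z => fderiv ℝ T.inv z := T.contDiff_inv.continuous_fderiv (by simp)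
  refine MemLp.of_le_mul (c := T.bound) h1 ?_ (Eventually.of_forall fun z => ?_)
  · have h3 : Continuous fun p : (E m →L[ℝ] F) × (E m →L[ℝ] E m) => p.1.comp p.2 := by
      fun_prop
    exact h3.comp_aestronglyMeasurable (h1.1.prodMk h2.aestronglyMeasurable)
  · refine (ContinuousLinearMap.opNorm_comp_le _ _).trans ?_
    rw [mul_comm]
    exact mul_le_mul_of_nonneg_right (T.norm_fderiv_inv_le z) (norm_nonneg _)

/-- The vector field used to test the weak gradient of a composition. -/
def testField (ψ : E m → ℝ) (v : E m) (y : E m) : E m :=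
  (T.jac y * ψ (T.toFun y)) • fderiv ℝ T.inv (T.toFun y) v

theorem contDiff_testField {ψ : E m → ℝ} (hψ : ContDiff ℝ ∞ ψ) (v : E m) :
    ContDiff ℝ ∞ (T.testField ψ v) := by
  have h1 : ContDiff ℝ ∞ fun y => fderiv ℝ T.inv (T.toFun y) :=
    (T.contDiff_inv.fderiv_right (by simp)).comp T.contDiff_toFun
  exact (T.contDiff_jac.mul (hψ.comp T.contDiff_toFun)).smul (h1.clm_apply contDiff_const)

theorem testField_eq_zero {ψ : E m → ℝ} (v : E m) {y : E m}
    (hy : y ∉ T.inv '' tsupport ψ) : T.testField ψ v y = 0 := by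
  have : T.toFun y ∉ tsupport ψ := fun h => hy ⟨_, h, T.left_inv y⟩
  rw [testField, image_eq_zero_of_notMem_tsupport this]
  simp

/-- Pass to the variable `z = T y`, integrate by parts there in the constant direction `v`, and
return; the derivative of `θ ∘ T⁻¹` produces the test field. -/
theorem integral_inner_fderiv_testField {ψ : E m → ℝ} (hψ : ContDiff ℝ ∞ ψ)
    (hψc : HasCompactSupport ψ) (v : E m) {θ : E m → ℝ} (hθ : ContDiff ℝ ∞ θ) :
    ∫ y, θ y * (T.jac y * fderiv ℝ ψ (T.toFun y) v) =
      - ∫ y, fderiv ℝ θ y (T.testField ψ v y) := by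
  have hθT : ContDiff ℝ ∞ fun z => θ (T.inv z) := hθ.comp T.contDiff_inv
  have hfd : ∀ z, fderiv ℝ (fun z => θ (T.inv z)) z v
      = fderiv ℝ θ (T.inv z) (fderiv ℝ T.inv z v) := by
    intro z
    have h1 := ((hθ.differentiable (by simp)) (T.inv z)).hasFDerivAt.comp z (T.hasFDerivAt_inv z)
    have h2 : fderiv ℝ (fun z => θ (T.inv z)) z = _ := h1.fderiv
    rw [h2]
    rfl
  have hψ' : Continuous fun z => fderiv ℝ ψ z v :=
    (hψ.continuous_fderiv (by simp)).clm_apply continuous_const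
  have hθ' : Continuous fun z => fderiv ℝ (fun z => θ (T.inv z)) z v :=
    (hθT.continuous_fderiv (by simp)).clm_apply continuous_const
  have hψ'c : HasCompactSupport fun z => fderiv ℝ ψ z v := hψc.fderiv_apply ℝ v
  have hibp := integral_mul_fderiv_eq_neg_fderiv_mul_of_integrable (μ := volume) (v := v)
    (f := ψ) (g := fun z => θ (T.inv z))
    ((hψ'.mul hθT.continuous).integrable_of_hasCompactSupport hψ'c.mul_right)
    ((hψ.continuous.mul hθ').integrable_of_hasCompactSupport hψc.mul_right)
    ((hψ.continuous.mul hθT.continuous).integrable_of_hasCompactSupport hψc.mul_right)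
    (fun x _ => hψ.differentiable (by simp) x) (fun x _ => hθT.differentiable (by simp) x)
  have e1 : ∫ z, fderiv ℝ ψ z v * θ (T.inv z) =
      ∫ y, θ y * (T.jac y * fderiv ℝ ψ (T.toFun y) v) := by
    have := T.setIntegral_comp MeasurableSet.univ T.image_univ_eq
      fun z => fderiv ℝ ψ z v * θ (T.inv z)
    rw [setIntegral_univ, setIntegral_univ] at this
    rw [this]
    refine integral_congr_ae (Eventually.of_forall fun y => ?_)
    simp only [T.left_inv, smul_eq_mul]
    ring
  have e2 : ∫ z, ψ z * fderiv ℝ (fun z => θ (T.inv z)) z v =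
      ∫ y, fderiv ℝ θ y (T.testField ψ v y) := by
    have := T.setIntegral_comp MeasurableSet.univ T.image_univ_eq
      fun z => ψ z * fderiv ℝ (fun z => θ (T.inv z)) z v
    rw [setIntegral_univ, setIntegral_univ] at this
    rw [this]
    refine integral_congr_ae (Eventually.of_forall fun y => ?_)
    simp only [hfd, T.left_inv, smul_eq_mul, testField, map_smul]
    ring
  rw [← e1, ← e2, hibp, neg_neg]

end SmoothTransform

/-! ### Testing with vector fields and the chain rule for weak gradients. -/

/-- The divergence of a vector field. -/
def divergence {m : ℕ} (X : E m → E m) (y : E m) : ℝ :=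
  ∑ i, fderiv ℝ (fun y => X y i) y (stdVec i)

theorem contDiff_apply_euclidean {m : ℕ} {X : E m → E m} (hX : ContDiff ℝ ∞ X) (i : Fin m) :
    ContDiff ℝ ∞ fun y => X y i :=
  (EuclideanSpace.proj (𝕜 := ℝ) i).contDiff.comp hX

theorem hasCompactSupport_apply_euclidean {m : ℕ} {X : E m → E m} (hX : HasCompactSupport X)
    (i : Fin m) : HasCompactSupport fun y => X y i :=
  hX.comp_left (g := fun x : E m => x i) rfl

theorem continuous_divergence {m : ℕ} {X : E m → E m} (hX : ContDiff ℝ ∞ X) :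
    Continuous (divergence X) :=
  continuous_finsetSum _ fun i _ =>
    ((contDiff_apply_euclidean hX i).continuous_fderiv (by simp)).clm_apply continuous_const

theorem integral_mul_divergence {m : ℕ} {X : E m → E m} (hX : ContDiff ℝ ∞ X)
    (hXc : HasCompactSupport X) {θ : E m → ℝ} (hθ : ContDiff ℝ ∞ θ) :
    ∫ y, θ y * divergence X y = - ∫ y, fderiv ℝ θ y (X y) := by
  have hXi := fun i => contDiff_apply_euclidean hX i
  have hXci := fun i => hasCompactSupport_apply_euclidean hXc i
  have hθ' : ∀ i, Continuous fun y => fderiv ℝ θ y (stdVec i) := fun i =>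
    (hθ.continuous_fderiv (by simp)).clm_apply continuous_const
  have hX' : ∀ i, Continuous fun y => fderiv ℝ (fun y => X y i) y (stdVec i) := fun i =>
    ((hXi i).continuous_fderiv (by simp)).clm_apply continuous_const
  have hX'c : ∀ i, HasCompactSupport fun y => fderiv ℝ (fun y => X y i) y (stdVec i) :=
    fun i => (hXci i).fderiv_apply ℝ _
  have hI1 : ∀ i, Integrable (fun y => θ y * fderiv ℝ (fun y => X y i) y (stdVec i)) volume :=
    fun i => (hθ.continuous.mul (hX' i)).integrable_of_hasCompactSupport (hX'c i).mul_left
  have hI2 : ∀ i, Integrable (fun y => fderiv ℝ θ y (stdVec i) * X y i) volume :=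
    fun i => ((hθ' i).mul (hXi i).continuous).integrable_of_hasCompactSupport (hXci i).mul_left
  have h1 : ∀ i, ∫ y, θ y * fderiv ℝ (fun y => X y i) y (stdVec i) =
      - ∫ y, fderiv ℝ θ y (stdVec i) * X y i := fun i =>
    integral_mul_fderiv_eq_neg_fderiv_mul_of_integrable (hI2 i) (hI1 i)
      ((hθ.continuous.mul (hXi i).continuous).integrable_of_hasCompactSupport (hXci i).mul_left)
      (fun x _ => hθ.differentiable (by simp) x) (fun x _ => (hXi i).differentiable (by simp) x)
  simp only [divergence, Finset.mul_sum]
  rw [integral_finsetSum _ fun i _ => hI1 i, Finset.sum_congr rfl fun i _ => h1 i,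
    Finset.sum_neg_distrib, ← integral_finsetSum _ fun i _ => hI2 i]
  congr 2
  funext y
  conv_rhs => rw [← sum_smul_stdVec (X y)]
  simp [mul_comm]

/-- Weak gradients can be tested with vector fields. -/
theorem IsWeakGrad.integral_divergence {m : ℕ} {F : Type*} [NormedAddCommGroup F]
    [NormedSpace ℝ F] {Ω : Set (E m)} {f : E m → F}
    {g : E m → (E m →L[ℝ] F)} (hf : IntegrableOn f Ω) (hg : IntegrableOn g Ω)
    (hfg : IsWeakGrad Ω f g) {X : E m → E m} (hX : ContDiff ℝ ∞ X)
    (hXc : HasCompactSupport X) (hXΩ : tsupport X ⊆ Ω) :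
    ∫ y in Ω, divergence X y • f y = - ∫ y in Ω, g y (X y) := by
  have hXi := fun i => contDiff_apply_euclidean hX i
  have hXci := fun i => hasCompactSupport_apply_euclidean hXc i
  have hXti : ∀ i, tsupport (fun y => X y i) ⊆ Ω := fun i =>
    (tsupport_comp_subset (g := fun x : E m => x i) rfl X).trans hXΩ
  have hX' : ∀ i, Continuous fun y => fderiv ℝ (fun y => X y i) y (stdVec i) := fun i =>
    ((hXi i).continuous_fderiv (by simp)).clm_apply continuous_const
  have hbdd : ∀ {k : E m → ℝ}, Continuous k → HasCompactSupport k → ∃ C, ∀ y, ‖k y‖ ≤ C :=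
    fun hk hkc => hkc.exists_bound_of_continuous hk
  have hI1 : ∀ i, IntegrableOn (fun y => fderiv ℝ (fun y => X y i) y (stdVec i) • f y) Ω := by
    intro i
    obtain ⟨C, hC⟩ := hbdd (hX' i) ((hXci i).fderiv_apply ℝ _)
    exact hf.bdd_smul C (hX' i).aestronglyMeasurable (Eventually.of_forall hC)
  have hgi : ∀ i, IntegrableOn (fun y => g y (stdVec i)) Ω := fun i =>
    (ContinuousLinearMap.apply ℝ F (stdVec i : E m)).integrable_comp hg
  have hI2 : ∀ i, IntegrableOn (fun y => X y i • g y (stdVec i)) Ω := by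
    intro i
    obtain ⟨C, hC⟩ := hbdd (hXi i).continuous (hXci i)
    exact (hgi i).bdd_smul C (hXi i).continuous.aestronglyMeasurable (Eventually.of_forall hC)
  simp only [divergence, Finset.sum_smul]
  rw [integral_finsetSum _ fun i _ => hI1 i,
    Finset.sum_congr rfl fun i _ => hfg _ (hXi i) (hXci i) (hXti i) (stdVec i),
    Finset.sum_neg_distrib, ← integral_finsetSum _ fun i _ => hI2 i]
  congr 2
  funext y
  conv_rhs => rw [← sum_smul_stdVec (X y)]
  simp

/-- The chain rule for weak gradients under smooth changes of variables. -/
theorem IsWeakGrad.comp_inv {m : ℕ} {F : Type*} [NormedAddCommGroup F]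
    [NormedSpace ℝ F] {Ω : Set (E m)} (hΩ : MeasurableSet Ω) (T : SmoothTransform Ω) {f : E m → F}
    {g : E m → (E m →L[ℝ] F)} (hf : IntegrableOn f Ω) (hg : IntegrableOn g Ω)
    (hfg : IsWeakGrad Ω f g) :
    IsWeakGrad Ω (fun z => f (T.inv z)) fun z => (g (T.inv z)).comp (fderiv ℝ T.inv z) := by
  intro ψ hψ hψc hψΩ v
  have hKc : IsCompact (T.inv '' tsupport ψ) := hψc.isCompact.image T.contDiff_inv.continuous
  have hX := T.contDiff_testField hψ v
  have hXt : tsupport (T.testField ψ v) ⊆ T.inv '' tsupport ψ := by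
    refine closure_minimal (fun y hy => ?_) hKc.isClosed
    by_contra h
    exact hy (T.testField_eq_zero v h)
  have hXc : HasCompactSupport (T.testField ψ v) :=
    hKc.of_isClosed_subset (isClosed_tsupport _) hXt
  have hXΩ : tsupport (T.testField ψ v) ⊆ Ω := by
    refine hXt.trans ?_
    rintro _ ⟨z, hz, rfl⟩
    exact (T.inv_mem_iff z).2 (hψΩ hz)
  have hψ' : Continuous fun y => T.jac y * fderiv ℝ ψ (T.toFun y) v :=
    T.contDiff_jac.continuous.mul
      (((hψ.continuous_fderiv (by simp)).comp T.contDiff_toFun.continuous).clm_apply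
        continuous_const)
  -- A form of the Piola identity, obtained by duality: both sides have the same integral against
  -- every test function, so no derivative of a cofactor is computed.
  have hdiv : ∀ᵐ y : E m, T.jac y * fderiv ℝ ψ (T.toFun y) v = divergence (T.testField ψ v) y := by
    refine ae_eq_of_integral_contDiff_smul_eq hψ'.locallyIntegrable
      (continuous_divergence hX).locallyIntegrable fun θ hθ _ => ?_
    simp only [smul_eq_mul]
    rw [T.integral_inner_fderiv_testField hψ hψc v hθ, integral_mul_divergence hX hXc hθ]
  have e1 : ∫ z in Ω, fderiv ℝ ψ z v • f (T.inv z) =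
      ∫ y in Ω, divergence (T.testField ψ v) y • f y := by
    rw [T.setIntegral_comp hΩ T.image_eq]
    refine integral_congr_ae (ae_restrict_of_ae (hdiv.mono fun y hy => ?_))
    simp only [T.left_inv, smul_smul, hy]
  have e2 : ∫ z in Ω, ψ z • (g (T.inv z)).comp (fderiv ℝ T.inv z) v =
      ∫ y in Ω, g y (T.testField ψ v y) := by
    rw [T.setIntegral_comp hΩ T.image_eq]
    refine integral_congr_ae (Eventually.of_forall fun y => ?_)
    simp only [T.left_inv, smul_smul, SmoothTransform.testField, map_smul,
      ContinuousLinearMap.comp_apply]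
  rw [e1, e2]
  exact hfg.integral_divergence hf hg hX hXc hXΩ

/-! ### Domain variations -/

theorem exists_linear_bounds (m : ℕ) : ∃ δ : ℝ, 0 < δ ∧ ∀ A : E m →L[ℝ] E m, ‖A‖ < δ →
    0 < (1 + A).det ∧ (1 + A).det ≤ 2 ∧ ‖Ring.inverse (1 + A)‖ ≤ 2 := by
  have h1 : ContinuousAt (fun A : E m →L[ℝ] E m => (1 + A).det) 0 :=
    hasFDerivAt_det_one_add.continuousAt
  have h2 : ContinuousAt (fun A : E m →L[ℝ] E m => ‖Ring.inverse (1 + A)‖) 0 :=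
    (hasFDerivAt_inverse_one_add (V := E m)).continuousAt.norm
  have e1 : ((1 : E m →L[ℝ] E m) + 0).det = 1 := by simp [ContinuousLinearMap.det]
  have e2 : ‖Ring.inverse ((1 : E m →L[ℝ] E m) + 0)‖ < 2 := by
    rw [add_zero, Ring.inverse_one]
    exact lt_of_le_of_lt ContinuousLinearMap.norm_id_le one_lt_two
  have h3 : ∀ᶠ A in 𝓝 (0 : E m →L[ℝ] E m), (1 + A).det ∈ Set.Ioo (0 : ℝ) 2 :=
    h1.eventually_mem (Ioo_mem_nhds (by rw [e1]; norm_num) (by rw [e1]; norm_num))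
  have h4 : ∀ᶠ A in 𝓝 (0 : E m →L[ℝ] E m), ‖Ring.inverse (1 + A)‖ < 2 :=
    h2.eventually (gt_mem_nhds e2)
  obtain ⟨δ, hδ, h5⟩ := Metric.eventually_nhds_iff.1 (h3.and h4)
  refine ⟨δ, hδ, fun A hA => ?_⟩
  have h6 := h5 (by simpa using hA : dist A 0 < δ)
  exact ⟨h6.1.1, h6.1.2.le, h6.2.le⟩

/-- By the mean value inequality `t • X` is Lipschitz with constant `1 / 2`, and such a perturbation
of the identity is a global homeomorphism. -/
theorem exists_homeomorph_add_smul {V : Type*} [NormedAddCommGroup V] [NormedSpace ℝ V]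
    [CompleteSpace V] {X : V → V} (hX : Differentiable ℝ X) {t M : ℝ}
    (hM : ∀ y, ‖fderiv ℝ X y‖ ≤ M) (htM : |t| * M ≤ 1 / 2) :
    ∃ h : V ≃ₜ V, ∀ y, h y = y + t • X y := by
  have hlip : ∀ x y, ‖t • X x - t • X y‖ ≤ 1 / 2 * ‖x - y‖ := by
    intro x y
    have h1 := Convex.norm_image_sub_le_of_norm_fderiv_le (𝕜 := ℝ) (f := X) (C := M)
      (s := Set.univ) (fun z _ => hX z) (fun z _ => hM z) convex_univ (Set.mem_univ y)
      (Set.mem_univ x)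
    rw [← smul_sub, norm_smul, Real.norm_eq_abs]
    calc |t| * ‖X x - X y‖ ≤ |t| * (M * ‖x - y‖) := by gcongr
      _ = |t| * M * ‖x - y‖ := by ring
      _ ≤ 1 / 2 * ‖x - y‖ := by gcongr
  have happ : ApproximatesLinearOn (fun y => y + t • X y)
      ((ContinuousLinearEquiv.refl ℝ V : V ≃L[ℝ] V) : V →L[ℝ] V) Set.univ (1 / 2 : NNReal) := by
    intro x _ y _
    have e : x + t • X x - (y + t • X y)
        - ((ContinuousLinearEquiv.refl ℝ V : V ≃L[ℝ] V) : V →L[ℝ] V) (x - y)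
        = t • X x - t • X y := by
      simp only [ContinuousLinearEquiv.coe_refl, ContinuousLinearMap.coe_id', id_eq]
      abel
    rw [e]
    simpa using hlip x y
  refine ⟨happ.toHomeomorph _ ?_, fun y => rfl⟩
  rcases subsingleton_or_nontrivial V with h | h
  · exact Or.inl h
  · refine Or.inr ?_
    have : ‖(((ContinuousLinearEquiv.refl ℝ V).symm : V ≃L[ℝ] V) : V →L[ℝ] V)‖₊ = 1 := by
      simp
    rw [this]
    rw [← NNReal.coe_lt_coe]
    norm_num

/-- Small multiples of a compactly supported vector field generate changes of variables. -/
theorem exists_smoothTransform {m : ℕ} {Ω : Set (E m)} {X : E m → E m} (hX : ContDiff ℝ ∞ X)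
    (hXΩ : tsupport X ⊆ Ω) {M : ℝ} (hM0 : 0 < M) (hM : ∀ y, ‖fderiv ℝ X y‖ ≤ M) :
    ∃ t₀ : ℝ, 0 < t₀ ∧ ∀ t : ℝ, |t| < t₀ →
      ∃ T : SmoothTransform Ω, ∀ y, T.toFun y = y + t • X y := by
  obtain ⟨δ, hδ, hA⟩ := exists_linear_bounds m
  -- The first bound keeps `t • fderiv ℝ X y` where the determinant and the inverse are controlled;
  -- the second makes `t • X` a contraction.
  refine ⟨min (δ / M) (1 / (2 * M)), by positivity, fun t ht => ?_⟩
  have ht1 : |t| * M < δ := (lt_div_iff₀ hM0).1 (ht.trans_le (min_le_left _ _))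
  have ht2 : |t| * M ≤ 1 / 2 := by
    have := (lt_div_iff₀ (by positivity)).1 (ht.trans_le (min_le_right _ _))
    linarith
  have hXd : Differentiable ℝ X := hX.differentiable (by simp)
  obtain ⟨h, hh⟩ := exists_homeomorph_add_smul hXd hM ht2
  have hhe : (h : E m → E m) = fun y => y + t • X y := funext hh
  have hcd : ContDiff ℝ ∞ (h : E m → E m) := by
    rw [hhe]; exact contDiff_id.add (hX.const_smul t)
  have hfd : ∀ y, HasFDerivAt h (1 + t • fderiv ℝ X y) y := by
    intro y
    rw [hhe]
    exact (hasFDerivAt_id y).add ((hXd y).hasFDerivAt.const_smul t)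
  have hfd' : ∀ y, fderiv ℝ h y = 1 + t • fderiv ℝ X y := fun y => (hfd y).fderiv
  have hsm : ∀ y, ‖t • fderiv ℝ X y‖ < δ := by
    intro y
    rw [norm_smul, Real.norm_eq_abs]
    exact (mul_le_mul_of_nonneg_left (hM y) (abs_nonneg t)).trans_lt ht1
  have hdet : ∀ y, (1 + t • fderiv ℝ X y).det ≠ 0 := fun y => (hA _ (hsm y)).1.ne'
  have hcs : ContDiff ℝ ∞ (h.symm : E m → E m) :=
    Homeomorph.contDiff_symm h (f₀' := fun y =>
      (1 + t • fderiv ℝ X y).toContinuousLinearEquivOfDetNeZero (hdet y))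
      (fun y => by simpa using hfd y) hcd
  -- A bijection that fixes the complement of `Ω` pointwise also preserves `Ω`.
  have hout : ∀ y, y ∉ Ω → h y = y := by
    intro y hy
    rw [hh, image_eq_zero_of_notMem_tsupport fun hmem => hy (hXΩ hmem)]
    simp
  refine ⟨{
    toFun := h
    inv := h.symm
    contDiff_toFun := hcd
    contDiff_inv := hcs
    left_inv := h.symm_apply_apply
    right_inv := h.apply_symm_apply
    det_pos := fun y => by rw [hfd']; exact (hA _ (hsm y)).1
    bound := 2
    det_le := fun y => by rw [hfd']; exact (hA _ (hsm y)).2.1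
    norm_fderiv_inv_le := fun z => by
      have h1 := fderiv_inverse_eq (hcd.differentiable (by simp)) (hcs.differentiable (by simp))
        h.symm_apply_apply h.apply_symm_apply (h.symm z)
      rw [h.apply_symm_apply, hfd'] at h1
      rw [h1]
      exact (hA _ (hsm _)).2.2
    mem_iff := fun y => ⟨fun hy => by
        by_contra hn
        exact hn (hout y hn ▸ hy), fun hy => by
        by_contra hn
        have h1 := h.injective (hout _ hn)
        exact hn (h1.symm ▸ hy)⟩ }, hh⟩

/-! ### Energy densities of maps in the class `𝒴₂` -/

section Density

variable {m n Q K : ℕ} {b : Fin K → OrthonormalBasis (Fin n) ℝ (E n)} {Ω : Set (E m)}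
  {u : E m → QPoint Q n} {g : E m → (E m →L[ℝ] EuclideanSpace ℝ (Fin K × Fin n × Fin Q))}

/-- For `Q = 0` nothing forces `K ≠ 0`, so this degenerate case cannot go through `ξ`; here all
distances vanish. -/
theorem approxDifferentiableAt_of_isEmpty (u : E m → QPoint 0 n) (y : E m) :
    ApproxDifferentiableAt u y := by
  refine ⟨0, hasApproxDerivAt_iff.2 ⟨0, Subsingleton.elim _ _, fun i => i.elim0, ?_⟩⟩
  have : ∀ p q : QPoint 0 n, QPoint.gdist p q = 0 := by
    intro p q
    refine le_antisymm ?_ (QPoint.gdist_nonneg p q)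
    obtain ⟨a, rfl⟩ := p.exists_ofFn
    obtain ⟨a', rfl⟩ := q.exists_ofFn
    simpa using QPoint.gdist_le a a'
  simp only [this]
  exact Asymptotics.isLittleO_zero _ _

/-- The energy density of `u` is that of `ξ ∘ u`. -/
theorem ae_dirDerivSq_eq (hn : n ≠ 0) (hΩ : IsOpen Ω) (hb : IsBiLipschitz (xi (Q := Q) b))
    (hf : IntegrableOn (fun y => xi b (u y)) Ω) (hg : IntegrableOn g Ω)
    (hfg : IsWeakGrad Ω (fun y => xi b (u y)) g) :
    ∀ᵐ y ∂(volume.restrict Ω), ApproxDifferentiableAt u y ∧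
      ∀ v, dirDerivSq u y v = ‖g y v‖ ^ 2 := by
  by_cases hQ : Q = 0
  · subst hQ
    refine Eventually.of_forall fun y => ⟨approxDifferentiableAt_of_isEmpty u y, fun v => ?_⟩
    have : g y v = 0 := Subsingleton.elim _ _
    simp [dirDerivSq, this]
  · have hK := IsBiLipschitz.ne_zero_of_xi hQ hn hb
    filter_upwards [ae_isLittleO_of_isWeakGrad hΩ hf hg hfg] with y hy
    exact ⟨approxDifferentiableAt_of_xi hK hb hy, dirDerivSq_eq_of_xi hK hb hy⟩

theorem dirEnergy_eq (hder : ∀ᵐ y ∂(volume.restrict Ω), ApproxDifferentiableAt u y ∧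
      ∀ v, dirDerivSq u y v = ‖g y v‖ ^ 2) :
    dirEnergy u Ω = ∫⁻ y in Ω, ENNReal.ofReal (hsSq (g y)) := by
  refine lintegral_congr_ae (hder.mono fun y hy => ?_)
  simp only [derivSq, hsSq, hy.2]

end Density

/-! ### Continuity, bounds and integrability of the energy density and its first variation. -/

section Variation

variable {m : ℕ} {F : Type*} [NormedAddCommGroup F] [InnerProductSpace ℝ F]

theorem continuous_hsSq : Continuous (hsSq : (E m →L[ℝ] F) → ℝ) := by
  unfold hsSq
  fun_prop

theorem continuous_varDensity :
    Continuous fun p : (E m →L[ℝ] F) × (E m →L[ℝ] E m) => varDensity p.1 p.2 := by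
  have h1 : Continuous fun p : (E m →L[ℝ] F) × (E m →L[ℝ] E m) => tr p.2 := by
    simp only [← trCLM_apply]
    fun_prop
  have h2 : Continuous fun p : (E m →L[ℝ] F) × (E m →L[ℝ] E m) => hsSq p.1 :=
    continuous_hsSq.comp continuous_fst
  unfold varDensity
  fun_prop

theorem varDensity_smul (G : E m →L[ℝ] F) (t : ℝ) (A : E m →L[ℝ] E m) :
    varDensity G (t • A) = t * varDensity G A := by
  have h1 : tr (t • A) = t * tr A := by simp [← trCLM_apply]
  have h2 : ∀ j, (inner ℝ (G (stdVec j)) (G ((t • A) (stdVec j))) : ℝ)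
      = t * inner ℝ (G (stdVec j)) (G (A (stdVec j))) := by
    intro j
    rw [_root_.smul_apply, map_smul, real_inner_smul_right]
  simp only [varDensity, h1, h2, ← Finset.mul_sum]
  ring

theorem abs_varDensity_le (G : E m →L[ℝ] F) (A : E m →L[ℝ] E m) :
    |varDensity G A| ≤ (m * m + 2 * m) * ‖A‖ * ‖G‖ ^ 2 := by
  have hA : ∀ j, ‖A (stdVec j)‖ ≤ ‖A‖ := by
    intro j
    have := A.le_opNorm (stdVec j)
    rwa [norm_stdVec, mul_one] at this
  have hG : ∀ j, ‖G (stdVec j)‖ ≤ ‖G‖ := by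
    intro j
    have := G.le_opNorm (stdVec j)
    rwa [norm_stdVec, mul_one] at this
  have h1 : |tr A| ≤ m * ‖A‖ := by
    refine (Finset.abs_sum_le_sum_abs _ _).trans ?_
    have : ∀ i ∈ (Finset.univ : Finset (Fin m)), |A (stdVec i) i| ≤ ‖A‖ := fun i _ =>
      (PiLp.norm_apply_le (A (stdVec i)) i).trans (hA i)
    simpa using Finset.sum_le_card_nsmul _ _ _ this
  have h2 : |∑ j, (inner ℝ (G (stdVec j)) (G (A (stdVec j))) : ℝ)| ≤ m * (‖A‖ * ‖G‖ ^ 2) := by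
    refine (Finset.abs_sum_le_sum_abs _ _).trans ?_
    have : ∀ j ∈ (Finset.univ : Finset (Fin m)),
        |(inner ℝ (G (stdVec j)) (G (A (stdVec j))) : ℝ)| ≤ ‖A‖ * ‖G‖ ^ 2 := by
      intro j _
      refine (abs_real_inner_le_norm _ _).trans ?_
      calc ‖G (stdVec j)‖ * ‖G (A (stdVec j))‖ ≤ ‖G‖ * (‖G‖ * ‖A‖) := by
            gcongr
            · exact hG j
            · exact (G.le_opNorm _).trans (mul_le_mul_of_nonneg_left (hA j) (norm_nonneg _))
        _ = ‖A‖ * ‖G‖ ^ 2 := by ring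
    simpa using Finset.sum_le_card_nsmul _ _ _ this
  have h3 : |tr A * hsSq G| ≤ m * ‖A‖ * (m * ‖G‖ ^ 2) := by
    rw [abs_mul, abs_of_nonneg (hsSq_nonneg G)]
    exact mul_le_mul h1 (hsSq_le G) (hsSq_nonneg G) (by positivity)
  unfold varDensity
  refine (abs_sub _ _).trans ?_
  rw [abs_mul (2 : ℝ), abs_of_pos (two_pos : (0 : ℝ) < 2)]
  linarith

theorem integrable_hsSq {S : Set (E m)} {g : E m → (E m →L[ℝ] F)} (hg : MemLp g 2 (volume.restrict S)) :
    Integrable (fun y => hsSq (g y)) (volume.restrict S) := by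
  refine Integrable.mono' ((hg.integrable_norm_pow two_ne_zero).const_mul (m : ℝ))
    (continuous_hsSq.comp_aestronglyMeasurable hg.1) (Eventually.of_forall fun y => ?_)
  rw [Real.norm_of_nonneg (hsSq_nonneg _)]
  exact hsSq_le _

theorem aestronglyMeasurable_comp₂ {α G H : Type*} [MeasurableSpace α] [TopologicalSpace G]
    [TopologicalSpace H] {μ : Measure α} {g : α → G} {A : α → H} (hg : AEStronglyMeasurable g μ)
    (hA : AEStronglyMeasurable A μ) {k : G → H → ℝ} (hk : Continuous fun p : G × H => k p.1 p.2) :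
    AEStronglyMeasurable (fun y => k (g y) (A y)) μ :=
  hk.comp_aestronglyMeasurable (hg.prodMk hA)

theorem integrable_varDensity {S : Set (E m)} {g : E m → (E m →L[ℝ] F)} (hg : MemLp g 2 (volume.restrict S))
    {A : E m → (E m →L[ℝ] E m)} (hA : Continuous A) {M : ℝ} (hM : ∀ y, ‖A y‖ ≤ M) :
    Integrable (fun y => varDensity (g y) (A y)) (volume.restrict S) := by
  have hi : Integrable (fun y => ((m : ℝ) * m + 2 * m) * M * ‖g y‖ ^ 2) (volume.restrict S) :=
    (hg.integrable_norm_pow two_ne_zero).const_mul _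
  have hA' : AEStronglyMeasurable A (volume.restrict S) := hA.aestronglyMeasurable
  refine Integrable.mono' hi (aestronglyMeasurable_comp₂ hg.1 hA' continuous_varDensity)
    (Eventually.of_forall fun y => ?_)
  rw [Real.norm_eq_abs]
  refine (abs_varDensity_le _ _).trans ?_
  have h1 : ((m : ℝ) * m + 2 * m) * ‖A y‖ ≤ ((m : ℝ) * m + 2 * m) * M :=
    mul_le_mul_of_nonneg_left (hM y) (by positivity)
  exact mul_le_mul_of_nonneg_right h1 (by positivity)

end Variation

/-! ### The inner variation formula -/

section InnerVariation

variable {m n Q K : ℕ} {b : Fin K → OrthonormalBasis (Fin n) ℝ (E n)}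
  {u : E m → QPoint Q n} {g : E m → (E m →L[ℝ] EuclideanSpace ℝ (Fin K × Fin n × Fin Q))}

instance isFiniteMeasure_restrict_unitBall :
    IsFiniteMeasure ((volume : Measure (E m)).restrict (Metric.ball 0 1)) :=
  ⟨by simpa using measure_ball_lt_top⟩

/-- Competitors must agree with `u` outside a strictly smaller concentric ball; compactness of the
support of the variation provides it. -/
theorem exists_ball_superset_of_isCompact {S : Set (E m)} (hS : IsCompact S)
    (hS1 : S ⊆ Metric.ball 0 1) : ∃ r : ℝ, r < 1 ∧ S ⊆ Metric.closedBall 0 r := by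
  rcases S.eq_empty_or_nonempty with rfl | hne
  · exact ⟨0, zero_lt_one, Set.empty_subset _⟩
  · obtain ⟨x, hx, hmax⟩ := hS.exists_isMaxOn hne continuous_norm.continuousOn
    exact ⟨‖x‖, by simpa using hS1 hx, fun y hy => by simpa using hmax hy⟩

/-- Comparison of the energy of a minimizer with that of its composition with a change of
variables. -/
theorem IsDirMinimizing.lintegral_le_comp (hn : n ≠ 0) (hu : IsDirMinimizing u)
    (hb : IsBiLipschitz (xi (Q := Q) b))
    (hf : MemLp (fun y => xi b (u y)) 2 (volume.restrict (Metric.ball 0 1)))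
    (hg : MemLp g 2 (volume.restrict (Metric.ball 0 1)))
    (hfg : IsWeakGrad (Metric.ball 0 1) (fun y => xi b (u y)) g)
    (T : SmoothTransform (Metric.ball (0 : E m) 1)) {S : Set (E m)} (hS : IsCompact S)
    (hS1 : S ⊆ Metric.ball 0 1) (hTS : ∀ y, y ∉ S → T.toFun y = y) :
    ∫⁻ y in Metric.ball 0 1, ENNReal.ofReal (hsSq (g y)) ≤
      ∫⁻ y in Metric.ball 0 1, ENNReal.ofReal
        (T.jac y * hsSq ((g y).comp (Ring.inverse (fderiv ℝ T.toFun y)))) := by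
  have hB : MeasurableSet (Metric.ball (0 : E m) 1) := measurableSet_ball
  set v : E m → QPoint Q n := fun z => u (T.inv z) with hv
  set gv : E m → (E m →L[ℝ] EuclideanSpace ℝ (Fin K × Fin n × Fin Q)) :=
    fun z => (g (T.inv z)).comp (fderiv ℝ T.inv z) with hgv
  have hfv : MemLp (fun z => xi b (v z)) 2 (volume.restrict (Metric.ball 0 1)) :=
    T.memLp_comp_inv hB hf
  have hgvm : MemLp gv 2 (volume.restrict (Metric.ball 0 1)) := T.memLp_grad_comp_inv hB hg
  have hweak : IsWeakGrad (Metric.ball 0 1) (fun z => xi b (v z)) gv :=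
    hfg.comp_inv hB T (hf.integrable one_le_two) (hg.integrable one_le_two)
  -- Only the domain is changed, so the constraint on the values is inherited up to null sets.
  have hvY : MemY2Sphere (Metric.ball 0 1) v :=
    ⟨T.ae_comp_inv hB hu.1.1, K, b, hb, hfv, gv, hgvm, hweak⟩
  obtain ⟨r, hr, hSr⟩ := exists_ball_superset_of_isCompact hS hS1
  have hagree : ∃ r : ℝ, r < 1 ∧
      ∀ᵐ y ∂(volume.restrict (Metric.ball (0 : E m) 1 \ Metric.ball 0 r)), v y = u y := by
    refine ⟨(r + 1) / 2, by linarith, ?_⟩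
    rw [ae_restrict_iff' (measurableSet_ball.diff measurableSet_ball)]
    refine Eventually.of_forall fun y hy => ?_
    have hyS : y ∉ S := fun h => by
      have h1 := hSr h
      have h2 := hy.2
      rw [mem_closedBall_zero_iff] at h1
      rw [mem_ball_zero_iff] at h2
      exact h2 (by linarith)
    have : T.inv y = y := by
      conv_lhs => rw [← hTS y hyS]
      exact T.left_inv y
    simp only [hv, this]
  have hle := hu.2 v hvY hagree
  rw [dirEnergy_eq (ae_dirDerivSq_eq hn Metric.isOpen_ball hb (hf.integrable one_le_two)
      (hg.integrable one_le_two) hfg),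
    dirEnergy_eq (ae_dirDerivSq_eq hn Metric.isOpen_ball hb (hfv.integrable one_le_two)
      (hgvm.integrable one_le_two) hweak),
    T.setLIntegral_comp hB fun z => ENNReal.ofReal (hsSq (gv z))] at hle
  refine hle.trans (le_of_eq (lintegral_congr fun y => ?_))
  rw [hgv, ENNReal.ofReal_mul (show 0 ≤ T.jac y from (T.det_pos y).le)]
  simp only [T.left_inv, T.fderiv_inv_eq]

/-- The first variation of the energy of a minimizer under domain variations vanishes. -/
theorem IsDirMinimizing.integral_varDensity_eq_zero (hn : n ≠ 0) (hu : IsDirMinimizing u)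
    (hb : IsBiLipschitz (xi (Q := Q) b))
    (hf : MemLp (fun y => xi b (u y)) 2 (volume.restrict (Metric.ball 0 1)))
    (hg : MemLp g 2 (volume.restrict (Metric.ball 0 1)))
    (hfg : IsWeakGrad (Metric.ball 0 1) (fun y => xi b (u y)) g)
    {X : E m → E m} (hX : ContDiff ℝ ∞ X) (hXc : HasCompactSupport X)
    (hX1 : tsupport X ⊆ Metric.ball 0 1) :
    ∫ y in Metric.ball 0 1, varDensity (g y) (fderiv ℝ X y) = 0 := by
  have hX' : Continuous (fderiv ℝ X) := hX.continuous_fderiv (by simp)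
  obtain ⟨M, hM0, hM⟩ : ∃ M : ℝ, 0 < M ∧ ∀ y, ‖fderiv ℝ X y‖ ≤ M := by
    obtain ⟨C, hC⟩ := (hXc.fderiv ℝ).exists_bound_of_continuous hX'
    exact ⟨max C 1, by positivity, fun y => (hC y).trans (le_max_left _ _)⟩
  set I := ∫ y in Metric.ball 0 1, varDensity (g y) (fderiv ℝ X y) with hI
  set N := ∫ y in Metric.ball (0 : E m) 1, ‖g y‖ ^ 2 with hN
  have hN0 : 0 ≤ N := integral_nonneg fun y => by positivity
  have hgN : Integrable (fun y => ‖g y‖ ^ 2) (volume.restrict (Metric.ball 0 1)) :=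
    hg.integrable_norm_pow two_ne_zero
  have hgh := integrable_hsSq hg
  have hgv := integrable_varDensity hg hX' hM
  obtain ⟨t₀, ht₀, hT⟩ := exists_smoothTransform hX hX1 hM0 hM
  -- Minimality combined with the integrated expansion: the energy increment is at most `t * I` plus
  -- an error of arbitrarily small slope, for `t` of either sign.
  have key : ∀ ε : ℝ, 0 < ε → ∃ t₁ : ℝ, 0 < t₁ ∧ ∀ t : ℝ, |t| < t₁ →
      0 ≤ t * I + ε * |t| * (M * N) := by
    intro ε hε
    obtain ⟨δ, hδ, hexp⟩ := exists_energy_expansion m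
      (EuclideanSpace ℝ (Fin K × Fin n × Fin Q)) hε
    refine ⟨min t₀ (δ / M), by positivity, fun t ht => ?_⟩
    obtain ⟨T, hTX⟩ := hT t (ht.trans_le (min_le_left _ _))
    have htM : |t| * M < δ := (lt_div_iff₀ hM0).1 (ht.trans_le (min_le_right _ _))
    have hTfd : ∀ y, fderiv ℝ T.toFun y = 1 + t • fderiv ℝ X y := by
      intro y
      have h1 : HasFDerivAt (fun y => y + t • X y) (1 + t • fderiv ℝ X y) y :=
        (hasFDerivAt_id y).add (((hX.differentiable (by simp)) y).hasFDerivAt.const_smul t)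
      rw [funext hTX]
      exact h1.fderiv
    have hle := hu.lintegral_le_comp hn hb hf hg hfg T hXc.isCompact hX1 fun y hy => by
      rw [hTX, image_eq_zero_of_notMem_tsupport hy, smul_zero, add_zero]
    -- An explicit integrable majorant of the pulled back density, which spares a separate
    -- integrability proof for the latter.
    set up : E m → ℝ := fun y =>
      hsSq (g y) + t * varDensity (g y) (fderiv ℝ X y) + ε * |t| * M * ‖g y‖ ^ 2 with hup
    have hq : ∀ y, T.jac y * hsSq ((g y).comp (Ring.inverse (fderiv ℝ T.toFun y))) ≤ up y := by
      intro y
      have hn : ‖t • fderiv ℝ X y‖ ≤ |t| * M := by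
        rw [norm_smul, Real.norm_eq_abs]
        exact mul_le_mul_of_nonneg_left (hM y) (abs_nonneg t)
      have h1 := (abs_le.1 (hexp (t • fderiv ℝ X y) (hn.trans_lt htM) (g y))).2
      rw [varDensity_smul, ← hTfd y] at h1
      have h2 : ε * ‖t • fderiv ℝ X y‖ * ‖g y‖ ^ 2 ≤ ε * (|t| * M) * ‖g y‖ ^ 2 := by gcongr
      simp only [hup, SmoothTransform.jac]
      linarith
    have hupi : Integrable up (volume.restrict (Metric.ball 0 1)) :=
      (hgh.add (hgv.const_mul t)).add (hgN.const_mul _)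
    have hup0 : ∀ y, 0 ≤ up y := fun y =>
      (mul_nonneg (T.det_pos y).le (hsSq_nonneg _)).trans (hq y)
    have hle2 : ∫⁻ y in Metric.ball 0 1, ENNReal.ofReal (hsSq (g y)) ≤
        ∫⁻ y in Metric.ball 0 1, ENNReal.ofReal (up y) :=
      hle.trans (lintegral_mono fun y => ENNReal.ofReal_le_ofReal (hq y))
    rw [← ofReal_integral_eq_lintegral_ofReal hgh (Eventually.of_forall fun y => hsSq_nonneg _),
      ← ofReal_integral_eq_lintegral_ofReal hupi (Eventually.of_forall hup0),
      ENNReal.ofReal_le_ofReal_iff (integral_nonneg hup0)] at hle2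
    have hsum : ∫ y in Metric.ball 0 1, up y =
        (∫ y in Metric.ball 0 1, hsSq (g y)) + t * I + ε * |t| * M * N := by
      simp only [hup]
      have hs : Integrable (fun y => hsSq (g y) + t * varDensity (g y) (fderiv ℝ X y))
          (volume.restrict (Metric.ball 0 1)) := hgh.add (hgv.const_mul t)
      rw [integral_add hs (hgN.const_mul _),
        integral_add hgh (hgv.const_mul t), integral_const_mul, integral_const_mul]
    rw [hsum] at hle2
    linarith
  -- Opposite values of `t` bound `I` from both sides.
  have hzero : ∀ ε : ℝ, 0 < ε → |I| ≤ ε * (M * N) := by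
    intro ε hε
    obtain ⟨t₁, ht₁, h⟩ := key ε hε
    have hp := h (t₁ / 2) (by rw [abs_of_pos (by positivity)]; linarith)
    have hm := h (-(t₁ / 2)) (by rw [abs_neg, abs_of_pos (by positivity)]; linarith)
    rw [abs_neg] at hm
    rw [abs_of_pos (by positivity : 0 < t₁ / 2)] at hp hm
    have hp' : 0 ≤ (t₁ / 2) * (I + ε * (M * N)) := by linarith
    have hm' : 0 ≤ (t₁ / 2) * (-I + ε * (M * N)) := by linarith
    have h1 := nonneg_of_mul_nonneg_right hp' (by positivity)
    have h2 := nonneg_of_mul_nonneg_right hm' (by positivity)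
    exact abs_le.2 ⟨by linarith, by linarith⟩
  have hMN : 0 ≤ M * N := by positivity
  have habs : |I| ≤ 0 := by
    refine le_of_forall_pos_le_add fun η hη => ?_
    refine (hzero (η / (M * N + 1)) (by positivity)).trans ?_
    rw [zero_add, div_mul_eq_mul_div, div_le_iff₀ (by positivity)]
    nlinarith
  exact abs_nonpos_iff.1 habs

end InnerVariation

/-! ### Radial vector fields -/

/-- Here `A` is `a` times the identity plus the rank one map `c d ⊗ d`. The coefficient `m - 2`,
source of the exponent `2 - m`, is `m` from the trace less `2` from the quadratic term. -/
theorem varDensity_radial {m : ℕ} {F : Type*} [NormedAddCommGroup F] [InnerProductSpace ℝ F]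
    (G : E m →L[ℝ] F) (a c : ℝ) (d : E m) {A : E m →L[ℝ] E m}
    (hA : ∀ v, A v = a • v + (c * inner ℝ d v) • d) :
    varDensity G A = ((m - 2) * a + c * ‖d‖ ^ 2) * hsSq G - 2 * c * ‖G d‖ ^ 2 := by
  have hd : ∀ j, (inner ℝ d (stdVec j) : ℝ) = d j := fun j => by
    simp [EuclideanSpace.inner_single_right]
  have htr : tr A = m * a + c * ‖d‖ ^ 2 := by
    have h1 : ∀ i, A (stdVec i) i = a + c * (d i) ^ 2 := by
      intro i
      rw [hA, hd]
      simp
      ring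
    simp only [tr, h1, Finset.sum_add_distrib, ← Finset.mul_sum, EuclideanSpace.real_norm_sq_eq]
    simp
  have hsum : ∑ j, (inner ℝ (G (stdVec j)) (G (A (stdVec j))) : ℝ) =
      a * hsSq G + c * ‖G d‖ ^ 2 := by
    have h1 : ∀ j, (inner ℝ (G (stdVec j)) (G (A (stdVec j))) : ℝ) =
        a * ‖G (stdVec j)‖ ^ 2 + c * inner ℝ (d j • G (stdVec j)) (G d) := by
      intro j
      rw [hA, hd, map_add, map_smul, map_smul, inner_add_right, real_inner_smul_right,
        real_inner_smul_right, real_inner_smul_left, real_inner_self_eq_norm_sq]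
      ring
    have h2 : ∑ j, d j • G (stdVec j) = G d := by
      conv_rhs => rw [← sum_smul_stdVec d]
      simp
    simp only [h1, Finset.sum_add_distrib, ← Finset.mul_sum, ← sum_inner, h2, hsSq,
      real_inner_self_eq_norm_sq]
  rw [varDensity, htr, hsum]
  ring

theorem hasFDerivAt_radial {m : ℕ} {η : ℝ → ℝ} {η' : ℝ} (x y : E m)
    (hη : HasDerivAt η η' (‖y - x‖ ^ 2)) :
    ∃ A : E m →L[ℝ] E m, HasFDerivAt (fun y => η (‖y - x‖ ^ 2) • (y - x)) A y ∧
      ∀ v, A v = η (‖y - x‖ ^ 2) • v + (2 * η' * inner ℝ (y - x) v) • (y - x) := by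
  have h1 : HasFDerivAt (fun y => y - x) (ContinuousLinearMap.id ℝ (E m)) y :=
    (hasFDerivAt_id y).sub_const x
  have h2 := hη.comp_hasFDerivAt y h1.norm_sq
  have h3 := h2.smul h1
  refine ⟨_, h3, fun v => ?_⟩
  simp only [_root_.add_apply, _root_.smul_apply, ContinuousLinearMap.smulRight_apply,
    ContinuousLinearMap.comp_apply, ContinuousLinearMap.id_apply, Function.comp_apply,
    innerSL_apply_apply, smul_eq_mul, nsmul_eq_mul]
  congr 2
  push_cast
  ring

/-! ### Cut-off weights and radial profiles. -/

section Weight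

variable {σ ρ : ℝ} {m : ℕ}

/-- The weight `τ^{-m/2}` cut off by `χ`. -/
def weight (m : ℕ) (χ : ℝ → ℝ) (τ : ℝ) : ℝ := χ τ * (Real.sqrt τ ^ m)⁻¹

/-- The radial profile with derivative `-weight / 2` vanishing beyond `ρ²`. -/
def profile (m : ℕ) (χ : ℝ → ℝ) (ρ s : ℝ) : ℝ := 1 / 2 * ∫ τ in s..ρ ^ 2, weight m χ τ

/-- The cut-off vanishes up to `σ ^ 2` and so hides the singularity of `τ^{-m/2}` at the origin. -/
theorem contDiff_weight (hσ : 0 < σ) {χ : ℝ → ℝ} (hχ : ContDiff ℝ ∞ χ)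
    (hχ0 : ∀ τ, τ ≤ σ ^ 2 → χ τ = 0) : ContDiff ℝ ∞ (weight m χ) := by
  rw [contDiff_iff_contDiffAt]
  intro τ
  rcases lt_or_ge 0 τ with hτ | hτ
  · have h1 : ContDiffAt ℝ ∞ Real.sqrt τ := Real.contDiffAt_sqrt hτ.ne'
    exact hχ.contDiffAt.mul ((h1.pow m).inv (pow_pos (Real.sqrt_pos.2 hτ) m).ne')
  · have h1 : (weight m χ) =ᶠ[𝓝 τ] fun _ => 0 := by
      filter_upwards [gt_mem_nhds (hτ.trans_lt (by positivity : 0 < σ ^ 2))] with s hs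
      simp [weight, hχ0 s hs.le]
    exact contDiffAt_const.congr_of_eventuallyEq h1

theorem weight_nonneg {χ : ℝ → ℝ} (hχ : ∀ τ, 0 ≤ χ τ) (τ : ℝ) : 0 ≤ weight m χ τ :=
  mul_nonneg (hχ τ) (by positivity)

theorem weight_le (hσ : 0 < σ) {χ : ℝ → ℝ} (hχ1 : ∀ τ, χ τ ≤ 1)
    (hχ0 : ∀ τ, τ ≤ σ ^ 2 → χ τ = 0) (τ : ℝ) : weight m χ τ ≤ (σ ^ m)⁻¹ := by
  rcases le_or_gt τ (σ ^ 2) with h | h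
  · simp only [weight, hχ0 τ h, zero_mul]
    positivity
  · have h1 : σ ≤ Real.sqrt τ := Real.le_sqrt_of_sq_le h.le
    calc weight m χ τ ≤ 1 * (Real.sqrt τ ^ m)⁻¹ :=
          mul_le_mul_of_nonneg_right (hχ1 τ) (by positivity)
      _ ≤ (σ ^ m)⁻¹ := by rw [one_mul]; gcongr

theorem hasDerivAt_profile {χ : ℝ → ℝ} (hw : Continuous (weight m χ)) (s : ℝ) :
    HasDerivAt (profile m χ ρ) (-(1 / 2) * weight m χ s) s := by
  have h1 := intervalIntegral.integral_hasDerivAt_left (hw.intervalIntegrable s (ρ ^ 2))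
    (hw.stronglyMeasurableAtFilter _ _) hw.continuousAt
  exact (h1.const_mul (1 / 2 : ℝ)).congr_deriv (by ring)

theorem contDiff_profile {χ : ℝ → ℝ} (hw : ContDiff ℝ ∞ (weight m χ)) :
    ContDiff ℝ ∞ (profile m χ ρ) := by
  rw [contDiff_infty_iff_deriv]
  refine ⟨fun s => (hasDerivAt_profile hw.continuous s).differentiableAt, ?_⟩
  have : deriv (profile m χ ρ) = fun s => -(1 / 2) * weight m χ s :=
    funext fun s => (hasDerivAt_profile hw.continuous s).deriv
  rw [this]
  exact contDiff_const.mul hw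

theorem profile_eq_zero {χ : ℝ → ℝ} (hχ : ∀ τ, ρ ^ 2 ≤ τ → χ τ = 0) {s : ℝ} (hs : ρ ^ 2 ≤ s) :
    profile m χ ρ s = 0 := by
  rw [profile, intervalIntegral.integral_congr (g := fun _ => (0 : ℝ))]
  · simp
  · intro τ hτ
    rw [Set.uIcc_of_ge hs] at hτ
    simp [weight, hχ τ hτ.1]

theorem abs_profile_le {χ : ℝ → ℝ} {C : ℝ} (hχ : ∀ τ, ρ ^ 2 ≤ τ → χ τ = 0)
    (hw : ∀ τ, |weight m χ τ| ≤ C) (hC : 0 ≤ C) {s : ℝ} (hs : 0 ≤ s) :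
    |profile m χ ρ s| ≤ C * ρ ^ 2 := by
  rcases le_or_gt (ρ ^ 2) s with h | h
  · rw [profile_eq_zero hχ h, abs_zero]
    positivity
  · have h1 := intervalIntegral.norm_integral_le_of_norm_le_const (a := s) (b := ρ ^ 2)
      (f := weight m χ) (C := C) fun τ _ => hw τ
    rw [Real.norm_eq_abs, abs_of_nonneg (by linarith : 0 ≤ ρ ^ 2 - s)] at h1
    rw [profile, abs_mul, abs_of_pos (by norm_num : (0 : ℝ) < 1 / 2)]
    nlinarith [mul_nonneg hC hs, mul_nonneg hC (sq_nonneg ρ)]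

/-- The profile of the sharp cut-off. -/
theorem integral_sharp_weight (hσ : 0 < σ) (hσρ : σ < ρ) {R : ℝ} (hR : 0 ≤ R) (hRρ : R < ρ) :
    ((m : ℝ) - 2) * (1 / 2 * ∫ τ in R ^ 2..ρ ^ 2,
      weight m ((Set.Ioo (σ ^ 2) (ρ ^ 2)).indicator 1) τ) =
      max R σ ^ (2 - (m : ℤ)) - ρ ^ (2 - (m : ℤ)) := by
  set M := max R σ with hM
  have hM0 : 0 < M := hσ.trans_le (le_max_right _ _)
  have hMρ : M < ρ := max_lt hRρ hσρ
  have hMsq : M ^ 2 ≤ ρ ^ 2 := by gcongr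
  have hRsq : R ^ 2 ≤ M ^ 2 := by gcongr; exact le_max_left _ _
  have hσsq : σ ^ 2 ≤ M ^ 2 := by gcongr; exact le_max_right _ _
  -- The weight vanishes up to `σ ^ 2`, so the lower limit may be raised to `max R σ ^ 2`.
  have hcut : ∫ τ in R ^ 2..ρ ^ 2, weight m ((Set.Ioo (σ ^ 2) (ρ ^ 2)).indicator 1) τ =
      ∫ τ in M ^ 2..ρ ^ 2, (Real.sqrt τ ^ m)⁻¹ := by
    rw [intervalIntegral.integral_of_le (hRsq.trans hMsq), intervalIntegral.integral_of_le hMsq,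
      integral_Ioc_eq_integral_Ioo, integral_Ioc_eq_integral_Ioo,
      ← integral_indicator measurableSet_Ioo, ← integral_indicator measurableSet_Ioo]
    congr 1
    funext τ
    simp only [Set.indicator_apply, weight, Set.mem_Ioo, Pi.one_apply]
    by_cases h1 : τ < ρ ^ 2
    · by_cases h2 : M ^ 2 < τ
      · simp [h1, h2, hRsq.trans_lt h2, hσsq.trans_lt h2]
      · have h3 : ¬ (R ^ 2 < τ ∧ σ ^ 2 < τ) := by
          rintro ⟨h4, h5⟩
          refine h2 ?_
          rcases max_choice R σ with h | h
          · rw [hM, h]; exact h4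
          · rw [hM, h]; exact h5
        by_cases h4 : R ^ 2 < τ
        · have h5 : ¬ σ ^ 2 < τ := fun h => h3 ⟨h4, h⟩
          simp [h1, h2, h4, h5]
        · simp [h2, h4]
    · simp [h1]
  -- Keeping the factor `m - 2` lets one antiderivative serve every `m`: for `m = 2` it is constant
  -- and no logarithm appears.
  have hder : ∀ τ ∈ Set.uIcc (M ^ 2) (ρ ^ 2), HasDerivAt
      (fun τ => -(Real.sqrt τ ^ (2 - (m : ℤ)))) (((m : ℝ) - 2) * (1 / 2 * (Real.sqrt τ ^ m)⁻¹))
      τ := by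
    intro τ hτ
    rw [Set.uIcc_of_le hMsq] at hτ
    have hτ0 : 0 < τ := (pow_pos hM0 2).trans_le hτ.1
    have hs : 0 < Real.sqrt τ := Real.sqrt_pos.2 hτ0
    have h1 := ((hasDerivAt_zpow (2 - (m : ℤ)) (Real.sqrt τ) (Or.inl hs.ne')).comp τ
      (Real.hasDerivAt_sqrt hτ0.ne')).neg
    refine HasDerivAt.congr_deriv h1 ?_
    have h2 : Real.sqrt τ ^ (2 - (m : ℤ) - 1) = Real.sqrt τ * (Real.sqrt τ ^ m)⁻¹ := by
      have : (2 - (m : ℤ) - 1) = 1 - (m : ℤ) := by ring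
      rw [this, zpow_sub₀ hs.ne', zpow_one, zpow_natCast, div_eq_mul_inv]
    rw [h2]
    push_cast
    field_simp
    ring
  have hcont : ContinuousOn (fun τ => ((m : ℝ) - 2) * (1 / 2 * (Real.sqrt τ ^ m)⁻¹))
      (Set.uIcc (M ^ 2) (ρ ^ 2)) := by
    intro τ hτ
    rw [Set.uIcc_of_le hMsq] at hτ
    have hτ0 : 0 < τ := (pow_pos hM0 2).trans_le hτ.1
    have hs : Real.sqrt τ ^ m ≠ 0 := (pow_pos (Real.sqrt_pos.2 hτ0) m).ne'
    refine ContinuousAt.continuousWithinAt ?_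
    exact continuousAt_const.mul (continuousAt_const.mul
      ((Real.continuous_sqrt.continuousAt.pow m).inv₀ hs))
  have hFTC := intervalIntegral.integral_eq_sub_of_hasDerivAt hder hcont.intervalIntegrable
  rw [intervalIntegral.integral_const_mul, intervalIntegral.integral_const_mul] at hFTC
  rw [hcut, hFTC, Real.sqrt_sq (hM0.le.trans hMρ.le), Real.sqrt_sq hM0.le]
  ring

/-- Smooth cut-offs increasing to the indicator of the annulus. -/
theorem exists_cutoff {a c : ℝ} (hac : a < c) : ∃ χ : ℕ → ℝ → ℝ, (∀ k, ContDiff ℝ ∞ (χ k)) ∧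
    (∀ k τ, 0 ≤ χ k τ) ∧ (∀ k τ, χ k τ ≤ 1) ∧ (∀ k τ, τ ∉ Set.Ioo a c → χ k τ = 0) ∧
    ∀ τ, Tendsto (fun k => χ k τ) atTop (𝓝 ((Set.Ioo a c).indicator 1 τ)) := by
  set d := (c - a) / 2 with hd
  have hd0 : 0 < d := by rw [hd]; linarith
  -- Inner radii increasing to the outer radius `d`; the shift by `2` makes the one for `k = 0`
  -- positive.
  have hk : ∀ k : ℕ, 0 < d * (1 - 1 / ((k : ℝ) + 2)) ∧ d * (1 - 1 / ((k : ℝ) + 2)) < d := by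
    intro k
    have h1 : 0 < 1 / ((k : ℝ) + 2) := by positivity
    have h2 : 1 / ((k : ℝ) + 2) < 1 := by
      rw [div_lt_one (by positivity)]
      have : (0 : ℝ) ≤ k := Nat.cast_nonneg k
      linarith
    exact ⟨mul_pos hd0 (by linarith), by nlinarith⟩
  set χ : ℕ → ContDiffBump ((a + c) / 2) := fun k =>
    ⟨d * (1 - 1 / ((k : ℝ) + 2)), d, (hk k).1, (hk k).2⟩ with hχ
  have hball : ∀ τ, τ ∈ Set.Ioo a c ↔ τ ∈ Metric.ball ((a + c) / 2) d := by
    intro τ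
    rw [Real.ball_eq_Ioo]
    have h1 : (a + c) / 2 - d = a := by rw [hd]; ring
    have h2 : (a + c) / 2 + d = c := by rw [hd]; ring
    rw [h1, h2]
  have hzero : ∀ k τ, τ ∉ Set.Ioo a c → χ k τ = 0 := by
    intro k τ hτ
    refine (χ k).zero_of_le_dist ?_
    have := mt (hball τ).2 hτ
    rw [Metric.mem_ball, not_lt] at this
    exact this
  refine ⟨fun k => χ k, fun k => (χ k).contDiff, fun k τ => (χ k).nonneg, fun k τ => (χ k).le_one,
    hzero, fun τ => ?_⟩
  by_cases hτ : τ ∈ Set.Ioo a c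
  · rw [Set.indicator_of_mem hτ]
    have hlim : Tendsto (fun k : ℕ => d * (1 - 1 / ((k : ℝ) + 2))) atTop (𝓝 (d * (1 - 0))) := by
      have h0 : Tendsto (fun k : ℕ => 1 / ((k : ℝ) + 2)) atTop (𝓝 0) :=
        tendsto_const_nhds.div_atTop
          (tendsto_atTop_add_const_right _ _ tendsto_natCast_atTop_atTop)
      exact (h0.const_sub 1).const_mul d
    rw [sub_zero, mul_one] at hlim
    have hτ' := (hball τ).1 hτ
    rw [Metric.mem_ball] at hτ'
    refine tendsto_const_nhds.congr' ?_
    filter_upwards [hlim.eventually (lt_mem_nhds hτ')] with k hkd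
    exact ((χ k).one_of_mem_closedBall (Metric.mem_closedBall.2 hkd.le)).symm
  · rw [Set.indicator_of_notMem hτ]
    simp only [hzero _ τ hτ]
    exact tendsto_const_nhds

theorem tendsto_weight {χ : ℕ → ℝ → ℝ} {χ₀ : ℝ → ℝ} {τ : ℝ}
    (h : Tendsto (fun k => χ k τ) atTop (𝓝 (χ₀ τ))) :
    Tendsto (fun k => weight m (χ k) τ) atTop (𝓝 (weight m χ₀ τ)) :=
  h.mul_const _

theorem tendsto_profile {χ : ℕ → ℝ → ℝ} {χ₀ : ℝ → ℝ} {C : ℝ}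
    (hwc : ∀ k, Continuous (weight m (χ k))) (hw : ∀ k τ, |weight m (χ k) τ| ≤ C)
    (h : ∀ τ, Tendsto (fun k => χ k τ) atTop (𝓝 (χ₀ τ))) (s : ℝ) :
    Tendsto (fun k => profile m (χ k) ρ s) atTop (𝓝 (profile m χ₀ ρ s)) := by
  refine Tendsto.const_mul _ ?_
  refine intervalIntegral.tendsto_integral_filter_of_dominated_convergence (fun _ => C)
    (Eventually.of_forall fun k => (hwc k).aestronglyMeasurable)
    (Eventually.of_forall fun k => Eventually.of_forall fun τ _ => hw k τ)
    intervalIntegrable_const (Eventually.of_forall fun τ _ => tendsto_weight (h τ))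

end Weight

/-! ### The monotonicity formula -/

section Monotonicity

variable {m n Q K : ℕ} {b : Fin K → OrthonormalBasis (Fin n) ℝ (E n)}
  {u : E m → QPoint Q n} {g : E m → (E m →L[ℝ] EuclideanSpace ℝ (Fin K × Fin n × Fin Q))}

/-- The inner variation formula for radial vector fields. -/
theorem IsDirMinimizing.integral_radial_eq_zero (hn : n ≠ 0) (hu : IsDirMinimizing u)
    (hb : IsBiLipschitz (xi (Q := Q) b))
    (hf : MemLp (fun y => xi b (u y)) 2 (volume.restrict (Metric.ball 0 1)))
    (hg : MemLp g 2 (volume.restrict (Metric.ball 0 1)))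
    (hfg : IsWeakGrad (Metric.ball 0 1) (fun y => xi b (u y)) g)
    {x : E m} {ρ : ℝ} (hρ : 0 < ρ) (hxρ : Metric.closedBall x ρ ⊆ Metric.ball 0 1)
    {η η' : ℝ → ℝ} (hη : ContDiff ℝ ∞ η) (hη' : ∀ s, HasDerivAt η (η' s) s)
    (hη0 : ∀ s, ρ ^ 2 ≤ s → η s = 0) :
    ∫ y in Metric.ball 0 1, (((m - 2) * η (‖y - x‖ ^ 2) + 2 * η' (‖y - x‖ ^ 2) * ‖y - x‖ ^ 2) *
      hsSq (g y) - 2 * (2 * η' (‖y - x‖ ^ 2)) * ‖g y (y - x)‖ ^ 2) = 0 := by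
  set X : E m → E m := fun y => η (‖y - x‖ ^ 2) • (y - x) with hX
  have hsub : ContDiff ℝ ∞ fun y : E m => y - x := contDiff_id.sub contDiff_const
  have hXs : ContDiff ℝ ∞ X := (hη.comp (hsub.norm_sq ℝ)).smul hsub
  have hXt : tsupport X ⊆ Metric.closedBall x ρ := by
    refine closure_minimal (fun y hy => ?_) Metric.isClosed_closedBall
    by_contra h
    rw [mem_closedBall_iff_norm, not_le] at h
    refine hy ?_
    simp only [hX]
    rw [hη0 _ (by gcongr), zero_smul]
  have hXc : HasCompactSupport X :=
    (isCompact_closedBall x ρ).of_isClosed_subset (isClosed_tsupport _) hXt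
  rw [← hu.integral_varDensity_eq_zero hn hb hf hg hfg hXs hXc (hXt.trans hxρ)]
  refine integral_congr_ae (Eventually.of_forall fun y => ?_)
  obtain ⟨A, hA, hAv⟩ := hasFDerivAt_radial x y (hη' (‖y - x‖ ^ 2))
  simp only [hX]
  rw [hA.fderiv, varDensity_radial (g y) _ _ _ hAv]

/-- The integrated identity with a sharp cut-off. -/
theorem IsDirMinimizing.integral_sharp_eq_zero (hn : n ≠ 0) (hu : IsDirMinimizing u)
    (hb : IsBiLipschitz (xi (Q := Q) b))
    (hf : MemLp (fun y => xi b (u y)) 2 (volume.restrict (Metric.ball 0 1)))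
    (hg : MemLp g 2 (volume.restrict (Metric.ball 0 1)))
    (hfg : IsWeakGrad (Metric.ball 0 1) (fun y => xi b (u y)) g)
    {x : E m} {σ ρ : ℝ} (hσ : 0 < σ) (hσρ : σ < ρ)
    (hxρ : Metric.closedBall x ρ ⊆ Metric.ball 0 1) {χ₀ : ℝ → ℝ}
    (hχ₀ : χ₀ = (Set.Ioo (σ ^ 2) (ρ ^ 2)).indicator 1) :
    ∫ y in Metric.ball 0 1, (((m - 2) * profile m χ₀ ρ (‖y - x‖ ^ 2)
      - weight m χ₀ (‖y - x‖ ^ 2) * ‖y - x‖ ^ 2) * hsSq (g y)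
        + 2 * weight m χ₀ (‖y - x‖ ^ 2) * ‖g y (y - x)‖ ^ 2) = 0 := by
  have hρ : 0 < ρ := hσ.trans hσρ
  obtain ⟨χ, hχs, hχ0, hχ1, hχz, hχlim⟩ :=
    exists_cutoff (a := σ ^ 2) (c := ρ ^ 2) (by gcongr)
  rw [← hχ₀] at hχlim
  have hχzl : ∀ k τ, τ ≤ σ ^ 2 → χ k τ = 0 := fun k τ h => hχz k τ fun h' => h'.1.not_ge h
  have hχzr : ∀ k τ, ρ ^ 2 ≤ τ → χ k τ = 0 := fun k τ h => hχz k τ fun h' => h'.2.not_ge h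
  have hws : ∀ k, ContDiff ℝ ∞ (weight m (χ k)) := fun k => contDiff_weight hσ (hχs k) (hχzl k)
  -- A bound for the weights independent of `k`. With their vanishing beyond `ρ ^ 2`, it dominates
  -- the integrands by a multiple of `‖g y‖ ^ 2`.
  set C := (σ ^ m)⁻¹ with hC
  have hC0 : 0 < C := by positivity
  have hwC : ∀ k τ, |weight m (χ k) τ| ≤ C := fun k τ => by
    rw [abs_of_nonneg (weight_nonneg (hχ0 k) τ)]
    exact weight_le hσ (hχ1 k) (hχzl k) τ
  have hw2 : ∀ k s, 0 ≤ s → |weight m (χ k) s| * s ≤ C * ρ ^ 2 := by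
    intro k s hs
    rcases le_or_gt (ρ ^ 2) s with h | h
    · simp only [weight, hχzr k s h, zero_mul, abs_zero]
      positivity
    · exact mul_le_mul (hwC k s) h.le hs hC0.le
  set f : ℕ → E m → ℝ := fun k y => ((m - 2) * profile m (χ k) ρ (‖y - x‖ ^ 2)
      - weight m (χ k) (‖y - x‖ ^ 2) * ‖y - x‖ ^ 2) * hsSq (g y)
        + 2 * weight m (χ k) (‖y - x‖ ^ 2) * ‖g y (y - x)‖ ^ 2 with hfdef
  have hzero : ∀ k, ∫ y in Metric.ball 0 1, f k y = 0 := by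
    intro k
    rw [← hu.integral_radial_eq_zero hn hb hf hg hfg hρ hxρ (contDiff_profile (hws k))
      (hasDerivAt_profile (hws k).continuous) fun s => profile_eq_zero (hχzr k)]
    refine integral_congr_ae (Eventually.of_forall fun y => ?_)
    simp only [hfdef]
    ring
  have hmeas : ∀ k, AEStronglyMeasurable (f k) (volume.restrict (Metric.ball 0 1)) := by
    intro k
    have hc1 : Continuous (profile m (χ k) ρ) := (contDiff_profile (hws k)).continuous
    have hc2 : Continuous (weight m (χ k)) := (hws k).continuous
    have h1 : Continuous fun y : E m => (m - 2) * profile m (χ k) ρ (‖y - x‖ ^ 2)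
      - weight m (χ k) (‖y - x‖ ^ 2) * ‖y - x‖ ^ 2 := by fun_prop
    have h2 : Continuous fun y : E m => 2 * weight m (χ k) (‖y - x‖ ^ 2) := by fun_prop
    have h3 : Continuous fun y : E m => y - x := by fun_prop
    have h4 : AEStronglyMeasurable (fun y => ‖g y (y - x)‖ ^ 2)
        (volume.restrict (Metric.ball 0 1)) :=
      aestronglyMeasurable_comp₂ (k := fun G w => ‖G w‖ ^ 2) hg.1 h3.aestronglyMeasurable
        (by fun_prop)
    exact (h1.aestronglyMeasurable.mul (integrable_hsSq hg).1).add
      (h2.aestronglyMeasurable.mul h4)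
  have hbound : ∀ k y, ‖f k y‖ ≤
      ((|(m : ℝ) - 2| * (C * ρ ^ 2) + C * ρ ^ 2) * m + 2 * (C * ρ ^ 2)) * ‖g y‖ ^ 2 := by
    intro k y
    have hp := abs_profile_le (hχzr k) (hwC k) hC0.le (sq_nonneg ‖y - x‖)
    have hw := hw2 k _ (sq_nonneg ‖y - x‖)
    have h1 : |(m - 2) * profile m (χ k) ρ (‖y - x‖ ^ 2)
        - weight m (χ k) (‖y - x‖ ^ 2) * ‖y - x‖ ^ 2| ≤
        |(m : ℝ) - 2| * (C * ρ ^ 2) + C * ρ ^ 2 := by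
      refine (abs_sub _ _).trans ?_
      rw [abs_mul, abs_mul, abs_of_nonneg (sq_nonneg ‖y - x‖)]
      gcongr
    have h2 : |weight m (χ k) (‖y - x‖ ^ 2)| * ‖g y (y - x)‖ ^ 2 ≤ C * ρ ^ 2 * ‖g y‖ ^ 2 := by
      calc |weight m (χ k) (‖y - x‖ ^ 2)| * ‖g y (y - x)‖ ^ 2
          ≤ |weight m (χ k) (‖y - x‖ ^ 2)| * (‖g y‖ * ‖y - x‖) ^ 2 := by
            gcongr
            exact (g y).le_opNorm _
        _ = |weight m (χ k) (‖y - x‖ ^ 2)| * ‖y - x‖ ^ 2 * ‖g y‖ ^ 2 := by ring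
        _ ≤ C * ρ ^ 2 * ‖g y‖ ^ 2 := by gcongr
    have h3 : |((m - 2) * profile m (χ k) ρ (‖y - x‖ ^ 2)
        - weight m (χ k) (‖y - x‖ ^ 2) * ‖y - x‖ ^ 2) * hsSq (g y)| ≤
        (|(m : ℝ) - 2| * (C * ρ ^ 2) + C * ρ ^ 2) * (m * ‖g y‖ ^ 2) := by
      rw [abs_mul, abs_of_nonneg (hsSq_nonneg (g y))]
      exact mul_le_mul h1 (hsSq_le _) (hsSq_nonneg _) (by positivity)
    have h4 : |2 * weight m (χ k) (‖y - x‖ ^ 2) * ‖g y (y - x)‖ ^ 2| ≤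
        2 * (C * ρ ^ 2 * ‖g y‖ ^ 2) := by
      rw [abs_mul, abs_mul, abs_of_nonneg (sq_nonneg ‖g y (y - x)‖), abs_two, mul_assoc]
      gcongr
    rw [Real.norm_eq_abs]
    refine (abs_add_le _ _).trans ((add_le_add h3 h4).trans (le_of_eq ?_))
    ring
  have hlim : Tendsto (fun k => ∫ y in Metric.ball 0 1, f k y) atTop
      (𝓝 (∫ y in Metric.ball 0 1, (((m - 2) * profile m χ₀ ρ (‖y - x‖ ^ 2)
      - weight m χ₀ (‖y - x‖ ^ 2) * ‖y - x‖ ^ 2) * hsSq (g y)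
        + 2 * weight m χ₀ (‖y - x‖ ^ 2) * ‖g y (y - x)‖ ^ 2))) := by
    refine tendsto_integral_of_dominated_convergence _ hmeas
      ((hg.integrable_norm_pow two_ne_zero).const_mul _)
      (fun k => Eventually.of_forall (hbound k)) (Eventually.of_forall fun y => ?_)
    have hp := tendsto_profile (ρ := ρ) (fun k => (hws k).continuous) hwC hχlim (‖y - x‖ ^ 2)
    have hw := tendsto_weight (m := m) (hχlim (‖y - x‖ ^ 2))
    exact (((hp.const_mul _).sub (hw.mul_const _)).mul_const _).add
      ((hw.const_mul 2).mul_const _)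
  simp only [hzero] at hlim
  exact (tendsto_nhds_unique hlim tendsto_const_nhds)

/-- The pointwise form of the integrand of the sharp identity. -/
theorem sharp_integrand_eq {x y : E m} {σ ρ : ℝ} (hσ : 0 < σ) (hσρ : σ < ρ)
    (hyσ : ‖y - x‖ ≠ σ) {F : Type*} [NormedAddCommGroup F] [InnerProductSpace ℝ F]
    (g : E m → (E m →L[ℝ] F)) {χ₀ : ℝ → ℝ} (hχ₀ : χ₀ = (Set.Ioo (σ ^ 2) (ρ ^ 2)).indicator 1) :
    ((m - 2) * profile m χ₀ ρ (‖y - x‖ ^ 2) - weight m χ₀ (‖y - x‖ ^ 2) * ‖y - x‖ ^ 2) * hsSq (g y)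
        + 2 * weight m χ₀ (‖y - x‖ ^ 2) * ‖g y (y - x)‖ ^ 2 =
      (Metric.ball x σ).indicator (fun y => σ ^ (2 - (m : ℤ)) * hsSq (g y)) y
      - (Metric.ball x ρ).indicator (fun y => ρ ^ (2 - (m : ℤ)) * hsSq (g y)) y
      + (Metric.ball x ρ \ Metric.ball x σ).indicator
        (fun y => 2 * (‖y - x‖ ^ (2 - (m : ℤ)) * ‖g y (‖y - x‖⁻¹ • (y - x))‖ ^ 2)) y := by
  set R := ‖y - x‖ with hR
  have hR0 : 0 ≤ R := norm_nonneg _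
  have hρ : 0 < ρ := hσ.trans hσρ
  have hmemσ : y ∈ Metric.ball x σ ↔ R < σ := mem_ball_iff_norm
  have hmemρ : y ∈ Metric.ball x ρ ↔ R < ρ := mem_ball_iff_norm
  rcases lt_or_ge R ρ with hRρ | hRρ
  · have hprof : ((m : ℝ) - 2) * profile m χ₀ ρ (R ^ 2) =
        max R σ ^ (2 - (m : ℤ)) - ρ ^ (2 - (m : ℤ)) := by
      rw [profile, hχ₀]
      exact integral_sharp_weight hσ hσρ hR0 hRρ
    rw [hprof, Set.indicator_of_mem (hmemρ.2 hRρ)]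
    -- In the inner ball the weight vanishes and the profile gives `σ^{2-m} - ρ^{2-m}`. In the
    -- annulus `R^{2-m}` from the profile cancels weight times `R²`, which leaves `-ρ^{2-m}` and the
    -- radial term.
    rcases lt_or_gt_of_ne hyσ with h | h
    · have hw : weight m χ₀ (R ^ 2) = 0 := by
        have : R ^ 2 ∉ Set.Ioo (σ ^ 2) (ρ ^ 2) := fun h' => by
          have : R ^ 2 < σ ^ 2 := by gcongr
          exact lt_asymm this h'.1
        rw [weight, hχ₀, Set.indicator_of_notMem this, zero_mul]
      rw [hw, Set.indicator_of_mem (hmemσ.2 h), Set.indicator_of_notMem fun h' => h'.2 (hmemσ.2 h),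
        max_eq_right h.le]
      ring
    · have hRpos : 0 < R := hσ.trans h
      have hw : weight m χ₀ (R ^ 2) = (R ^ m)⁻¹ := by
        have : R ^ 2 ∈ Set.Ioo (σ ^ 2) (ρ ^ 2) := ⟨by gcongr, by gcongr⟩
        rw [weight, hχ₀, Set.indicator_of_mem this, Pi.one_apply, one_mul, Real.sqrt_sq hR0]
      have hnσ : y ∉ Metric.ball x σ := fun h' => lt_asymm (hmemσ.1 h') h
      have hz : R ^ (2 - (m : ℤ)) = R ^ 2 * (R ^ m)⁻¹ := by
        rw [zpow_sub₀ hRpos.ne', zpow_natCast, div_eq_mul_inv]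
        norm_cast
      have hmemA : y ∈ Metric.ball x ρ \ Metric.ball x σ := ⟨hmemρ.2 hRρ, hnσ⟩
      rw [hw, Set.indicator_of_notMem hnσ, Set.indicator_of_mem hmemA,
        max_eq_left h.le, map_smul, norm_smul, norm_inv, norm_norm, ← hR, hz]
      field_simp
      ring
  · have hw : weight m χ₀ (R ^ 2) = 0 := by
      have : R ^ 2 ∉ Set.Ioo (σ ^ 2) (ρ ^ 2) := fun h' => by
        have : ρ ^ 2 ≤ R ^ 2 := by gcongr
        exact h'.2.not_ge this
      rw [weight, hχ₀, Set.indicator_of_notMem this, zero_mul]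
    have hp : profile m χ₀ ρ (R ^ 2) = 0 := by
      refine profile_eq_zero (fun τ hτ => ?_) (by gcongr)
      rw [hχ₀, Set.indicator_of_notMem fun h' => h'.2.not_ge hτ]
    have hnρ : y ∉ Metric.ball x ρ := fun h' => (hmemρ.1 h').not_ge hRρ
    have hnσ : y ∉ Metric.ball x σ := fun h' => ((hmemσ.1 h').trans hσρ).not_ge hRρ
    rw [hw, hp, Set.indicator_of_notMem hnσ, Set.indicator_of_notMem hnρ,
      Set.indicator_of_notMem fun h' => hnρ h'.1]
    ring

/-- `R^{2-m} |∂f/∂R|²` is integrable away from the centre. -/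
theorem integrableOn_radial {x : E m} {σ ρ : ℝ} (hσ : 0 < σ)
    {F : Type*} [NormedAddCommGroup F] [InnerProductSpace ℝ F] {g : E m → (E m →L[ℝ] F)}
    (hg : MemLp g 2 (volume.restrict (Metric.ball x ρ))) :
    IntegrableOn (fun y => ‖y - x‖ ^ (2 - (m : ℤ)) * ‖g y (‖y - x‖⁻¹ • (y - x))‖ ^ 2)
      (Metric.ball x ρ \ Metric.ball x σ) := by
  have hS : MeasurableSet (Metric.ball x ρ \ Metric.ball x σ) :=
    measurableSet_ball.diff measurableSet_ball
  have hg' : MemLp g 2 (volume.restrict (Metric.ball x ρ \ Metric.ball x σ)) :=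
    hg.mono_measure (Measure.restrict_mono Set.sdiff_subset le_rfl)
  have hcd : ContinuousOn (fun y : E m => ‖y - x‖ ^ (2 - (m : ℤ)))
      (Metric.closedBall x ρ \ Metric.ball x σ) := by
    refine ContinuousOn.zpow₀ (by fun_prop) _ fun y hy => Or.inl ?_
    have h := hy.2
    rw [mem_ball_iff_norm, not_lt] at h
    exact (hσ.trans_le h).ne'
  have hcompact : IsCompact (Metric.closedBall x ρ \ Metric.ball x σ) :=
    (isCompact_closedBall x ρ).diff Metric.isOpen_ball
  obtain ⟨C, hC⟩ := hcompact.exists_bound_of_continuousOn hcd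
  have hsub : Metric.ball x ρ \ Metric.ball x σ ⊆ Metric.closedBall x ρ \ Metric.ball x σ :=
    Set.sdiff_subset_sdiff_left Metric.ball_subset_closedBall
  have hm1 : AEStronglyMeasurable (fun y : E m => ‖y - x‖ ^ (2 - (m : ℤ)))
      (volume.restrict (Metric.ball x ρ \ Metric.ball x σ)) :=
    (hcd.mono hsub).aestronglyMeasurable hS
  have hm2 : Measurable fun y : E m => ‖y - x‖⁻¹ • (y - x) := by fun_prop
  have hm3 : AEStronglyMeasurable (fun y => ‖g y (‖y - x‖⁻¹ • (y - x))‖ ^ 2)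
      (volume.restrict (Metric.ball x ρ \ Metric.ball x σ)) :=
    aestronglyMeasurable_comp₂ (k := fun G w => ‖G w‖ ^ 2) hg'.1 hm2.aestronglyMeasurable
      (by fun_prop)
  refine Integrable.mono' ((hg'.integrable_norm_pow two_ne_zero).const_mul C) (hm1.mul hm3) ?_
  rw [ae_restrict_iff' hS]
  refine Eventually.of_forall fun y hy => ?_
  have h1 : ‖g y (‖y - x‖⁻¹ • (y - x))‖ ≤ ‖g y‖ := by
    refine ((g y).le_opNorm _).trans (mul_le_of_le_one_right (norm_nonneg _) ?_)
    rw [norm_smul, norm_inv, norm_norm]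
    exact inv_mul_le_one
  rw [norm_mul, norm_pow, norm_norm]
  have h2 := hC y (hsub hy)
  gcongr
  exact (norm_nonneg _).trans h2

/-- The monotonicity identity for a representing weak gradient. -/
theorem IsDirMinimizing.monotonicity_hsSq (hn0 : n ≠ 0) (hu : IsDirMinimizing u)
    (hb : IsBiLipschitz (xi (Q := Q) b))
    (hf : MemLp (fun y => xi b (u y)) 2 (volume.restrict (Metric.ball 0 1)))
    (hg : MemLp g 2 (volume.restrict (Metric.ball 0 1)))
    (hfg : IsWeakGrad (Metric.ball 0 1) (fun y => xi b (u y)) g)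
    {x : E m} {σ ρ : ℝ} (hσ : 0 < σ) (hσρ : σ < ρ)
    (hclosed : Metric.closedBall x ρ ⊆ Metric.ball 0 1) :
    ρ ^ (2 - (m : ℤ)) * (∫ y in Metric.ball x ρ, hsSq (g y))
        - σ ^ (2 - (m : ℤ)) * (∫ y in Metric.ball x σ, hsSq (g y))
      = 2 * ∫ y in Metric.ball x ρ \ Metric.ball x σ,
          ‖y - x‖ ^ (2 - (m : ℤ)) * ‖g y (‖y - x‖⁻¹ • (y - x))‖ ^ 2 := by
  have hBρ : Metric.ball x ρ ⊆ Metric.ball (0 : E m) 1 :=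
    Metric.ball_subset_closedBall.trans hclosed
  have hBσρ : Metric.ball x σ ⊆ Metric.ball x ρ := Metric.ball_subset_ball hσρ.le
  have hgρ : MemLp g 2 (volume.restrict (Metric.ball x ρ)) :=
    hg.mono_measure (Measure.restrict_mono hBρ le_rfl)
  have hann : Metric.ball x ρ \ Metric.ball x σ ⊆ Metric.ball 0 1 := Set.sdiff_subset.trans hBρ
  have hiρ : IntegrableOn (fun y => hsSq (g y)) (Metric.ball x ρ) := integrable_hsSq hgρ
  have hiσ : IntegrableOn (fun y => hsSq (g y)) (Metric.ball x σ) := hiρ.mono_set hBσρ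
  have hir := integrableOn_radial hσ hgρ
  have hmain := hu.integral_sharp_eq_zero hn0 hb hf hg hfg hσ hσρ hclosed rfl
  -- The inner sphere belongs to the annulus but not to the support of the sharp weight; being a
  -- null set, it can be discarded.
  have hsphere : ∀ᵐ y ∂(volume.restrict (Metric.ball (0 : E m) 1)), ‖y - x‖ ≠ σ := by
    have h0 : volume (Metric.sphere x σ) = 0 :=
      Measure.addHaar_sphere_of_ne_zero volume x hσ.ne'
    refine ae_restrict_of_ae ((measure_eq_zero_iff_ae_notMem.1 h0).mono fun y hy h => hy ?_)
    rwa [mem_sphere_iff_norm]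
  have hptw := hsphere.mono fun y hy => sharp_integrand_eq hσ hσρ hy g rfl
  rw [integral_congr_ae hptw] at hmain
  have hI1 : Integrable ((Metric.ball x σ).indicator fun y => σ ^ (2 - (m : ℤ)) * hsSq (g y))
      (volume.restrict (Metric.ball 0 1)) :=
    (IntegrableOn.integrable_indicator (hiσ.const_mul _) measurableSet_ball).restrict
  have hI2 : Integrable ((Metric.ball x ρ).indicator fun y => ρ ^ (2 - (m : ℤ)) * hsSq (g y))
      (volume.restrict (Metric.ball 0 1)) :=
    (IntegrableOn.integrable_indicator (hiρ.const_mul _) measurableSet_ball).restrict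
  have hAm : MeasurableSet (Metric.ball x ρ \ Metric.ball x σ) :=
    measurableSet_ball.diff measurableSet_ball
  have hI3 : Integrable ((Metric.ball x ρ \ Metric.ball x σ).indicator fun y =>
      2 * (‖y - x‖ ^ (2 - (m : ℤ)) * ‖g y (‖y - x‖⁻¹ • (y - x))‖ ^ 2))
      (volume.restrict (Metric.ball 0 1)) :=
    (IntegrableOn.integrable_indicator (hir.const_mul 2) hAm).restrict
  have hset : ∀ {S : Set (E m)} (k : E m → ℝ), MeasurableSet S → S ⊆ Metric.ball 0 1 →
      ∫ y in Metric.ball 0 1, S.indicator k y = ∫ y in S, k y := by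
    intro S k hS hSB
    rw [setIntegral_indicator hS, Set.inter_eq_right.2 hSB]
  have hsplit : ∫ y in Metric.ball (0 : E m) 1,
      ((Metric.ball x σ).indicator (fun y => σ ^ (2 - (m : ℤ)) * hsSq (g y)) y
      - (Metric.ball x ρ).indicator (fun y => ρ ^ (2 - (m : ℤ)) * hsSq (g y)) y
      + (Metric.ball x ρ \ Metric.ball x σ).indicator
        (fun y => 2 * (‖y - x‖ ^ (2 - (m : ℤ)) * ‖g y (‖y - x‖⁻¹ • (y - x))‖ ^ 2)) y) = 0 :=
    hmain
  have hI12 := hI1.sub hI2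
  simp only [Pi.sub_def] at hI12
  rw [integral_add hI12 hI3, integral_sub hI1 hI2,
    hset _ measurableSet_ball (hBσρ.trans hBρ), hset _ measurableSet_ball hBρ, hset _ hAm hann,
    integral_const_mul, integral_const_mul, integral_const_mul] at hsplit
  linarith

end Monotonicity

end MultiValued

end

/-! ### The monotonicity formula in terms of approximate derivatives. -/

open MultiValued in
theorem theorem9p1 (m n Q : ℕ) (hm : 2 ≤ m) (hn : 2 ≤ n)
    (u : MultiValued.E m → MultiValued.QPoint Q n) (hu : MultiValued.IsDirMinimizing u)
    (x : MultiValued.E m) (ρ₀ : ℝ)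
    (hball : Metric.ball x ρ₀ ⊆ Metric.ball (0 : MultiValued.E m) 1)
    (σ ρ : ℝ) (hσ : 0 < σ) (hσρ : σ < ρ) (hρ : ρ < ρ₀) :
    (∀ᵐ y ∂(volume.restrict (Metric.ball (0 : MultiValued.E m) 1)),
      MultiValued.ApproxDifferentiableAt u y) ∧
    IntegrableOn (fun y => MultiValued.derivSq u y) (Metric.ball x ρ) volume ∧
    IntegrableOn (fun y => ‖y - x‖ ^ (2 - (m : ℤ)) * MultiValued.radialDerivSq u x y)
      (Metric.ball x ρ \ Metric.ball x σ) volume ∧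
    ρ ^ (2 - (m : ℤ)) * (∫ y in Metric.ball x ρ, MultiValued.derivSq u y)
        - σ ^ (2 - (m : ℤ)) * (∫ y in Metric.ball x σ, MultiValued.derivSq u y)
      = 2 * ∫ y in Metric.ball x ρ \ Metric.ball x σ,
          ‖y - x‖ ^ (2 - (m : ℤ)) * MultiValued.radialDerivSq u x y := by
  obtain ⟨-, K, b, hb, hf, g, hg, hfg⟩ := hu.1
  have hn0 : n ≠ 0 := by lia
  have hder := ae_dirDerivSq_eq hn0 Metric.isOpen_ball hb (hf.integrable one_le_two)
    (hg.integrable one_le_two) hfg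
  -- The strict inequality `ρ < ρ₀` makes the support of the radial fields compact in the unit ball.
  have hclosed : Metric.closedBall x ρ ⊆ Metric.ball (0 : E m) 1 :=
    (Metric.closedBall_subset_ball hρ).trans hball
  have hBρ : Metric.ball x ρ ⊆ Metric.ball (0 : E m) 1 :=
    Metric.ball_subset_closedBall.trans hclosed
  have hBσρ : Metric.ball x σ ⊆ Metric.ball x ρ := Metric.ball_subset_ball hσρ.le
  have hgρ : MemLp g 2 (volume.restrict (Metric.ball x ρ)) :=
    hg.mono_measure (Measure.restrict_mono hBρ le_rfl)
  have hderS : ∀ S : Set (E m), S ⊆ Metric.ball 0 1 →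
      ∀ᵐ y ∂(volume.restrict S), ∀ v, dirDerivSq u y v = ‖g y v‖ ^ 2 := fun S hS =>
    (hder.filter_mono (ae_mono (Measure.restrict_mono hS le_rfl))).mono fun y hy => hy.2
  have heq : ∀ S : Set (E m), S ⊆ Metric.ball 0 1 →
      (fun y => derivSq u y) =ᵐ[volume.restrict S] fun y => hsSq (g y) := fun S hS =>
    (hderS S hS).mono fun y hy => by simp only [derivSq, hsSq, hy]
  have hann : Metric.ball x ρ \ Metric.ball x σ ⊆ Metric.ball 0 1 := Set.sdiff_subset.trans hBρ
  have heqr : (fun y => ‖y - x‖ ^ (2 - (m : ℤ)) * radialDerivSq u x y)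
      =ᵐ[volume.restrict (Metric.ball x ρ \ Metric.ball x σ)]
        fun y => ‖y - x‖ ^ (2 - (m : ℤ)) * ‖g y (‖y - x‖⁻¹ • (y - x))‖ ^ 2 :=
    (hderS _ hann).mono fun y hy => by simp only [radialDerivSq, hy]
  have hiρ : IntegrableOn (fun y => hsSq (g y)) (Metric.ball x ρ) := integrable_hsSq hgρ
  have hiσ : IntegrableOn (fun y => hsSq (g y)) (Metric.ball x σ) := hiρ.mono_set hBσρ
  have hir := integrableOn_radial hσ hgρ
  refine ⟨hder.mono fun y hy => hy.1, hiρ.congr (heq _ hBρ).symm, hir.congr heqr.symm, ?_⟩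
  rw [integral_congr_ae (heq _ hBρ), integral_congr_ae (heq _ (hBσρ.trans hBρ)),
    integral_congr_ae heqr]
  exact hu.monotonicity_hsSq hn0 hb hf hg hfg hσ hσρ hclosed
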